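/- **Definitions.** Directed graphs are finite, without parallel edges. A directed graph is *strongly biconnected* if it is strongly connected and its underlying undirected graph is biconnected, i.e. connected and not disconnected by the deletion of any one vertex (a single vertex and a single edge are biconnected). Its *strongly biconnected components* are its maximal strongly biconnected subgraphs. A vertex $b$ of a strongly biconnected graph $H$ is a *b-articulation point* of $H$ if $H\setminus\{b\}$ is not strongly biconnected. A directed graph is *2-vertex-connected* (respectively *2-vertex strongly biconnected*) if it has at least three vertices, is strongly connected (respectively strongly biconnected), and remains so after the deletion of any one vertex. **Algorithm 1.** Input: a 2-vertex strongly biconnected directed graph $G=(V,E)$. 1. Find a minimal 2-vertex-connected spanning subgraph $G_1=(V,E_1)$ of $G$ (no proper subset of $E_1$ gives a 2-vertex-connected graph on $V$). 2. If $G_1$ is 2-vertex strongly biconnected, output $G_1$ and stop. Otherwise put $E_{2s}:=E_1$ and identify the b-articulation points of $G_1$. 3. For every b-articulation point $b$ of $G_1$: while $(V,E_{2s})\setminus\{b\}$ is not strongly biconnected, calculate the strongly biconnected components of $(V,E_{2s})\setminus\{b\}$, find an edge $(u,w)\in E\setminus E_{2s}$ with $u,w\ne b$ such that no such component contains both $u$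 and $w$, and add $(u,w)$ to $E_{2s}$. 4. Output $(V,E_{2s})$. **Theorem.** Algorithm 1 runs in $O(n^2m)$ time, where $n=|V|$ and $m=|E|$. Precisely: there are a program $P$ for a random access machine and constants $c,C$ such that for every 2-vertex strongly biconnected directed graph $G$ with vertex set $\{0,\dots,n-1\}$ and $m$ edges, given by $n$, $m$ and the list of its edges in any order, the program $P$ performs an execution of Algorithm 1 on $G$ and halts after at most $C\,n^2m$ steps. Here the words of the machine hold the natural numbers below $(n+2)^c$ (that is, $O(\log n)$ bits), a memory access, an arithmetic operation (addition, truncated subtraction, multiplication, integer division, comparison), a test or an output operation on words takes one step, and performing an execution means that $P$ writes, in this order, the results of the steps of one execution of Algorithm 1: the edges of $G_1$, the truth value of the test in step 2, the list of b-articulation points, for each of these points the point itself and, for each round of its loop, the truth value of the test, the vertex sets of the strongly biconnected components and the added edge, and at the end the edges of the output graph. -/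

import Mathlib

/-! ### Directed graphs -/

namespace SB

/-- The directed graph with vertex set `V` and edge set `F`. -/
def graph {V : Type*} (F : Finset (V × V)) : Digraph V where
  Adj u v := (u, v) ∈ F

/-- The subgraph of `D` induced on the vertex set `S`. -/
def induce {V : Type*} (D : Digraph V) (S : Set V) : Digraph S where
  Adj u v := D.Adj u v

/-- `D ∖ {b}`: the subgraph induced on all vertices other than `b`. -/
abbrev deleteVertex {V : Type*} (D : Digraph V) (b : V) : Digraph ({b}ᶜ : Set V) :=
  induce D {b}ᶜ

/-- There is at least one vertex, and every vertex is reachable from every other one. -/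
def StronglyConnected {V : Type*} (D : Digraph V) : Prop :=
  Nonempty V ∧ ∀ u v : V, Relation.ReflTransGen D.Adj u v

/-- An undirected graph is biconnected if it is connected and deleting any one vertex does not
disconnect it (so the one-vertex graph and the graph consisting of one edge are biconnected). -/
def Biconnected {V : Type*} (H : SimpleGraph V) : Prop :=
  H.Connected ∧ ∀ v : V, (H.induce {v}ᶜ).Preconnected

/-- Strongly connected, with biconnected underlying undirected graph. -/
def StronglyBiconnected {V : Type*} (D : Digraph V) : Prop :=
  StronglyConnected D ∧ Biconnected D.toSimpleGraphInclusive

/-- At least three vertices, strongly connected, and without strong articulation points. -/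
def TwoVertexConnected {V : Type*} (D : Digraph V) : Prop :=
  3 ≤ Nat.card V ∧ StronglyConnected D ∧ ∀ w : V, StronglyConnected (deleteVertex D w)

/-- At least three vertices, strongly biconnected, and still strongly biconnected after the
deletion of any one vertex. -/
def TwoVertexStronglyBiconnected {V : Type*} (D : Digraph V) : Prop :=
  3 ≤ Nat.card V ∧ StronglyBiconnected D ∧ ∀ w : V, StronglyBiconnected (deleteVertex D w)

/-- `b` is a b-articulation point of `D`. -/
def IsBArticulationPoint {V : Type*} (D : Digraph V) (b : V) : Prop :=
  StronglyBiconnected D ∧ ¬ StronglyBiconnected (deleteVertex D b)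

/-- `S` is the vertex set of a strongly biconnected component of `D ∖ {b}`, that is, of a maximal
strongly biconnected subgraph of `D ∖ {b}`. -/
def IsSBComponent {V : Type*} (D : Digraph V) (b : V) (S : Set V) : Prop :=
  Maximal (fun S : Set V => S ⊆ {b}ᶜ ∧ StronglyBiconnected (induce D S)) S

/-- `(V, E₁)` is a minimal 2-vertex-connected spanning subgraph of `(V, E)`: no proper subset
of `E₁` gives a 2-vertex-connected graph. -/
def IsMinimalTwoVertexConnected {V : Type*} (E E₁ : Finset (V × V)) : Prop :=
  Minimal (fun F : Finset (V × V) => F ⊆ E ∧ TwoVertexConnected (graph F)) E₁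

/-- `cs` lists the strongly biconnected components of `D ∖ {b}`, each exactly once, and each of
them as a list of its vertices without repetition. -/
def ListsSBComponents {V : Type*} [DecidableEq V] (D : Digraph V) (b : V)
    (cs : List (List V)) : Prop :=
  (∀ c ∈ cs, c.Nodup) ∧ (cs.map List.toFinset).Nodup ∧
    ∀ S : Finset V, S ∈ cs.map List.toFinset ↔ IsSBComponent D b (S : Set V)

/-! ### The algorithm

The executions of the algorithm are described together with their transcripts. A transcript is
the list of everything that the lines of the algorithm compute, in the order in which they compute
it, written as natural numbers: vertices are their own numbers, a truth value is `1` or `0`, and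
a list is preceded by its length. -/

def encodeVertices {n : ℕ} (c : List (Fin n)) : List ℕ :=
  c.length :: c.map Fin.val

def encodeEdge {n : ℕ} (e : Fin n × Fin n) : List ℕ :=
  [(e.1 : ℕ), (e.2 : ℕ)]

def encodeEdges {n : ℕ} (es : List (Fin n × Fin n)) : List ℕ :=
  es.length :: es.flatMap encodeEdge

def encodeComponents {n : ℕ} (cs : List (List (Fin n))) : List ℕ :=
  cs.length :: cs.flatMap encodeVertices

/-- `WhileLoop E b F τ F'`: started with current edge set `F`, the loop
"while `(V, F) ∖ {b}` is not strongly biconnected, calculate its strongly biconnected components,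
find an edge `(u, w) ∈ E ∖ F` whose ends are vertices of `(V, F) ∖ {b}` that are not in the same
component, and add it to `F`" can end with the edge set `F'` and the transcript `τ`. -/
inductive WhileLoop {n : ℕ} (E : Finset (Fin n × Fin n)) (b : Fin n) :
    Finset (Fin n × Fin n) → List ℕ → Finset (Fin n × Fin n) → Prop
  | done {F : Finset (Fin n × Fin n)}
      (test : StronglyBiconnected (deleteVertex (graph F) b)) :
      WhileLoop E b F [0] F
  | step {F F' : Finset (Fin n × Fin n)} {τ : List ℕ}
      (test : ¬ StronglyBiconnected (deleteVertex (graph F) b))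
      (cs : List (List (Fin n))) (comps : ListsSBComponents (graph F) b cs)
      (u w : Fin n) (mem : (u, w) ∈ E \ F) (hu : u ≠ b) (hw : w ≠ b)
      (sep : ∀ c ∈ cs, ¬ (u ∈ c ∧ w ∈ c))
      (rest : WhileLoop E b (insert (u, w) F) τ F') :
      WhileLoop E b F ([1] ++ encodeComponents cs ++ encodeEdge (u, w) ++ τ) F'

/-- The while loop is executed for the vertices of the given list, one after the other. -/
inductive ForLoop {n : ℕ} (E : Finset (Fin n × Fin n)) :
    List (Fin n) → Finset (Fin n × Fin n) → List ℕ → Finset (Fin n × Fin n) → Prop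
  | nil {F : Finset (Fin n × Fin n)} : ForLoop E [] F [] F
  | cons {b : Fin n} {bs : List (Fin n)} {F F' F'' : Finset (Fin n × Fin n)} {τ τ' : List ℕ}
      (first : WhileLoop E b F τ F') (rest : ForLoop E bs F' τ' F'') :
      ForLoop E (b :: bs) F ([(b : ℕ)] ++ τ ++ τ') F''

/-- `Execution E τ`: the algorithm, run on the graph `(V, E)`, has an execution with
transcript `τ`. -/
inductive Execution {n : ℕ} (E : Finset (Fin n × Fin n)) : List ℕ → Prop
  | early (es₁ : List (Fin n × Fin n)) (nodup : es₁.Nodup)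
      (minimal : IsMinimalTwoVertexConnected E es₁.toFinset)
      (test : TwoVertexStronglyBiconnected (graph es₁.toFinset))
      (es : List (Fin n × Fin n)) (nodup_out : es.Nodup) (out : es.toFinset = es₁.toFinset) :
      Execution E (encodeEdges es₁ ++ [1] ++ encodeEdges es)
  | main (es₁ : List (Fin n × Fin n)) (nodup : es₁.Nodup)
      (minimal : IsMinimalTwoVertexConnected E es₁.toFinset)
      (test : ¬ TwoVertexStronglyBiconnected (graph es₁.toFinset))
      (bs : List (Fin n)) (nodup_bs : bs.Nodup)
      (mem_bs : ∀ b : Fin n, b ∈ bs ↔ IsBArticulationPoint (graph es₁.toFinset) b)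
      (τ : List ℕ) (F : Finset (Fin n × Fin n)) (loop : ForLoop E bs es₁.toFinset τ F)
      (es : List (Fin n × Fin n)) (nodup_out : es.Nodup) (out : es.toFinset = F) :
      Execution E (encodeEdges es₁ ++ [0] ++ encodeVertices bs ++ τ ++ encodeEdges es)

/-! ### Random access machines with bounded words

Programs act on variables, on arrays (both numbered by constants of the program) and on a
write-only output tape. All values are natural numbers below a bound `W`; a program whose
computation leaves this range has no execution. -/

/-- The memory of the machine and the contents of its output tape. -/
structure State where
  var : ℕ → ℕ
  arr : ℕ → ℕ → ℕ
  out : List ℕ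

/-- Arithmetic operations: subtraction is truncated, division rounds down, and the comparisons
give `1` for true and `0` for false. -/
inductive Op
  | add | sub | mul | div | lt | eq

def Op.eval : Op → ℕ → ℕ → ℕ
  | .add, a, b => a + b
  | .sub, a, b => a - b
  | .mul, a, b => a * b
  | .div, a, b => a / b
  | .lt, a, b => if a < b then 1 else 0
  | .eq, a, b => if a = b then 1 else 0

inductive Expr
  | lit (k : ℕ)
  | var (x : ℕ)
  | get (a : ℕ) (i : Expr)
  | op (o : Op) (e₁ e₂ : Expr)

def Expr.eval (σ : State) : Expr → ℕ
  | .lit k => k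
  | .var x => σ.var x
  | .get a i => σ.arr a (i.eval σ)
  | .op o e₁ e₂ => o.eval (e₁.eval σ) (e₂.eval σ)

/-- The value of the expression and all intermediate values are below `W`. -/
def Expr.Fits (W : ℕ) (σ : State) : Expr → Prop
  | .lit k => k < W
  | .var x => σ.var x < W
  | .get a i => i.Fits W σ ∧ σ.arr a (i.eval σ) < W
  | .op o e₁ e₂ => e₁.Fits W σ ∧ e₂.Fits W σ ∧ o.eval (e₁.eval σ) (e₂.eval σ) < W

/-- The number of steps that the evaluation of an expression takes: one for each constant, each
memory access and each arithmetic operation. -/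
def Expr.cost : Expr → ℕ
  | .lit _ => 1
  | .var _ => 1
  | .get _ i => i.cost + 1
  | .op _ e₁ e₂ => e₁.cost + e₂.cost + 1

inductive Program
  | skip
  | assign (x : ℕ) (e : Expr)
  | store (a : ℕ) (i e : Expr)
  | emit (e : Expr)
  | seq (p q : Program)
  | ite (e : Expr) (p q : Program)
  | while (e : Expr) (p : Program)

def State.setVar (σ : State) (x v : ℕ) : State :=
  { σ with var := Function.update σ.var x v }

def State.setArr (σ : State) (a i v : ℕ) : State :=
  { σ with arr := Function.update σ.arr a (Function.update (σ.arr a) i v) }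

def State.write (σ : State) (v : ℕ) : State :=
  { σ with out := σ.out ++ [v] }

/-- `Exec W p σ t σ'`: on a machine whose words hold the numbers below `W`, the program `p`,
started in the state `σ`, halts after exactly `t` steps in the state `σ'`. A condition counts as
true if its value is not zero. -/
inductive Exec (W : ℕ) : Program → State → ℕ → State → Prop
  | skip {σ : State} : Exec W .skip σ 1 σ
  | assign {σ : State} {x : ℕ} {e : Expr} (fits : e.Fits W σ) :
      Exec W (.assign x e) σ (e.cost + 1) (σ.setVar x (e.eval σ))
  | store {σ : State} {a : ℕ} {i e : Expr} (fits_i : i.Fits W σ) (fits_e : e.Fits W σ) :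
      Exec W (.store a i e) σ (i.cost + e.cost + 1) (σ.setArr a (i.eval σ) (e.eval σ))
  | emit {σ : State} {e : Expr} (fits : e.Fits W σ) :
      Exec W (.emit e) σ (e.cost + 1) (σ.write (e.eval σ))
  | seq {σ σ' σ'' : State} {p q : Program} {t t' : ℕ}
      (first : Exec W p σ t σ') (second : Exec W q σ' t' σ'') :
      Exec W (.seq p q) σ (t + t') σ''
  | ite_true {σ σ' : State} {e : Expr} {p q : Program} {t : ℕ}
      (fits : e.Fits W σ) (test : e.eval σ ≠ 0) (branch : Exec W p σ t σ') :
      Exec W (.ite e p q) σ (e.cost + 1 + t) σ'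
  | ite_false {σ σ' : State} {e : Expr} {p q : Program} {t : ℕ}
      (fits : e.Fits W σ) (test : e.eval σ = 0) (branch : Exec W q σ t σ') :
      Exec W (.ite e p q) σ (e.cost + 1 + t) σ'
  | while_true {σ σ' σ'' : State} {e : Expr} {p : Program} {t t' : ℕ}
      (fits : e.Fits W σ) (test : e.eval σ ≠ 0) (body : Exec W p σ t σ')
      (rest : Exec W (.while e p) σ' t' σ'') :
      Exec W (.while e p) σ (e.cost + 1 + t + t') σ''
  | while_false {σ : State} {e : Expr} {p : Program}
      (fits : e.Fits W σ) (test : e.eval σ = 0) :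
      Exec W (.while e p) σ (e.cost + 1) σ

/-- The initial state for the graph with vertices `0, …, n - 1` whose edges are listed by `L`:
variable `0` holds `n`, variable `1` holds the number of edges, array `0` holds the tails and
array `1` the heads of the edges, all the rest of the memory is `0`, and the output tape is
empty. -/
def input (n : ℕ) (L : List (Fin n × Fin n)) : State where
  var x := if x = 0 then n else if x = 1 then L.length else 0
  arr a i :=
    if a = 0 then (L.map fun e => (e.1 : ℕ)).getD i 0
    else if a = 1 then (L.map fun e => (e.2 : ℕ)).getD i 0
    else 0
  out := []

end SB

/-! In a 2-vertex-connected graph every vertex has an outgoing edge, so `n ≤ m`, and terms such as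
`n ^ 3` are within the budget `n ^ 2 * m`.

A minimal 2-vertex-connected spanning subgraph is found greedily, each edge being tried once. Adding
edges preserves 2-vertex-connectivity, so an edge that could not be spared when it was tried cannot
be spared later. The edge `(u, w)` can be spared iff, without it, `u` still reaches `w` and no third
vertex separates them (`twoVertexConnected_erase_iff`). By the two-path case of Menger's theorem
this takes two searches of time `O(n ^ 2)`, the second one in a residual graph
(`residual_reachIn_iff`).

Every later graph `(V, F)` contains that subgraph, so it stays strongly connected when `b` is
deleted. A path between two vertices of a block can be shortened to stay inside the block; hence the
blocks of the underlying undirected graph are strongly connected, and they are exactly the strongly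
biconnected components (`IsBlock.stronglyBiconnected`, `isSBComponent_iff`). Only undirected
separation by one vertex, expressed by `Same`, has to be computed. The blocks are stored as labels
on the edges of a rooted spanning tree: each edge of the graph merges the labels on the tree path
between its ends. Afterwards two vertices are inseparable iff the tree path between them carries a
single label (`LabelsSound.same`, `LabelsComplete.mono_of_same`). Following a tree path and merging
takes time `O(n)`, so the blocks for one `b` take `O(n ^ 2 + n * m)`, and those for all `b` take
`O(n ^ 2 * m)`.

The while loop for `b` is realised by one pass over the edges of `E`. Since `Same` only grows with
`F`, an edge once passed never qualifies again; and when no edge of `E` is separated, the graph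
without `b` is strongly biconnected because `(V, E)` without `b` is (`stronglyBiconnected_of_same`).
Reporting the components costs `O(n ^ 2)` for each added edge, but an edge is added only once in the
whole run, so all additions together cost `O(n ^ 2 * m)`. This amortisation is the content of
`scan_spec` and `treatPoints_spec`.

The program is written with counting loops, whose running time can be computed, and then compiled.
In `Cmd.exec` the memory contents grow by a bounded amount per step and expressions have bounded
size, so words of polynomial range suffice. -/

namespace SB

/-! ### Reachability inside a set of vertices -/

/-- `u` reaches `w` along edges of `R` with both ends in `S`. -/
def ReachIn {V : Type*} (R : V → V → Prop) (S : Set V) : V → V → Prop :=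
  Relation.ReflTransGen fun x y => x ∈ S ∧ y ∈ S ∧ R x y

section ReachIn

variable {V W : Type*} {R R' : V → V → Prop} {S T : Set V}

theorem ReachIn.refl (u : V) : ReachIn R S u u := Relation.ReflTransGen.refl

theorem ReachIn.trans {u v w : V} (h : ReachIn R S u v) (h' : ReachIn R S v w) :
    ReachIn R S u w := Relation.ReflTransGen.trans h h'

theorem ReachIn.single {u w : V} (hu : u ∈ S) (hw : w ∈ S) (h : R u w) : ReachIn R S u w :=
  Relation.ReflTransGen.single ⟨hu, hw, h⟩

theorem ReachIn.mono {u w : V} (hR : ∀ x ∈ S, ∀ y ∈ S, R x y → R' x y) (hS : S ⊆ T)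
    (h : ReachIn R S u w) : ReachIn R' T u w := by
  induction h with
  | refl => exact Relation.ReflTransGen.refl
  | tail _ h ih => exact ih.tail ⟨hS h.1, hS h.2.1, hR _ h.1 _ h.2.1 h.2.2⟩

theorem ReachIn.symm {u w : V} (hR : ∀ x y, R x y → R y x) (h : ReachIn R S u w) :
    ReachIn R S w u := by
  induction h with
  | refl => exact ReachIn.refl _
  | tail _ h ih => exact (ReachIn.single h.2.1 h.1 (hR _ _ h.2.2)).trans ih

/-- If every edge of `R` in `S` can be replaced by a path, then so can every path. -/
theorem ReachIn.replace {u w : V} (hR : ∀ x ∈ S, ∀ y ∈ S, R x y → ReachIn R' T x y)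
    (h : ReachIn R S u w) : ReachIn R' T u w := by
  induction h with
  | refl => exact ReachIn.refl _
  | tail _ h ih => exact ih.trans (hR _ h.1 _ h.2.1 h.2.2)

theorem ReachIn.mem_closed {P : V → Prop} {u w : V} (h : ReachIn R S u w) (hu : P u)
    (hP : ∀ x ∈ S, ∀ y ∈ S, R x y → P x → P y) : P w := by
  induction h with
  | refl => exact hu
  | tail _ h ih => exact hP _ h.1 _ h.2.1 h.2.2 ih

theorem ReachIn.mem_right {u w : V} (h : ReachIn R S u w) (hu : u ∈ S) : w ∈ S :=
  h.mem_closed hu fun _ _ _ hy _ _ => hy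

/-- The graphs in the definitions live on subtypes, and on subtypes of subtypes; this moves their
paths into `V`. Adjacency is compared for distinct vertices only, because a simple graph has no
loops and loops do not affect reachability. -/
theorem reflTransGen_iff_reachIn {f : W → V} (hf : f.Injective) {A : W → W → Prop}
    (hA : ∀ a c, a ≠ c → (A a c ↔ R (f a) (f c))) (a c : W) :
    Relation.ReflTransGen A a c ↔ ReachIn R (Set.range f) (f a) (f c) := by
  constructor
  · intro h
    induction h with
    | refl => exact ReachIn.refl _
    | @tail x y _ h ih =>
      by_cases hxy : x = y
      · exact hxy ▸ ih
      · exact ih.trans (ReachIn.single ⟨x, rfl⟩ ⟨y, rfl⟩ ((hA x y hxy).1 h))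
  · intro h
    suffices H : ∀ y, ReachIn R (Set.range f) (f a) y → ∀ c, f c = y →
        Relation.ReflTransGen A a c from H _ h c rfl
    intro y h
    induction h with
    | refl => intro c hc; rw [hf hc]
    | tail _ h ih =>
      rintro c rfl
      obtain ⟨⟨x, rfl⟩, -, hxc⟩ := h
      by_cases hne : x = c
      · exact hne ▸ ih x rfl
      · exact (ih x rfl).tail ((hA x c hne).2 hxc)

end ReachIn

/-! ### The connectivity notions in terms of `ReachIn` -/

/-- The adjacency relation of the underlying undirected graph. -/
def Sym {V : Type*} (F : Finset (V × V)) (x y : V) : Prop := (x, y) ∈ F ∨ (y, x) ∈ F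

/-- `u` and `w` are connected in the underlying undirected graph without `b` and `v`. -/
def Link {V : Type*} (F : Finset (V × V)) (b v u w : V) : Prop :=
  ReachIn (Sym F) {x | x ≠ b ∧ x ≠ v} u w

/-- No vertex separates `u` from `w` in the underlying undirected graph without `b`. -/
def Same {V : Type*} (F : Finset (V × V)) (b u w : V) : Prop :=
  ∀ v, v ≠ u → v ≠ w → Link F b v u w

section Bridge

variable {V : Type*} {F : Finset (V × V)}

theorem Sym.symm {x y : V} (h : Sym F x y) : Sym F y x := Or.symm h

theorem stronglyConnected_induce (S : Set V) :
    StronglyConnected (induce (graph F) S) ↔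
      S.Nonempty ∧ ∀ u ∈ S, ∀ w ∈ S, ReachIn (fun x y => (x, y) ∈ F) S u w := by
  have key := fun a c : S => reflTransGen_iff_reachIn (R := fun x y => (x, y) ∈ F)
    (f := (Subtype.val : S → V)) Subtype.val_injective (A := (induce (graph F) S).Adj)
    (fun _ _ _ => Iff.rfl) a c
  simp only [StronglyConnected, key, Subtype.range_coe, Set.nonempty_coe_sort, Subtype.forall]

theorem stronglyConnected_graph :
    StronglyConnected (graph F) ↔
      Nonempty V ∧ ∀ u w, ReachIn (fun x y => (x, y) ∈ F) Set.univ u w := by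
  have key := fun a c : V => reflTransGen_iff_reachIn (R := fun x y => (x, y) ∈ F)
    (f := (id : V → V)) Function.injective_id (A := (graph F).Adj) (fun _ _ _ => Iff.rfl) a c
  simp only [StronglyConnected, key, Set.range_id, id]

theorem inclusive_adj {W : Type*} (D : Digraph W) (a c : W) :
    D.toSimpleGraphInclusive.Adj a c ↔ a ≠ c ∧ (D.Adj a c ∨ D.Adj c a) := Iff.rfl

theorem preconnected_induce (S : Set V) :
    (induce (graph F) S).toSimpleGraphInclusive.Preconnected ↔
      ∀ u ∈ S, ∀ w ∈ S, ReachIn (Sym F) S u w := by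
  have key := fun a c : S => reflTransGen_iff_reachIn (R := Sym F)
    (f := (Subtype.val : S → V)) Subtype.val_injective
    (A := (induce (graph F) S).toSimpleGraphInclusive.Adj)
    (fun a c h => by rw [inclusive_adj]; exact ⟨fun h => h.2, fun h' => ⟨h, h'⟩⟩) a c
  simp only [SimpleGraph.Preconnected, SimpleGraph.reachable_iff_reflTransGen, key,
    Subtype.range_coe, Subtype.forall]

theorem preconnected_graph :
    (graph F).toSimpleGraphInclusive.Preconnected ↔ ∀ u w, ReachIn (Sym F) Set.univ u w := by
  have key := fun a c : V => reflTransGen_iff_reachIn (R := Sym F)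
    (f := (id : V → V)) Function.injective_id (A := (graph F).toSimpleGraphInclusive.Adj)
    (fun a c h => by rw [inclusive_adj]; exact ⟨fun h => h.2, fun h' => ⟨h, h'⟩⟩) a c
  simp only [SimpleGraph.Preconnected, SimpleGraph.reachable_iff_reflTransGen, key,
    Set.range_id, id]

theorem preconnected_induce_compl (S : Set V) (v : S) :
    ((induce (graph F) S).toSimpleGraphInclusive.induce {v}ᶜ).Preconnected ↔
      ∀ u ∈ S, ∀ w ∈ S, u ≠ v → w ≠ v → ReachIn (Sym F) (S \ {(v : V)}) u w := by
  have inj : Function.Injective (fun a : ({v}ᶜ : Set S) => (a : V)) :=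
    fun a c h => Subtype.ext (Subtype.ext h)
  have key := fun a c => reflTransGen_iff_reachIn (R := Sym F) inj
    (A := ((induce (graph F) S).toSimpleGraphInclusive.induce {v}ᶜ).Adj)
    (fun a c h => by
      rw [SimpleGraph.comap_adj]
      refine Iff.trans (inclusive_adj _ _ _) ⟨fun h => h.2, fun h' => ⟨?_, h'⟩⟩
      exact fun e => h (Subtype.ext e)) a c
  have range : Set.range (fun a : ({v}ᶜ : Set S) => (a : V)) = S \ {(v : V)} := by
    ext x
    constructor
    · rintro ⟨a, rfl⟩
      exact ⟨a.1.2, fun e => a.2 (Subtype.ext e)⟩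
    · rintro ⟨hx, hv⟩
      exact ⟨⟨⟨x, hx⟩, fun e => hv (congrArg Subtype.val e)⟩, rfl⟩
  simp only [SimpleGraph.Preconnected, SimpleGraph.reachable_iff_reflTransGen, key, range]
  constructor
  · intro h u hu w hw huv hwv
    exact h ⟨⟨u, hu⟩, fun e => huv (congrArg Subtype.val e)⟩
      ⟨⟨w, hw⟩, fun e => hwv (congrArg Subtype.val e)⟩
  · intro h a c
    exact h a.1 a.1.2 c.1 c.1.2 (fun e => a.2 (Subtype.ext e)) (fun e => c.2 (Subtype.ext e))

theorem preconnected_graph_compl (v : V) :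
    ((graph F).toSimpleGraphInclusive.induce {v}ᶜ).Preconnected ↔
      ∀ u w, u ≠ v → w ≠ v → ReachIn (Sym F) {v}ᶜ u w := by
  have key := fun a c => reflTransGen_iff_reachIn (R := Sym F)
    (f := (Subtype.val : ({v}ᶜ : Set V) → V)) Subtype.val_injective
    (A := ((graph F).toSimpleGraphInclusive.induce {v}ᶜ).Adj)
    (fun a c h => by
      rw [SimpleGraph.comap_adj]
      exact Iff.trans (inclusive_adj _ _ _) ⟨fun h => h.2, fun h' => ⟨fun e => h (Subtype.ext e), h'⟩⟩)
    a c
  simp only [SimpleGraph.Preconnected, SimpleGraph.reachable_iff_reflTransGen, key,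
    Subtype.range_coe, Subtype.forall]
  exact ⟨fun h u w hu hw => h u hu w hw, fun h u hu w hw => h u w hu hw⟩

theorem stronglyBiconnected_induce (S : Set V) :
    StronglyBiconnected (induce (graph F) S) ↔
      S.Nonempty ∧ (∀ u ∈ S, ∀ w ∈ S, ReachIn (fun x y => (x, y) ∈ F) S u w) ∧
        (∀ u ∈ S, ∀ w ∈ S, ReachIn (Sym F) S u w) ∧
          ∀ v ∈ S, ∀ u ∈ S, ∀ w ∈ S, u ≠ v → w ≠ v → ReachIn (Sym F) (S \ {v}) u w := by
  rw [StronglyBiconnected, Biconnected, stronglyConnected_induce, SimpleGraph.connected_iff,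
    preconnected_induce]
  have := fun v => preconnected_induce_compl (F := F) S v
  simp only [this, Set.nonempty_coe_sort, Subtype.forall]
  tauto

theorem stronglyBiconnected_deleteVertex (b : V) :
    StronglyBiconnected (deleteVertex (graph F) b) ↔
      (∃ x, x ≠ b) ∧ (∀ u w, u ≠ b → w ≠ b → ReachIn (fun x y => (x, y) ∈ F) {b}ᶜ u w) ∧
        ∀ u w, u ≠ b → w ≠ b → Same F b u w := by
  rw [deleteVertex, stronglyBiconnected_induce]
  have e1 : ∀ v, ({b}ᶜ : Set V) \ {v} = {x | x ≠ b ∧ x ≠ v} := fun v => rfl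
  have e2 : ({b}ᶜ : Set V) = {x | x ≠ b ∧ x ≠ b} := by ext x; simp
  constructor
  · rintro ⟨⟨x, hx⟩, h1, h2, h3⟩
    refine ⟨⟨x, hx⟩, fun u w hu hw => h1 u hu w hw, fun u w hu hw v hvu hvw => ?_⟩
    -- In `Same` the vertex `v` may be `b`; that case says that the graph without `b` is connected.
    by_cases hv : v = b
    · subst hv
      have := h2 u hu w hw
      rw [e2] at this
      exact this
    · exact h3 v hv u hu w hw hvu.symm hvw.symm
  · rintro ⟨⟨x, hx⟩, h1, h2⟩
    refine ⟨⟨x, hx⟩, fun u hu w hw => h1 u w hu hw, fun u hu w hw => ?_,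
      fun v _ u hu w hw huv hwv => h2 u w hu hw v huv.symm hwv.symm⟩
    rw [e2]
    exact h2 u w hu hw b (Ne.symm hu) (Ne.symm hw)

theorem exists_ne_of_three_le_card (h : 3 ≤ Nat.card V) (a c : V) : ∃ x, x ≠ a ∧ x ≠ c := by
  classical
  have : Finite V := Nat.finite_of_card_ne_zero (by omega)
  have := Fintype.ofFinite V
  by_contra hcon
  push Not at hcon
  have : (Finset.univ : Finset V) ⊆ {a, c} := by
    intro x _
    by_cases hx : x = a
    · simp [hx]
    · simp [hcon x hx]
  have h1 := Finset.card_le_card this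
  have h2 := Finset.card_le_two (a := a) (b := c)
  rw [Nat.card_eq_fintype_card] at h
  rw [Finset.card_univ] at h1
  omega

theorem twoVertexConnected_graph :
    TwoVertexConnected (graph F) ↔
      3 ≤ Nat.card V ∧ (∀ u w, ReachIn (fun x y => (x, y) ∈ F) Set.univ u w) ∧
        ∀ v u w, u ≠ v → w ≠ v → ReachIn (fun x y => (x, y) ∈ F) {v}ᶜ u w := by
  rw [TwoVertexConnected, stronglyConnected_graph]
  have := fun v => stronglyConnected_induce (F := F) ({v}ᶜ : Set V)
  simp only [deleteVertex, this]
  refine and_congr_right fun h3 => ?_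
  have hne : Nonempty V := (Nat.card_pos_iff.1 (by omega)).1
  constructor
  · rintro ⟨⟨-, h1⟩, h2⟩
    exact ⟨h1, fun v u w hu hw => (h2 v).2 u hu w hw⟩
  · rintro ⟨h1, h2⟩
    refine ⟨⟨hne, h1⟩, fun v => ⟨?_, fun u hu w hw => h2 v u w hu hw⟩⟩
    obtain ⟨x, hx, -⟩ := exists_ne_of_three_le_card h3 v v
    exact ⟨x, hx⟩

theorem TwoVertexConnected.mono {F' : Finset (V × V)} (h : F ⊆ F')
    (hF : TwoVertexConnected (graph F)) : TwoVertexConnected (graph F') := by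
  rw [twoVertexConnected_graph] at hF ⊢
  exact ⟨hF.1, fun u w => (hF.2.1 u w).mono (fun _ _ _ _ hxy => h hxy) le_rfl,
    fun v u w hu hw => (hF.2.2 v u w hu hw).mono (fun _ _ _ _ hxy => h hxy) le_rfl⟩

theorem TwoVertexStronglyBiconnected.twoVertexConnected {D : Digraph V}
    (h : TwoVertexStronglyBiconnected D) : TwoVertexConnected D :=
  ⟨h.1, h.2.1.1, fun w => (h.2.2 w).1⟩

/-- A 2-vertex-connected graph is strongly biconnected. -/
theorem TwoVertexConnected.stronglyBiconnected (h : TwoVertexConnected (graph F)) :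
    StronglyBiconnected (graph F) := by
  have h' := twoVertexConnected_graph.1 h
  refine ⟨h.2.1, (SimpleGraph.connected_iff _).2 ⟨preconnected_graph.2 fun u w => ?_, h.2.1.1⟩,
    fun v => (preconnected_graph_compl v).2 fun u w hu hw => ?_⟩
  · exact (h'.2.1 u w).mono (fun _ _ _ _ h => Or.inl h) le_rfl
  · exact (h'.2.2 v u w hu hw).mono (fun _ _ _ _ h => Or.inl h) le_rfl

theorem TwoVertexConnected.isBArticulationPoint_iff (h : TwoVertexConnected (graph F)) (b : V) :
    IsBArticulationPoint (graph F) b ↔ ¬ StronglyBiconnected (deleteVertex (graph F) b) :=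
  and_iff_right h.stronglyBiconnected

/-- The test of step 2 can therefore be read off from the b-articulation points, with no computation
of its own. -/
theorem TwoVertexConnected.twoVertexStronglyBiconnected_iff (h : TwoVertexConnected (graph F)) :
    TwoVertexStronglyBiconnected (graph F) ↔ ∀ b, ¬ IsBArticulationPoint (graph F) b := by
  simp only [h.isBArticulationPoint_iff, not_not]
  exact ⟨fun h' => h'.2.2, fun h' => ⟨h.1, h.stronglyBiconnected, h'⟩⟩

end Bridge

/-! ### Vertices that no vertex separates -/

section Same

variable {V : Type*} {F F' : Finset (V × V)} {b u v w x y : V}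

theorem Link.refl (u : V) : Link F b v u u := ReachIn.refl u

theorem Link.symm (h : Link F b v u w) : Link F b v w u := ReachIn.symm (fun _ _ => Sym.symm) h

theorem Link.trans (h : Link F b v u w) (h' : Link F b v w x) : Link F b v u x :=
  ReachIn.trans h h'

theorem Link.of_sym (h : Sym F u w) (hu : u ≠ b) (hw : w ≠ b) (huv : u ≠ v) (hwv : w ≠ v) :
    Link F b v u w := ReachIn.single (S := {x | x ≠ b ∧ x ≠ v}) ⟨hu, huv⟩ ⟨hw, hwv⟩ h

theorem Link.mono (hF : F ⊆ F') (h : Link F b v u w) : Link F' b v u w :=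
  ReachIn.mono (fun _ _ _ _ => Or.imp (@hF _) (@hF _)) le_rfl h

theorem Same.refl (u : V) : Same F b u u := fun _ _ _ => Link.refl u

theorem Same.symm (h : Same F b u w) : Same F b w u := fun v hw hu => (h v hu hw).symm

theorem Same.mono (hF : F ⊆ F') (h : Same F b u w) : Same F' b u w :=
  fun v hu hw => (h v hu hw).mono hF

theorem Same.of_sym (h : Sym F u w) (hu : u ≠ b) (hw : w ≠ b) : Same F b u w :=
  fun _ hvu hvw => Link.of_sym h hu hw hvu.symm hvw.symm

/-- Two vertices which are not separated from either of two distinct vertices are not separated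
from each other. -/
theorem Same.of_two (h : x ≠ y) (hux : Same F b u x) (huy : Same F b u y) (hwx : Same F b w x)
    (hwy : Same F b w y) : Same F b u w := by
  intro v hvu hvw
  -- The vertex `v` differs from `x` or from `y`, and a detour through that one avoids `v`.
  by_cases hvx : v = x
  · have hvy : v ≠ y := fun e => h (hvx.symm.trans e)
    exact (huy v hvu hvy).trans (hwy v hvw hvy).symm
  · exact (hux v hvu hvx).trans (hwx v hvw hvx).symm

/-- `M` is a maximal set of vertices other than `b` no two of which are separated. -/
def IsBlock (F : Finset (V × V)) (b : V) (M : Set V) : Prop :=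
  (∀ x ∈ M, x ≠ b) ∧ (∀ x ∈ M, ∀ y ∈ M, Same F b x y) ∧
    ∀ x, x ≠ b → (∀ y ∈ M, Same F b x y) → x ∈ M

/-- Two distinct vertices of a block determine it, by `Same.of_two`. -/
theorem IsBlock.mem_of_two {M : Set V} (hM : IsBlock F b M) (hx : x ∈ M) (hy : y ∈ M) (h : x ≠ y)
    (hw : w ≠ b) (hwx : Same F b w x) (hwy : Same F b w y) : w ∈ M :=
  hM.2.2 w hw fun _ hs => Same.of_two h hwx hwy (hM.2.1 _ hs _ hx) (hM.2.1 _ hs _ hy)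

/-- A path between two vertices of a block can be replaced by a path inside the block. -/
theorem IsBlock.reachIn {M : Set V} (hM : IsBlock F b M) {R : V → V → Prop} {S : Set V}
    (hR : ∀ x y, R x y → Sym F x y) (hS : b ∉ S) (hu : u ∈ M) (hw : w ∈ M)
    (h : ReachIn R S u w) : ReachIn R (M ∩ S) u w := by
  -- The induction runs along the path from its start and must also treat starts outside `M`. There
  -- `a` is the vertex at which the path next enters `M`, and the part before `a` connects the start
  -- to `a` without any other vertex of `M`.
  suffices H : (u ∈ M → ReachIn R (M ∩ S) u w) ∧
      (u ∉ M → ∃ a ∈ M, (∀ v ∈ M, v ≠ a → Link F b v u a) ∧ ReachIn R (M ∩ S) a w) from H.1 hu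
  clear hu
  have ne : ∀ {x}, x ∈ S → x ≠ b := fun hx e => hS (e ▸ hx)
  induction h using Relation.ReflTransGen.head_induction_on with
  | refl => exact ⟨fun _ => ReachIn.refl _, fun h => absurd hw h⟩
  | @head x y hxy _ ih =>
    obtain ⟨hx, hy, hxy⟩ := hxy
    constructor
    · intro hxM
      by_cases hyM : y ∈ M
      · exact (ReachIn.single (S := M ∩ S) ⟨hxM, hx⟩ ⟨hyM, hy⟩ hxy).trans (ih.1 hyM)
      · obtain ⟨a, haM, ha, haw⟩ := ih.2 hyM
        by_cases hax : a = x
        · exact hax ▸ haw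
        -- An excursion that leaves `M` at `x` and returns at `a ≠ x` would make `y` inseparable
        -- from all of `M`: the edge to `x` serves unless `x` is removed, and then the way to `a`
        -- does. This contradicts maximality.
        · exfalso
          refine hyM (hM.2.2 y (ne hy) fun s hs v hvy hvs => ?_)
          by_cases hvx : v = x
          · subst hvx
            exact (ha v hxM (Ne.symm hax)).trans (hM.2.1 a haM s hs v (Ne.symm hax) hvs)
          · exact (Link.of_sym (hR _ _ hxy).symm (ne hy) (ne hx) hvy.symm (Ne.symm hvx)).trans
              (hM.2.1 x hxM s hs v hvx hvs)
    · intro hxM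
      by_cases hyM : y ∈ M
      · refine ⟨y, hyM, fun v hv hvy => ?_, ih.1 hyM⟩
        exact Link.of_sym (hR _ _ hxy) (ne hx) (ne hy) (fun e => hxM (e ▸ hv)) hvy.symm
      · obtain ⟨a, haM, ha, haw⟩ := ih.2 hyM
        refine ⟨a, haM, fun v hv hva => ?_, haw⟩
        exact (Link.of_sym (hR _ _ hxy) (ne hx) (ne hy) (fun e => hxM (e ▸ hv))
          (fun e => hyM (e ▸ hv))).trans (ha v hv hva)

/-- The blocks of a strongly connected graph are strongly biconnected. -/
theorem IsBlock.stronglyBiconnected {M : Set V} (hM : IsBlock F b M) (hne : M.Nonempty)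
    (hF : ∀ u w, u ≠ b → w ≠ b → ReachIn (fun x y => (x, y) ∈ F) {b}ᶜ u w) :
    StronglyBiconnected (induce (graph F) M) := by
  have hMb : M ⊆ {b}ᶜ := fun x hx => hM.1 x hx
  have sc : ∀ u ∈ M, ∀ w ∈ M, ReachIn (fun x y => (x, y) ∈ F) M u w := fun u hu w hw =>
    (hM.reachIn (fun _ _ h => Or.inl h) (by simp) hu hw (hF u w (hM.1 u hu) (hM.1 w hw))).mono
      (fun _ _ _ _ h => h) Set.inter_subset_left
  refine (stronglyBiconnected_induce M).2 ⟨hne, sc, fun u hu w hw =>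
    (sc u hu w hw).mono (fun _ _ _ _ h => Or.inl h) le_rfl, fun v _ u hu w hw huv hwv => ?_⟩
  have := hM.2.1 u hu w hw v huv.symm hwv.symm
  refine (hM.reachIn (fun _ _ h => h) (by simp) hu hw this).mono (fun _ _ _ _ h => h) ?_
  exact fun x hx => ⟨hx.1, hx.2.2⟩

theorem same_of_stronglyBiconnected {S : Set V} (hS : S ⊆ {b}ᶜ)
    (h : StronglyBiconnected (induce (graph F) S)) (hu : u ∈ S) (hw : w ∈ S) : Same F b u w := by
  obtain ⟨-, -, h2, h3⟩ := (stronglyBiconnected_induce S).1 h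
  intro v hvu hvw
  by_cases hv : v ∈ S
  · refine (h3 v hv u hu w hw hvu.symm hvw.symm).mono (fun _ _ _ _ h => h) ?_
    exact fun x hx => ⟨hS hx.1, hx.2⟩
  · refine (h2 u hu w hw).mono (fun _ _ _ _ h => h) ?_
    exact fun x hx => ⟨hS hx, fun e => hv (e ▸ hx)⟩

/-- A strongly connected graph is strongly biconnected if it separates no edge of a larger strongly
biconnected graph. -/
theorem stronglyBiconnected_of_same {E : Finset (V × V)}
    (hE : StronglyBiconnected (deleteVertex (graph E) b))
    (hF : ∀ u w, u ≠ b → w ≠ b → ReachIn (fun x y => (x, y) ∈ F) {b}ᶜ u w)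
    (h : ∀ u w, (u, w) ∈ E → u ≠ b → w ≠ b → Same F b u w) :
    StronglyBiconnected (deleteVertex (graph F) b) := by
  obtain ⟨hx, -, hE⟩ := (stronglyBiconnected_deleteVertex b).1 hE
  refine (stronglyBiconnected_deleteVertex b).2 ⟨hx, hF, fun u w hu hw v hvu hvw => ?_⟩
  -- A path of the larger graph that avoids `b` and `v` is replaced edge by edge, as `v` does not
  -- separate the ends of any of its edges in `F`.
  refine (hE u w hu hw v hvu hvw).replace fun x hx y hy hxy => ?_
  rcases hxy with hxy | hxy
  · exact h x y hxy hx.1 hy.1 v hx.2.symm hy.2.symm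
  · exact (h y x hxy hy.1 hx.1).symm v hx.2.symm hy.2.symm

end Same

/-! ### Blocks from a spanning tree

A rooted spanning tree of the graph without `b` is given by the parents of its vertices; its edges
are named by their lower ends. -/

section Tree

variable {V : Type*} {F F' : Finset (V × V)} {b r : V} {p : V → V} {ord : V → ℕ}

/-- `ord` will be the time at which the search reaches a vertex. Only its strict decrease towards
the root is used; distinct vertices may share a value. -/
structure IsTree (F : Finset (V × V)) (b r : V) (p : V → V) (ord : V → ℕ) : Prop where
  root_ne : r ≠ b
  ord_root : ord r = 0
  par_ne : ∀ y, y ≠ b → y ≠ r → p y ≠ b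
  adj : ∀ y, y ≠ b → y ≠ r → (p y, y) ∈ F
  lt : ∀ y, y ≠ b → y ≠ r → ord (p y) < ord y

theorem IsTree.mono (hF : F ⊆ F') (h : IsTree F b r p ord) : IsTree F' b r p ord :=
  { h with adj := fun y hb hr => hF (h.adj y hb hr) }

/-- `Climb p ord u w l`: the edges of the tree path from `u` to `w` are those in `l`. -/
inductive Climb (p : V → V) (ord : V → ℕ) : V → V → List V → Prop
  | nil (u : V) : Climb p ord u u []
  -- The end with the larger `ord` moves up. It is never an ancestor of the other end, so the two
  -- meet in their lowest common ancestor.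
  | left {u w : V} {l : List V} (ne : u ≠ w) (lt : ord w < ord u) (h : Climb p ord (p u) w l) :
      Climb p ord u w (u :: l)
  | right {u w : V} {l : List V} (ne : u ≠ w) (le : ord u ≤ ord w) (h : Climb p ord u (p w) l) :
      Climb p ord u w (w :: l)

/-- The vertices of the tree path from `u` to `w` with the edges `l`. -/
def onPath (p : V → V) (u w : V) (l : List V) (x : V) : Prop :=
  x = u ∨ x = w ∨ x ∈ l ∨ ∃ z ∈ l, x = p z

theorem IsTree.ne_root_of_lt (h : IsTree F b r p ord) {u w : V} (lt : ord w < ord u) : u ≠ r := by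
  rintro rfl
  rw [h.ord_root] at lt
  omega

theorem IsTree.ne_root_of_le (h : IsTree F b r p ord) {u w : V} (hu : u ≠ b) (ne : u ≠ w)
    (le : ord u ≤ ord w) : w ≠ r := by
  rintro rfl
  rw [h.ord_root] at le
  have := h.lt u hu ne
  omega

theorem onPath_left {u w x : V} {l : List V} :
    onPath p u w (u :: l) x ↔ x = u ∨ onPath p (p u) w l x := by
  simp only [onPath, List.mem_cons, exists_eq_or_imp]
  tauto

theorem onPath_right {u w x : V} {l : List V} :
    onPath p u w (w :: l) x ↔ x = w ∨ onPath p u (p w) l x := by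
  simp only [onPath, List.mem_cons, exists_eq_or_imp]
  tauto

/-- It follows that an end which has moved up does not recur on the rest of the path, so tree paths
are simple. -/
theorem Climb.ord_lt (h : IsTree F b r p ord) {u w : V} {l : List V} (hc : Climb p ord u w l)
    (hu : u ≠ b) (hw : w ≠ b) :
    ∀ x, onPath p u w l x → x = u ∨ x = w ∨ ord x < ord u ∨ ord x < ord w := by
  induction hc with
  | nil u => intro x hx; simp [onPath] at hx; exact Or.inl hx
  | @left u w l ne lt _ ih =>
    intro x hx
    have hr := h.ne_root_of_lt lt
    have hl := h.lt u hu hr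
    rcases onPath_left.1 hx with rfl | hx
    · exact Or.inl rfl
    · rcases ih (h.par_ne u hu hr) hw x hx with rfl | rfl | h1 | h1
      · exact Or.inr (Or.inr (Or.inl hl))
      · exact Or.inr (Or.inl rfl)
      · exact Or.inr (Or.inr (Or.inl (h1.trans hl)))
      · exact Or.inr (Or.inr (Or.inr h1))
  | @right u w l ne le _ ih =>
    intro x hx
    have hr := h.ne_root_of_le hu ne le
    have hl := h.lt w hw hr
    rcases onPath_right.1 hx with rfl | hx
    · exact Or.inr (Or.inl rfl)
    · rcases ih hu (h.par_ne w hw hr) x hx with rfl | rfl | h1 | h1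
      · exact Or.inl rfl
      · exact Or.inr (Or.inr (Or.inr hl))
      · exact Or.inr (Or.inr (Or.inl h1))
      · exact Or.inr (Or.inr (Or.inr (h1.trans hl)))

theorem Climb.mem_ne (h : IsTree F b r p ord) {u w : V} {l : List V} (hc : Climb p ord u w l)
    (hu : u ≠ b) (hw : w ≠ b) : ∀ z ∈ l, z ≠ b ∧ z ≠ r := by
  induction hc with
  | nil => simp
  | @left u w l ne lt _ ih =>
    have hr := h.ne_root_of_lt lt
    intro z hz
    rcases List.mem_cons.1 hz with rfl | hz
    · exact ⟨hu, hr⟩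
    · exact ih (h.par_ne u hu hr) hw z hz
  | @right u w l ne le _ ih =>
    have hr := h.ne_root_of_le hu ne le
    intro z hz
    rcases List.mem_cons.1 hz with rfl | hz
    · exact ⟨hw, hr⟩
    · exact ih hu (h.par_ne w hw hr) z hz

theorem IsTree.sym (h : IsTree F b r p ord) {y : V} (hb : y ≠ b) (hr : y ≠ r) : Sym F y (p y) :=
  Or.inr (h.adj y hb hr)

theorem IsTree.par_ne_self (h : IsTree F b r p ord) {y : V} (hb : y ≠ b) (hr : y ≠ r) :
    p y ≠ y := fun e => by
  have := h.lt y hb hr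
  rw [e] at this
  omega

/-- The parts into which a tree path falls when a vertex `v` is removed are connected. -/
theorem Climb.link (h : IsTree F b r p ord) {u w : V} {l : List V} (hc : Climb p ord u w l)
    (hu : u ≠ b) (hw : w ≠ b) (v : V) :
    (∀ x, onPath p u w l x → x ≠ v → (v ≠ u ∧ Link F b v x u) ∨ (v ≠ w ∧ Link F b v x w)) ∧
      (¬ onPath p u w l v → ∀ x, onPath p u w l x → Link F b v x u ∧ Link F b v x w) := by
  induction hc with
  | nil u =>
    have : ∀ x, onPath p u u [] x → x = u := fun x hx => by simpa [onPath] using hx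
    refine ⟨fun x hx hv => ?_, fun _ x hx => ?_⟩
    · rw [this x hx] at hv ⊢
      exact Or.inl ⟨hv.symm, Link.refl _⟩
    · rw [this x hx]
      exact ⟨Link.refl _, Link.refl _⟩
  | @left u w l ne lt hc ih =>
    have hr := h.ne_root_of_lt lt
    have hl := h.lt u hu hr
    have hpb := h.par_ne u hu hr
    obtain ⟨ih1, ih2⟩ := ih hpb hw
    have notin : ¬ onPath p (p u) w l u := fun hx => by
      rcases hc.ord_lt h hpb hw u hx with e | e | e | e
      · exact h.par_ne_self hu hr e.symm
      · exact ne e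
      · omega
      · omega
    have edge : v ≠ u → v ≠ p u → Link F b v (p u) u := fun h1 h2 =>
      Link.of_sym (h.sym hu hr).symm hpb hu h2.symm h1.symm
    constructor
    · intro x hx hxv
      rcases onPath_left.1 hx with rfl | hx
      · exact Or.inl ⟨hxv.symm, Link.refl _⟩
      · by_cases hvu : v = u
        · subst hvu
          exact Or.inr ⟨ne, (ih2 notin x hx).2⟩
        · rcases ih1 x hx hxv with ⟨h1, h2⟩ | h2
          · exact Or.inl ⟨hvu, h2.trans (edge hvu h1)⟩
          · exact Or.inr h2
    · intro hv x hx
      rw [onPath_left, not_or] at hv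
      have hvp : v ≠ p u := fun e => hv.2 (Or.inl e)
      have hpw := (ih2 hv.2 (p u) (Or.inl rfl)).2
      rcases onPath_left.1 hx with rfl | hx
      · exact ⟨Link.refl _, (edge hv.1 hvp).symm.trans hpw⟩
      · exact ⟨(ih2 hv.2 x hx).1.trans (edge hv.1 hvp), (ih2 hv.2 x hx).2⟩
  | @right u w l ne le hc ih =>
    have hr := h.ne_root_of_le hu ne le
    have hl := h.lt w hw hr
    have hpb := h.par_ne w hw hr
    obtain ⟨ih1, ih2⟩ := ih hu hpb
    have notin : ¬ onPath p u (p w) l w := fun hx => by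
      rcases hc.ord_lt h hu hpb w hx with e | e | e | e
      · exact ne e.symm
      · exact h.par_ne_self hw hr e.symm
      · omega
      · omega
    have edge : v ≠ w → v ≠ p w → Link F b v (p w) w := fun h1 h2 =>
      Link.of_sym (h.sym hw hr).symm hpb hw h2.symm h1.symm
    constructor
    · intro x hx hxv
      rcases onPath_right.1 hx with rfl | hx
      · exact Or.inr ⟨hxv.symm, Link.refl _⟩
      · by_cases hvw : v = w
        · subst hvw
          exact Or.inl ⟨ne.symm, (ih2 notin x hx).1⟩
        · rcases ih1 x hx hxv with h2 | ⟨h1, h2⟩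
          · exact Or.inl h2
          · exact Or.inr ⟨hvw, h2.trans (edge hvw h1)⟩
    · intro hv x hx
      rw [onPath_right, not_or] at hv
      have hvp : v ≠ p w := fun e => hv.2 (Or.inr (Or.inl e))
      have hpu := (ih2 hv.2 (p w) (Or.inr (Or.inl rfl))).1
      rcases onPath_right.1 hx with rfl | hx
      · exact ⟨(edge hv.1 hvp).symm.trans hpu, Link.refl _⟩
      · exact ⟨(ih2 hv.2 x hx).1, (ih2 hv.2 x hx).2.trans (edge hv.1 hvp)⟩

/-- The tree path between two vertices that are not separated lies in a block. -/
theorem Climb.same (h : IsTree F b r p ord) {u w : V} {l : List V} (hc : Climb p ord u w l)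
    (hu : u ≠ b) (hw : w ≠ b) (huw : Same F b u w) {x y : V} (hx : onPath p u w l x)
    (hy : onPath p u w l y) : Same F b x y := by
  intro v hvx hvy
  -- Without `v` each of `x` and `y` hangs on an end of the path other than `v`, and the two ends
  -- are linked by `huw`.
  have key := (hc.link h hu hw v).1
  rcases key x hx hvx.symm with ⟨h1, h2⟩ | ⟨h1, h2⟩ <;>
    rcases key y hy hvy.symm with ⟨h3, h4⟩ | ⟨h3, h4⟩
  · exact h2.trans h4.symm
  · exact h2.trans ((huw v h1 h3).trans h4.symm)
  · exact h2.trans ((huw v h3 h1).symm.trans h4.symm)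
  · exact h2.trans h4.symm

theorem IsTree.exists_climb (h : IsTree F b r p ord) :
    ∀ {u w : V}, u ≠ b → w ≠ b → ∃ l, Climb p ord u w l := by
  suffices H : ∀ k u w, ord u + ord w < k → u ≠ b → w ≠ b → ∃ l, Climb p ord u w l from
    fun {u w} hu hw => H _ u w (Nat.lt_succ_self _) hu hw
  intro k
  induction k with
  | zero => intro u w hk; omega
  | succ k ih =>
    intro u w hk hu hw
    by_cases ne : u = w
    · subst ne
      exact ⟨[], Climb.nil u⟩
    · rcases lt_or_ge (ord w) (ord u) with lt | le
      · have hr := h.ne_root_of_lt lt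
        have := h.lt u hu hr
        obtain ⟨l, hl⟩ := ih (p u) w (by omega) (h.par_ne u hu hr) hw
        exact ⟨_, Climb.left ne lt hl⟩
      · have hr := h.ne_root_of_le hu ne le
        have := h.lt w hw hr
        obtain ⟨l, hl⟩ := ih u (p w) (by omega) hu (h.par_ne w hw hr)
        exact ⟨_, Climb.right ne le hl⟩

theorem Climb.ends {u w : V} {l : List V} (hc : Climb p ord u w l) (ne : u ≠ w) :
    (∃ z ∈ l, u = z ∨ u = p z) ∧ ∃ z ∈ l, w = z ∨ w = p z := by
  induction hc with
  | nil => exact absurd rfl ne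
  | @left u w l ne lt hc ih =>
    refine ⟨⟨u, by simp, Or.inl rfl⟩, ?_⟩
    by_cases e : p u = w
    · exact ⟨u, by simp, Or.inr e.symm⟩
    · obtain ⟨-, z, hz, hw⟩ := ih e
      exact ⟨z, List.mem_cons_of_mem _ hz, hw⟩
  | @right u w l ne le hc ih =>
    refine ⟨?_, ⟨w, by simp, Or.inl rfl⟩⟩
    by_cases e : u = p w
    · exact ⟨w, by simp, Or.inr e⟩
    · obtain ⟨⟨z, hz, hu⟩, -⟩ := ih e
      exact ⟨z, List.mem_cons_of_mem _ hz, hu⟩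

open Classical in
/-- The tree edge at `x` on the tree path from `x` to `z`. -/
noncomputable def gate (r : V) (p : V → V) (ord : V → ℕ) (x z : V) : V :=
  -- Walking up from `z`: if a child of `x` is met, the path leaves `x` through that child; if the
  -- root is reached instead, it leaves through the edge above `x`, which is named `x`. The
  -- comparison of `ord` is there for termination.
  if z = r then x
  else if p z = x then z
  else if ord (p z) < ord z then gate r p ord x (p z) else x
termination_by ord z

theorem gate_root (x : V) : gate r p ord x r = x := by
  rw [gate]
  simp

theorem gate_child {x z : V} (hz : z ≠ r) (e : p z = x) : gate r p ord x z = z := by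
  rw [gate]
  simp [hz, e]

theorem IsTree.gate_step (h : IsTree F b r p ord) {x z : V} (hb : z ≠ b) (hz : z ≠ r)
    (e : p z ≠ x) : gate r p ord x z = gate r p ord x (p z) := by
  conv_lhs => rw [gate]
  simp [hz, e, h.lt z hb hz]

/-- A vertex of smaller `ord` is no descendant of `x`, so the path to it leaves `x` upwards. -/
theorem IsTree.gate_of_lt (h : IsTree F b r p ord) {x : V} :
    ∀ {z : V}, z ≠ b → ord z < ord x → gate r p ord x z = x := by
  suffices H : ∀ k z, ord z < k → z ≠ b → ord z < ord x → gate r p ord x z = x from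
    fun {z} => H _ z (Nat.lt_succ_self _)
  intro k
  induction k with
  | zero => intro z hk; omega
  | succ k ih =>
    intro z hk hb hx
    by_cases hz : z = r
    · rw [hz, gate_root]
    · have := h.lt z hb hz
      have hne : p z ≠ x := fun e => by
        rw [e] at this
        omega
      rw [h.gate_step hb hz hne]
      exact ih _ (by omega) (h.par_ne z hb hz) (by omega)

/-- A labelling of the tree edges is constant on the list `l`. -/
def Mono {L : Type*} (lab : V → L) (l : List V) : Prop := ∀ z ∈ l, ∀ z' ∈ l, lab z = lab z'

/-! ### Labellings of the tree edges and the blocks they describe -/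

section Labels

variable {L : Type*} {lab : V → L}

theorem Mono.tail {z : V} {l : List V} (h : Mono lab (z :: l)) : Mono lab l :=
  fun x hx y hy => h x (List.mem_cons_of_mem _ hx) y (List.mem_cons_of_mem _ hy)

/-- The gate at an end of a tree path is one of the edges of that path, so it carries their common
label. `Climb.gate_left` is the mirror image. -/
theorem Climb.gate_right (h : IsTree F b r p ord) {x w : V} {l : List V}
    (hc : Climb p ord x w l) (hx : x ≠ b) (hw : w ≠ b) (ne : x ≠ w) {c : L}
    (hl : ∀ z ∈ l, lab z = c) : lab (gate r p ord x w) = c := by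
  induction hc with
  | nil => exact absurd rfl ne
  | @left x w l _ lt hc _ =>
    rw [h.gate_of_lt hw lt]
    exact hl x (by simp)
  | @right x w l _ le hc ih =>
    have hr := h.ne_root_of_le hx ne le
    by_cases e : p w = x
    · rw [gate_child hr e]
      exact hl w (by simp)
    · rw [h.gate_step hw hr e]
      exact ih hx (h.par_ne w hw hr) (Ne.symm e) fun z hz => hl z (List.mem_cons_of_mem _ hz)

theorem Climb.gate_left (h : IsTree F b r p ord) {u x : V} {l : List V}
    (hc : Climb p ord u x l) (hu : u ≠ b) (hx : x ≠ b) (ne : u ≠ x) {c : L}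
    (hl : ∀ z ∈ l, lab z = c) : lab (gate r p ord x u) = c := by
  induction hc with
  | nil => exact absurd rfl ne
  | @left u x l _ lt hc ih =>
    have hr := h.ne_root_of_lt lt
    by_cases e : p u = x
    · rw [gate_child hr e]
      exact hl u (by simp)
    · rw [h.gate_step hu hr e]
      exact ih (h.par_ne u hu hr) hx e fun z hz => hl z (List.mem_cons_of_mem _ hz)
  | @right u x l _ le hc ih =>
    have : gate r p ord x u = x := by
      rcases eq_or_lt_of_le le with e | lt
      · by_cases hr : u = r
        · rw [hr, gate_root]
        · have hlt := h.lt u hu hr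
          have hne : p u ≠ x := fun e' => by rw [e'] at hlt; omega
          rw [h.gate_step hu hr hne]
          exact h.gate_of_lt (h.par_ne u hu hr) (by omega)
      · exact h.gate_of_lt hu lt
    rw [this]
    exact hl x (by simp)

/-- If the path misses `x`, its two ends lie behind the same gate. If it passes through `x`, both
gates are edges of the path and share its label. -/
theorem Climb.gate_eq (h : IsTree F b r p ord) {u w x : V} {l : List V}
    (hc : Climb p ord u w l) (hu : u ≠ b) (hw : w ≠ b) (hux : u ≠ x) (hwx : w ≠ x)
    (hl : Mono lab l) : lab (gate r p ord x u) = lab (gate r p ord x w) := by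
  induction hc with
  | nil => rfl
  | @left u w l _ lt hc ih =>
    have hr := h.ne_root_of_lt lt
    have hpb := h.par_ne u hu hr
    by_cases e : p u = x
    · rw [gate_child hr e]
      subst e
      exact (hc.gate_right h hpb hw hwx.symm fun z hz =>
        hl z (List.mem_cons_of_mem _ hz) u (by simp)).symm
    · rw [h.gate_step hu hr e]
      exact ih hpb hw e hwx hl.tail
  | @right u w l ne le hc ih =>
    have hr := h.ne_root_of_le hu ne le
    have hpb := h.par_ne w hw hr
    by_cases e : p w = x
    · rw [gate_child hr e]
      subst e
      exact hc.gate_left h hu hpb hux fun z hz => hl z (List.mem_cons_of_mem _ hz) w (by simp)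
    · rw [h.gate_step hw hr e]
      exact ih hu hpb hux e hl.tail

/-- Every edge of the graph closes a cycle with tree edges of one label. -/
def LabelsComplete (F : Finset (V × V)) (b : V) (p : V → V) (ord : V → ℕ) (lab : V → L) : Prop :=
  ∀ u w, (u, w) ∈ F → u ≠ b → w ≠ b → ∃ l, Climb p ord u w l ∧ Mono lab l

/-- Tree edges of one label are in one block. -/
def LabelsSound (F : Finset (V × V)) (b r : V) (p : V → V) (lab : V → L) : Prop :=
  ∀ z z', z ≠ b → z ≠ r → z' ≠ b → z' ≠ r → lab z = lab z' →
    Same F b z z' ∧ Same F b z (p z') ∧ Same F b (p z) z' ∧ Same F b (p z) (p z')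

/-- No edge avoiding `x` changes the label of the gate at `x`, so this label is an invariant of the
components left by removing `x`. It is what proves vertices separated. -/
theorem LabelsComplete.gate_eq (h : IsTree F b r p ord) (hC : LabelsComplete F b p ord lab)
    {x u w : V} (huw : Link F b x u w) :
    lab (gate r p ord x u) = lab (gate r p ord x w) := by
  refine huw.mem_closed (P := fun y => lab (gate r p ord x u) = lab (gate r p ord x y)) rfl ?_
  rintro y hy z hz (hyz | hyz) e
  · obtain ⟨l, hl, hm⟩ := hC y z hyz hy.1 hz.1
    exact e.trans (hl.gate_eq h hy.1 hz.1 hy.2 hz.2 hm)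
  · obtain ⟨l, hl, hm⟩ := hC z y hyz hz.1 hy.1
    exact e.trans (hl.gate_eq h hz.1 hy.1 hz.2 hy.2 hm).symm

/-- At an inner vertex `x` of the tree path the two path edges are the gates towards the two ends.
As `x` does not separate the ends, these gates have the same label. -/
theorem LabelsComplete.mono_of_same (h : IsTree F b r p ord) (hC : LabelsComplete F b p ord lab)
    {u w : V} {l : List V} (hc : Climb p ord u w l) (hu : u ≠ b) (hw : w ≠ b)
    (huw : Same F b u w) : Mono lab l := by
  have cons : ∀ (z : V) (l : List V), Mono lab l → (∀ y ∈ l, lab z = lab y) →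
      Mono lab (z :: l) := by
    intro z l hl hz x hx y hy
    rcases List.mem_cons.1 hx with ex | hx' <;> rcases List.mem_cons.1 hy with ey | hy'
    · rw [ex, ey]
    · exact ex ▸ hz y hy'
    · exact ey ▸ (hz x hx').symm
    · exact hl x hx' y hy'
  induction hc with
  | nil => exact fun z hz => by simp at hz
  | @left u w l ne lt hc ih =>
    have hr := h.ne_root_of_lt lt
    have hpb := h.par_ne u hu hr
    have hpw : Same F b (p u) w := (Climb.left ne lt hc).same h hu hw huw
      (Or.inr (Or.inr (Or.inr ⟨u, by simp, rfl⟩))) (Or.inr (Or.inl rfl))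
    have hm := ih hpb hw hpw
    refine cons u l hm fun y hy => ?_
    have hne : p u ≠ w := by
      rintro rfl
      cases hc with
      | nil => simp at hy
      | left ne => exact ne rfl
      | right ne => exact ne rfl
    have e := hC.gate_eq h (huw (p u) (h.par_ne_self hu hr) hne)
    rwa [gate_child hr rfl, hc.gate_right h hpb hw hne fun z hz => hm z hz y hy] at e
  | @right u w l ne le hc ih =>
    have hr := h.ne_root_of_le hu ne le
    have hpb := h.par_ne w hw hr
    have hpw : Same F b u (p w) := (Climb.right ne le hc).same h hu hw huw
      (Or.inl rfl) (Or.inr (Or.inr (Or.inr ⟨w, by simp, rfl⟩)))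
    have hm := ih hu hpb hpw
    refine cons w l hm fun y hy => ?_
    have hne : u ≠ p w := by
      rintro rfl
      cases hc with
      | nil => simp at hy
      | left ne => exact ne rfl
      | right ne => exact ne rfl
    have e := hC.gate_eq h (huw (p w) hne.symm (h.par_ne_self hw hr))
    rw [gate_child hr rfl, hc.gate_left h hu hpb hne fun z hz => hm z hz y hy] at e
    exact e.symm

theorem LabelsSound.same (h : IsTree F b r p ord) (hS : LabelsSound F b r p lab) {u w : V}
    {l : List V} (hc : Climb p ord u w l) (hu : u ≠ b) (hw : w ≠ b) (hm : Mono lab l) :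
    Same F b u w := by
  by_cases ne : u = w
  · exact ne ▸ Same.refl u
  · obtain ⟨⟨z, hz, hzu⟩, z', hz', hzw⟩ := hc.ends ne
    obtain ⟨h1, h2⟩ := hc.mem_ne h hu hw z hz
    obtain ⟨h3, h4⟩ := hc.mem_ne h hu hw z' hz'
    obtain ⟨k1, k2, k3, k4⟩ := hS z z' h1 h2 h3 h4 (hm z hz z' hz')
    rcases hzu with rfl | rfl <;> rcases hzw with rfl | rfl <;> assumption

/-- The set of ends of the tree edges with label `c`. -/
def labelSet (b r : V) (p : V → V) (lab : V → L) (c : L) : Set V :=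
  {x | ∃ y, y ≠ b ∧ y ≠ r ∧ lab y = c ∧ (x = y ∨ x = p y)}

theorem mem_labelSet {y : V} (hb : y ≠ b) (hr : y ≠ r) : y ∈ labelSet b r p lab (lab y) :=
  ⟨y, hb, hr, rfl, Or.inl rfl⟩

theorem par_mem_labelSet {y : V} (hb : y ≠ b) (hr : y ≠ r) : p y ∈ labelSet b r p lab (lab y) :=
  ⟨y, hb, hr, rfl, Or.inr rfl⟩

/-- A vertex in the block of the tree edge at `y` is separated from the rest of the tree by `y` as
the upper end of that edge is. -/
theorem LabelsComplete.gate_of_same_par (h : IsTree F b r p ord)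
    (hC : LabelsComplete F b p ord lab) {x y : V} (hyb : y ≠ b) (hyr : y ≠ r) (hxy : x ≠ y)
    (hxp : Same F b x (p y)) : lab (gate r p ord y x) = lab y := by
  rw [hC.gate_eq h (hxp y hxy.symm (h.par_ne_self hyb hyr).symm),
    h.gate_of_lt (h.par_ne y hyb hyr) (h.lt y hyb hyr)]

/-- For maximality, let `x` be inseparable from both ends of the tree edge at `y`. The tree path
from `x` to `y` has one label, and its gate at `y` has the label of the edge above `y`, because `y`
does not separate `x` from `p y`. So `x` is an end of an edge with that label. -/
theorem isBlock_labelSet (h : IsTree F b r p ord) (hC : LabelsComplete F b p ord lab)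
    (hS : LabelsSound F b r p lab) {y : V} (hyb : y ≠ b) (hyr : y ≠ r) :
    IsBlock F b (labelSet b r p lab (lab y)) := by
  refine ⟨?_, ?_, ?_⟩
  · rintro x ⟨z, hzb, hzr, -, rfl | rfl⟩
    · exact hzb
    · exact h.par_ne z hzb hzr
  · rintro x ⟨z, hzb, hzr, hz, hxz⟩ x' ⟨z', hzb', hzr', hz', hxz'⟩
    obtain ⟨k1, k2, k3, k4⟩ := hS z z' hzb hzr hzb' hzr' (hz.trans hz'.symm)
    rcases hxz with rfl | rfl <;> rcases hxz' with rfl | rfl <;> assumption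
  · intro x hxb hx
    have hxy := hx y (mem_labelSet hyb hyr)
    have hxp := hx (p y) (par_mem_labelSet hyb hyr)
    by_cases e : x = y
    · rw [e]
      exact mem_labelSet hyb hyr
    · obtain ⟨l, hl⟩ := h.exists_climb hxb hyb
      have hm := hC.mono_of_same h hl hxb hyb hxy
      obtain ⟨⟨z, hz, hxz⟩, -⟩ := hl.ends e
      have e1 := hl.gate_left h hxb hyb e (lab := lab) fun z' hz' => hm z' hz' z hz
      rw [hC.gate_of_same_par h hyb hyr e hxp] at e1
      obtain ⟨hzb, hzr⟩ := hl.mem_ne h hxb hyb z hz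
      exact ⟨z, hzb, hzr, e1.symm, hxz⟩

/-- This ensures that no component is listed twice. The tree path from `y` to `y'` has a single
label, and comparing it with the gates at both ends identifies it with `lab y` and with `lab y'`. -/
theorem label_eq_of_labelSet_eq (h : IsTree F b r p ord) (hC : LabelsComplete F b p ord lab)
    (hS : LabelsSound F b r p lab) {y y' : V} (hyb : y ≠ b) (hyr : y ≠ r) (hyb' : y' ≠ b)
    (hyr' : y' ≠ r) (he : labelSet b r p lab (lab y) = labelSet b r p lab (lab y')) :
    lab y = lab y' := by
  by_cases e : y = y'
  · rw [e]
  have hB := isBlock_labelSet h hC hS hyb hyr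
  have m1 : y ∈ labelSet b r p lab (lab y) := mem_labelSet hyb hyr
  have m2 : p y ∈ labelSet b r p lab (lab y) := par_mem_labelSet hyb hyr
  have m3 : y' ∈ labelSet b r p lab (lab y) := he ▸ mem_labelSet hyb' hyr'
  have m4 : p y' ∈ labelSet b r p lab (lab y) := he ▸ par_mem_labelSet hyb' hyr'
  obtain ⟨l, hl⟩ := h.exists_climb hyb hyb'
  have hm := hC.mono_of_same h hl hyb hyb' (hB.2.1 _ m1 _ m3)
  obtain ⟨⟨z, hz, -⟩, -⟩ := hl.ends e
  have e1 := hl.gate_left h hyb hyb' e (lab := lab) fun z' hz' => hm z' hz' z hz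
  have e2 := hl.gate_right h hyb hyb' e (lab := lab) fun z' hz' => hm z' hz' z hz
  rw [hC.gate_of_same_par h hyb' hyr' e (hB.2.1 _ m1 _ m4)] at e1
  rw [hC.gate_of_same_par h hyb hyr (Ne.symm e) (hB.2.1 _ m3 _ m2)] at e2
  exact e2.trans e1.symm

/-- Vertices that are pairwise not separated are contained in one of the sets given by the
labels. -/
theorem exists_labelSet_superset (h : IsTree F b r p ord) (hC : LabelsComplete F b p ord lab)
    (hS : LabelsSound F b r p lab) (hV : ∃ x, x ≠ b ∧ x ≠ r) {S : Set V} (hSb : S ⊆ {b}ᶜ)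
    (hSS : ∀ x ∈ S, ∀ y ∈ S, Same F b x y) :
    ∃ y, y ≠ b ∧ y ≠ r ∧ S ⊆ labelSet b r p lab (lab y) := by
  obtain ⟨x₀, hxb, hxr⟩ := hV
  by_cases hs : ∃ u ∈ S, ∃ w ∈ S, u ≠ w
  · obtain ⟨u, hu, w, hw, ne⟩ := hs
    obtain ⟨l, hl⟩ := h.exists_climb (hSb hu) (hSb hw)
    have hm := hC.mono_of_same h hl (hSb hu) (hSb hw) (hSS u hu w hw)
    obtain ⟨⟨z, hz, hzu⟩, z', hz', hzw⟩ := hl.ends ne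
    obtain ⟨h1, h2⟩ := hl.mem_ne h (hSb hu) (hSb hw) z hz
    obtain ⟨h3, h4⟩ := hl.mem_ne h (hSb hu) (hSb hw) z' hz'
    refine ⟨z, h1, h2, fun x hx => ?_⟩
    exact (isBlock_labelSet h hC hS h1 h2).mem_of_two (x := u) (y := w) ⟨z, h1, h2, rfl, hzu⟩
      ⟨z', h3, h4, hm z' hz' z hz, hzw⟩ ne (hSb hx) (hSS x hx u hu) (hSS x hx w hw)
  · push Not at hs
    rcases S.eq_empty_or_nonempty with rfl | ⟨u, hu⟩
    · exact ⟨x₀, hxb, hxr, by simp⟩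
    · have hub := hSb hu
      -- A single vertex is an end of some tree edge, since the tree has the further vertex `x₀`
      -- besides its root. Hence there are no trivial components to be listed separately.
      suffices H : ∃ y, y ≠ b ∧ y ≠ r ∧ u ∈ labelSet b r p lab (lab y) by
        obtain ⟨y, h1, h2, h3⟩ := H
        exact ⟨y, h1, h2, fun x hx => hs u hu x hx ▸ h3⟩
      by_cases hur : u = r
      · subst hur
        obtain ⟨l, hl⟩ := h.exists_climb hub hxb
        obtain ⟨⟨z, hz, hzu⟩, -⟩ := hl.ends (Ne.symm hxr)
        obtain ⟨h1, h2⟩ := hl.mem_ne h hub hxb z hz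
        exact ⟨z, h1, h2, z, h1, h2, rfl, hzu⟩
      · exact ⟨u, hub, hur, mem_labelSet hub hur⟩

/-- The strongly biconnected components are the sets given by the labels. -/
theorem isSBComponent_iff (h : IsTree F b r p ord) (hC : LabelsComplete F b p ord lab)
    (hS : LabelsSound F b r p lab) (hV : ∃ x, x ≠ b ∧ x ≠ r)
    (hF : ∀ u w, u ≠ b → w ≠ b → ReachIn (fun x y => (x, y) ∈ F) {b}ᶜ u w) (S : Set V) :
    IsSBComponent (graph F) b S ↔ ∃ y, y ≠ b ∧ y ≠ r ∧ S = labelSet b r p lab (lab y) := by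
  have sb : ∀ y, y ≠ b → y ≠ r → labelSet b r p lab (lab y) ⊆ {b}ᶜ ∧
      StronglyBiconnected (induce (graph F) (labelSet b r p lab (lab y))) := fun y hyb hyr =>
    ⟨(isBlock_labelSet h hC hS hyb hyr).1,
      (isBlock_labelSet h hC hS hyb hyr).stronglyBiconnected ⟨y, mem_labelSet hyb hyr⟩ hF⟩
  have sup : ∀ T : Set V, T ⊆ {b}ᶜ ∧ StronglyBiconnected (induce (graph F) T) →
      ∃ y, y ≠ b ∧ y ≠ r ∧ T ⊆ labelSet b r p lab (lab y) := fun T hT =>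
    exists_labelSet_superset h hC hS hV hT.1
      fun x hx y hy => same_of_stronglyBiconnected hT.1 hT.2 hx hy
  constructor
  · intro hmax
    obtain ⟨y, hyb, hyr, hy⟩ := sup S hmax.1
    exact ⟨y, hyb, hyr, hy.antisymm (hmax.2 (sb y hyb hyr) hy)⟩
  · rintro ⟨y, hyb, hyr, rfl⟩
    refine ⟨sb y hyb hyr, fun T hT hle => ?_⟩
    obtain ⟨y', hyb', hyr', hy'⟩ := sup T hT
    refine hy'.trans fun x hx => ?_
    have hB' := isBlock_labelSet h hC hS hyb' hyr'
    exact (isBlock_labelSet h hC hS hyb hyr).2.2 x (hB'.1 x hx)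
      fun z hz => hB'.2.1 x hx z (hy' (hle hz))

theorem LabelsSound.mono (hF : F ⊆ F') (h : LabelsSound F b r p lab) :
    LabelsSound F' b r p lab := fun z z' h1 h2 h3 h4 e =>
  let ⟨k1, k2, k3, k4⟩ := h z z' h1 h2 h3 h4 e
  ⟨k1.mono hF, k2.mono hF, k3.mono hF, k4.mono hF⟩

/-- If every vertex is its own label, then the labelling is sound. -/
theorem LabelsSound.of_injective (h : IsTree F b r p ord) (hi : lab.Injective) :
    LabelsSound F b r p lab := by
  intro z z' h1 h2 _ _ e
  rw [← hi e]
  have := Same.of_sym (h.sym h1 h2) h1 (h.par_ne z h1 h2)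
  exact ⟨Same.refl _, this, this.symm, Same.refl _⟩

/-- Merging the labels on the tree path between the ends of an edge. -/
theorem LabelsSound.relabel (h : IsTree F b r p ord) (hS : LabelsSound F b r p lab) {u w : V}
    {l : List V} (hc : Climb p ord u w l) (hu : u ≠ b) (hw : w ≠ b) (huw : (u, w) ∈ F)
    {lab' : V → L} {c : L} (h1 : ∀ y, (∃ z ∈ l, lab y = lab z) → lab' y = c)
    (h2 : ∀ y, (¬ ∃ z ∈ l, lab y = lab z) → lab' y = lab y) (hcl : l ≠ [] → ∃ z ∈ l, lab z = c) :
    LabelsSound F b r p lab' := by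
  have hsame : Same F b u w := Same.of_sym (Or.inl huw) hu hw
  -- The edge `(u, w)` makes its ends inseparable, and then the whole tree path between them lies in
  -- one block.
  have inpath : ∀ {z z'}, z ∈ l → z' ∈ l →
      Same F b z z' ∧ Same F b z (p z') ∧ Same F b (p z) z' ∧ Same F b (p z) (p z') := by
    intro z z' hz hz'
    have m : ∀ {z}, z ∈ l → onPath p u w l z ∧ onPath p u w l (p z) := fun {z} hz =>
      ⟨Or.inr (Or.inr (Or.inl hz)), Or.inr (Or.inr (Or.inr ⟨z, hz, rfl⟩))⟩
    exact ⟨hc.same h hu hw hsame (m hz).1 (m hz').1, hc.same h hu hw hsame (m hz).1 (m hz').2,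
      hc.same h hu hw hsame (m hz).2 (m hz').1, hc.same h hu hw hsame (m hz).2 (m hz').2⟩
  -- Lying in a common block is transitive for tree edges, because the middle edge has two distinct
  -- ends.
  have trans : ∀ {z₁ z₂ z₃}, z₂ ≠ b → z₂ ≠ r →
      (Same F b z₁ z₂ ∧ Same F b z₁ (p z₂) ∧ Same F b (p z₁) z₂ ∧ Same F b (p z₁) (p z₂)) →
      (Same F b z₂ z₃ ∧ Same F b z₂ (p z₃) ∧ Same F b (p z₂) z₃ ∧ Same F b (p z₂) (p z₃)) →
      Same F b z₁ z₃ ∧ Same F b z₁ (p z₃) ∧ Same F b (p z₁) z₃ ∧ Same F b (p z₁) (p z₃) := by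
    rintro z₁ z₂ z₃ hb hr ⟨a1, a2, a3, a4⟩ ⟨c1, c2, c3, c4⟩
    have ne := (h.par_ne_self hb hr).symm
    exact ⟨Same.of_two ne a1 a2 c1.symm c3.symm, Same.of_two ne a1 a2 c2.symm c4.symm,
      Same.of_two ne a3 a4 c1.symm c3.symm, Same.of_two ne a3 a4 c2.symm c4.symm⟩
  intro y y' hyb hyr hyb' hyr' e
  by_cases k : ∃ z ∈ l, lab y = lab z <;> by_cases k' : ∃ z ∈ l, lab y' = lab z
  · obtain ⟨z, hz, e1⟩ := k
    obtain ⟨z', hz', e2⟩ := k'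
    obtain ⟨hzb, hzr⟩ := hc.mem_ne h hu hw z hz
    obtain ⟨hzb', hzr'⟩ := hc.mem_ne h hu hw z' hz'
    exact trans hzb hzr (hS y z hyb hyr hzb hzr e1)
      (trans hzb' hzr' (inpath hz hz') (hS z' y' hzb' hzr' hyb' hyr' e2.symm))
  -- The merged label `c` was already in use on the path, so it differs from every label that is
  -- kept.
  · rw [h1 y k, h2 y' k'] at e
    obtain ⟨z, hz, -⟩ := k
    obtain ⟨z', hz', e'⟩ := hcl (List.ne_nil_of_mem hz)
    exact absurd ⟨z', hz', e.symm.trans e'.symm⟩ k'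
  · rw [h2 y k, h1 y' k'] at e
    obtain ⟨z, hz, -⟩ := k'
    obtain ⟨z', hz', e'⟩ := hcl (List.ne_nil_of_mem hz)
    exact absurd ⟨z', hz', e.trans e'.symm⟩ k
  · rw [h2 y k, h2 y' k'] at e
    exact hS y y' hyb hyr hyb' hyr' e

theorem Mono.relabel {l l₀ : List V} (hm : Mono lab l) {lab' : V → L} {c : L}
    (h1 : ∀ y, (∃ z ∈ l₀, lab y = lab z) → lab' y = c)
    (h2 : ∀ y, (¬ ∃ z ∈ l₀, lab y = lab z) → lab' y = lab y) : Mono lab' l := by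
  intro z hz z' hz'
  have e := hm z hz z' hz'
  by_cases k : ∃ x ∈ l₀, lab z = lab x
  · rw [h1 z k, h1 z' (by rwa [← e])]
  · rw [h2 z k, h2 z' (by rwa [← e]), e]

theorem mono_relabel_self {l : List V} {lab' : V → L} {c : L}
    (h1 : ∀ y, (∃ z ∈ l, lab y = lab z) → lab' y = c) : Mono lab' l := fun z hz z' hz' => by
  rw [h1 z ⟨z, hz, rfl⟩, h1 z' ⟨z', hz', rfl⟩]

end Labels

end Tree

/-! ### Edges that a 2-vertex-connected graph can do without -/

section Removal

variable {V : Type*} {R R' : V → V → Prop} {q : ℕ → V} {k : ℕ} {nxt : V → V}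

/-- A path `q 0, …, q k` in a graph with edge relation `R` can be augmented to two internally
disjoint paths iff its end is reachable in the residual graph `R'`. -/
theorem residual_reachIn_iff (hq : ∀ i < k, R (q i) (q (i + 1)))
    (hinj : ∀ i ≤ k, ∀ j ≤ k, q i = q j → i = j) (hn : ∀ i < k, nxt (q i) = q (i + 1))
    (hn' : ∀ y, (∀ i < k, y ≠ q i) → nxt y = y)
    (hR' : ∀ x y, R' x y ↔ R x (nxt y) ∨ ∃ i < k, x = q (i + 1) ∧ y = q i) :
    ReachIn R' Set.univ (q 0) (q k) ↔
      ∀ v, v ≠ q 0 → v ≠ q k → ReachIn R {v}ᶜ (q 0) (q k) := by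
  -- In the residual graph `q i` stands for leaving `q i`. An edge into `q (i + 1)` enters an
  -- occupied vertex and forces a step back along the path, so it counts as an edge to `q i`; this
  -- is the shift of heads by `nxt`. The end `q k` is not shifted and can be entered directly.
  constructor
  · intro h v hv0 hvk
    by_contra hcon
    have seg : ∀ i j, i ≤ j → j ≤ k → (∀ l, i ≤ l → l ≤ j → q l ≠ v) →
        ReachIn R {v}ᶜ (q i) (q j) := by
      intro i j hij
      induction j, hij using Nat.le_induction with
      | base => intro _ _; exact ReachIn.refl _
      | succ j hij ih =>
        intro hjk hv
        refine (ih (by omega) fun l h1 h2 => hv l h1 (by omega)).trans ?_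
        exact ReachIn.single (hv j hij (by omega)) (hv (j + 1) (by omega) le_rfl) (hq j (by omega))
    -- A separating vertex lies on the path, since otherwise the path itself avoids it. If it is `q
    -- i`, the vertices reachable without it include `q j` for `j < i` and exclude `q j` for `j >
    -- i`; this set is closed under residual edges and so would contain `q k`.
    by_cases hon : ∃ i ≤ k, q i = v
    · obtain ⟨i, hik, rfl⟩ := hon
      have pre : ∀ j < i, ReachIn R {q i}ᶜ (q 0) (q j) := fun j hj =>
        seg 0 j (by omega) (by omega) fun l _ h2 e => by
          have := hinj l (by omega) i hik e
          omega
      have post : ∀ j, i < j → j ≤ k → ¬ ReachIn R {q i}ᶜ (q 0) (q j) := fun j hj hjk hr =>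
        hcon (hr.trans (seg j k hjk le_rfl fun l h1 h2 e => by
          have := hinj l (by omega) i hik e
          omega))
      have hi0 : i ≠ 0 := fun e => hv0 (by rw [e])
      have hik' : i ≠ k := fun e => hvk (by rw [e])
      have mem : ∀ {x}, ReachIn R {q i}ᶜ (q 0) x → x ≠ q i := fun hx =>
        hx.mem_right (Ne.symm hv0)
      refine hcon (h.mem_closed (P := fun x => ReachIn R {q i}ᶜ (q 0) x) (ReachIn.refl _) ?_)
      intro x _ y _ hxy hx
      rcases (hR' x y).1 hxy with hxy | ⟨j, hj, rfl, rfl⟩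
      · by_cases hy : ∃ j < k, y = q j
        · obtain ⟨j, hj, rfl⟩ := hy
          rw [hn j hj] at hxy
          rcases lt_or_ge j i with hji | hji
          · exact pre j hji
          · refine absurd (hx.trans (ReachIn.single (mem hx) ?_ hxy)) (post (j + 1) (by omega) hj)
            intro e
            have := hinj (j + 1) hj i hik e
            omega
        · push Not at hy
          rw [hn' y hy] at hxy
          exact hx.trans (ReachIn.single (mem hx) (hy i (by omega)) hxy)
      · rcases lt_trichotomy (j + 1) i with hji | hji | hji
        · exact pre j (by omega)
        · exact absurd (by rw [hji]) (mem hx)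
        · exact absurd hx (post (j + 1) hji hj)
    · push Not at hon
      exact hcon (seg 0 k (by omega) le_rfl fun l _ hl => hon l hl)
  · intro h
    by_contra hw
    set Z : V → Prop := fun x => ReachIn R' Set.univ (q 0) x with hZ
    have hstep : ∀ {x y}, Z x → R' x y → Z y := fun hx hxy =>
      hx.trans (ReachIn.single trivial trivial hxy)
    classical
    have hex : ∃ i, ¬ Z (q i) := ⟨k, hw⟩
    -- The first path vertex outside `Z` is the separating one. By the backward edges all later path
    -- vertices are outside `Z` as well, and an edge from `Z` into `q j` with `j > i` would put `q
    -- (j - 1)` into `Z`.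
    set i := Nat.find hex with hi
    have hiZ : ¬ Z (q i) := Nat.find_spec hex
    have hlt : ∀ j < i, Z (q j) := fun j hj => not_not.1 (Nat.find_min hex hj)
    have hik : i ≤ k := Nat.find_min' hex hw
    have hi0 : i ≠ 0 := fun e => hiZ (by rw [e]; exact ReachIn.refl _)
    have hik' : i ≠ k := by
      intro e
      refine hw (hstep (hlt (k - 1) (by omega)) ((hR' _ _).2 (Or.inl ?_)))
      rw [hn' (q k) fun j hj e' => by have := hinj k le_rfl j hj.le e'; omega]
      have := hq (k - 1) (by omega)
      rwa [Nat.sub_add_cancel (by omega)] at this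
    have desc : ∀ j, i ≤ j → j ≤ k → ¬ Z (q j) := by
      intro j hij
      induction j, hij using Nat.le_induction with
      | base => exact fun _ => hiZ
      | succ j _ ih =>
        exact fun hj hz => ih (by omega) (hstep hz ((hR' _ _).2 (Or.inr ⟨j, hj, rfl, rfl⟩)))
    refine hw ((h (q i) (fun e => hi0 (hinj i hik 0 (by omega) e))
      (fun e => hik' (hinj i hik k le_rfl e))).mem_closed (P := Z) (ReachIn.refl _) ?_)
    intro x _ y hy hxy hx
    by_cases hyq : ∃ j ≤ k, y = q j
    · obtain ⟨j, hj, rfl⟩ := hyq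
      rcases lt_or_ge j i with hji | hji
      · exact hlt j hji
      · have hne : j ≠ i := fun e => hy (by rw [e]; rfl)
        refine absurd (hstep hx ((hR' x (q (j - 1))).2 (Or.inl ?_))) (desc (j - 1) (by omega) (by omega))
        rw [hn (j - 1) (by omega), Nat.sub_add_cancel (by omega)]
        exact hxy
    · push Not at hyq
      refine hstep hx ((hR' _ _).2 (Or.inl ?_))
      rw [hn' y fun j hj => hyq j hj.le]
      exact hxy

variable [DecidableEq V] {E F : Finset (V × V)}

/-- Any other path that used the deleted edge can be repaired by a path from `u` to `w` avoiding the
same vertex. So one pair of vertices has to be tested instead of all. -/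
theorem twoVertexConnected_erase_iff (hF : TwoVertexConnected (graph F)) (u w : V) :
    TwoVertexConnected (graph (F.erase (u, w))) ↔
      ReachIn (fun x y => (x, y) ∈ F.erase (u, w)) Set.univ u w ∧
        ∀ v, v ≠ u → v ≠ w → ReachIn (fun x y => (x, y) ∈ F.erase (u, w)) {v}ᶜ u w := by
  rw [twoVertexConnected_graph] at hF ⊢
  constructor
  · exact fun h => ⟨h.2.1 u w, fun v hu hw => h.2.2 v u w hu.symm hw.symm⟩
  · rintro ⟨h1, h2⟩
    refine ⟨hF.1, fun a c => (hF.2.1 a c).replace fun x _ y _ hxy => ?_,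
      fun v a c ha hc => (hF.2.2 v a c ha hc).replace fun x hx y hy hxy => ?_⟩
    · by_cases e : (x, y) = (u, w)
      · cases e
        exact h1
      · exact ReachIn.single trivial trivial (Finset.mem_erase.2 ⟨e, hxy⟩)
    · by_cases e : (x, y) = (u, w)
      · cases e
        exact h2 v (Ne.symm hx) (Ne.symm hy)
      · exact ReachIn.single hx hy (Finset.mem_erase.2 ⟨e, hxy⟩)

/-- A proper subset misses some edge `e`, and by monotonicity its 2-vertex-connectivity would pass
to `F.erase e`. Single deletions therefore decide minimality. -/
theorem isMinimalTwoVertexConnected_of_erase (hFE : F ⊆ E) (hF : TwoVertexConnected (graph F))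
    (h : ∀ e ∈ F, ¬ TwoVertexConnected (graph (F.erase e))) : IsMinimalTwoVertexConnected E F := by
  refine ⟨⟨hFE, hF⟩, fun F' hF' hle e he => ?_⟩
  by_contra hne
  exact h e he (hF'.2.mono fun x hx => Finset.mem_erase.2 ⟨fun e' => hne (e' ▸ hx), hle hx⟩)

end Removal

/-! ### Programs with counting loops

Commands with loops of the form `for x < N` have total semantics and a running time that can be
computed; they are compiled to programs of the machine. -/

section State

variable (σ : State) (x y a a' i j v : ℕ)

@[simp] theorem State.setVar_var : (σ.setVar x v).var y = if y = x then v else σ.var y := by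
  simp [State.setVar, Function.update_apply]

@[simp] theorem State.setVar_arr : (σ.setVar x v).arr = σ.arr := rfl

@[simp] theorem State.setVar_out : (σ.setVar x v).out = σ.out := rfl

@[simp] theorem State.setArr_var : (σ.setArr a i v).var = σ.var := rfl

@[simp] theorem State.setArr_out : (σ.setArr a i v).out = σ.out := rfl

theorem State.setArr_arr_of_ne (h : a' ≠ a) : (σ.setArr a i v).arr a' = σ.arr a' := by
  simp [State.setArr, h]

theorem State.setArr_arr :
    (σ.setArr a i v).arr a' j = if a' = a ∧ j = i then v else σ.arr a' j := by
  by_cases h : a' = a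
  · subst h
    simp [State.setArr, Function.update_apply]
  · simp [State.setArr, h]

@[simp] theorem State.write_var : (σ.write v).var = σ.var := rfl

@[simp] theorem State.write_arr : (σ.write v).arr = σ.arr := rfl

@[simp] theorem State.write_out : (σ.write v).out = σ.out ++ [v] := rfl

end State

inductive Cmd
  | skip
  | assign (x : ℕ) (e : Expr)
  | store (a : ℕ) (i e : Expr)
  | emit (e : Expr)
  | seq (p q : Cmd)
  | ite (e : Expr) (p q : Cmd)
  | loop (x N : ℕ) (p : Cmd)

namespace Cmd

def compile : Cmd → Program
  | skip => .skip
  | assign x e => .assign x e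
  | store a i e => .store a i e
  | emit e => .emit e
  | seq p q => .seq p.compile q.compile
  | ite e p q => .ite e p.compile q.compile
  | loop x N p => .seq (.assign x (.lit 0)) (.while (.op .lt (.var x) (.var N))
      (.seq p.compile (.assign x (.op .add (.var x) (.lit 1)))))

/-- The state after `k` rounds of a loop with counter `x` and body `f`. -/
def iter (f : State → State) (x : ℕ) (σ : State) : ℕ → State
  | 0 => σ.setVar x 0
  | k + 1 => (f (iter f x σ k)).setVar x (k + 1)

/-- The number of rounds is fixed on entry and the counter is set anew after each round. This agrees
with the compiled loop if the body changes neither the counter nor the bound, which `ok` checks. -/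
def eval : Cmd → State → State
  | skip, σ => σ
  | assign x e, σ => σ.setVar x (e.eval σ)
  | store a i e, σ => σ.setArr a (i.eval σ) (e.eval σ)
  | emit e, σ => σ.write (e.eval σ)
  | seq p q, σ => q.eval (p.eval σ)
  | ite e p q, σ => if e.eval σ ≠ 0 then p.eval σ else q.eval σ
  | loop x N p, σ => iter p.eval x σ (σ.var N)

section

variable (σ : State)

theorem eval_skip : skip.eval σ = σ := by rw [eval]

theorem eval_assign (x : ℕ) (e : Expr) : (assign x e).eval σ = σ.setVar x (e.eval σ) := by
  rw [eval]

theorem eval_store (a : ℕ) (i e : Expr) :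
    (store a i e).eval σ = σ.setArr a (i.eval σ) (e.eval σ) := by rw [eval]

theorem eval_emit (e : Expr) : (emit e).eval σ = σ.write (e.eval σ) := by rw [eval]

theorem eval_seq (p q : Cmd) : (seq p q).eval σ = q.eval (p.eval σ) := by rw [eval]

theorem eval_ite (e : Expr) (p q : Cmd) :
    (ite e p q).eval σ = if e.eval σ ≠ 0 then p.eval σ else q.eval σ := by rw [eval]

end

def time : Cmd → State → ℕ
  | skip, _ => 1
  | assign _ e, _ => e.cost + 1
  | store _ i e, _ => i.cost + e.cost + 1
  | emit e, _ => e.cost + 1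
  | seq p q, σ => p.time σ + q.time (p.eval σ)
  | ite e p q, σ => e.cost + 1 + if e.eval σ ≠ 0 then p.time σ else q.time σ
  -- Clearing the counter takes 2 steps and the final test 4; each round takes 4 for its test and 4
  -- for the increment.
  | loop x N p, σ => 6 + ∑ k ∈ Finset.range (σ.var N), (p.time (iter p.eval x σ k) + 8)

/-- The command may change the variable `y`. -/
def writes : Cmd → ℕ → Bool
  | skip, _ => false
  | assign x _, y => x == y
  | store _ _ _, _ => false
  | emit _, _ => false
  | seq p q, y => p.writes y || q.writes y
  | ite _ p q, y => p.writes y || q.writes y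
  | loop x _ p, y => x == y || p.writes y

/-- The command may change the array `a`. -/
def stores : Cmd → ℕ → Bool
  | skip, _ => false
  | assign _ _, _ => false
  | store a _ _, a' => a == a'
  | emit _, _ => false
  | seq p q, a => p.stores a || q.stores a
  | ite _ p q, a => p.stores a || q.stores a
  | loop _ _ p, a => p.stores a

def emits : Cmd → Bool
  | skip => false
  | assign _ _ => false
  | store _ _ _ => false
  | emit _ => true
  | seq p q => p.emits || q.emits
  | ite _ p q => p.emits || q.emits
  | loop _ _ p => p.emits

/-- Everything that the command `c` cannot change is the same in `σ` and `τ`. -/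
structure Frame (c : Cmd) (σ τ : State) : Prop where
  var : ∀ y, c.writes y = false → τ.var y = σ.var y
  arr : ∀ a, c.stores a = false → τ.arr a = σ.arr a
  out : c.emits = false → τ.out = σ.out

theorem Frame.refl (c : Cmd) (σ : State) : Frame c σ σ :=
  ⟨fun _ _ => rfl, fun _ _ => rfl, fun _ => rfl⟩

theorem Frame.trans {c : Cmd} {σ τ υ : State} (h : Frame c σ τ) (h' : Frame c τ υ) :
    Frame c σ υ :=
  ⟨fun y hy => (h'.var y hy).trans (h.var y hy), fun a ha => (h'.arr a ha).trans (h.arr a ha),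
    fun ho => (h'.out ho).trans (h.out ho)⟩

theorem Frame.weaken {c d : Cmd} {σ τ : State} (h : Frame c σ τ)
    (hv : ∀ y, d.writes y = false → c.writes y = false)
    (ha : ∀ a, d.stores a = false → c.stores a = false)
    (ho : d.emits = false → c.emits = false) : Frame d σ τ :=
  ⟨fun y hy => h.var y (hv y hy), fun a h' => h.arr a (ha a h'), fun h' => h.out (ho h')⟩

theorem frame_setVar_loop {x N : ℕ} {p : Cmd} (σ : State) (v : ℕ) :
    Frame (loop x N p) σ (σ.setVar x v) := by
  refine ⟨fun y hy => ?_, fun _ _ => rfl, fun _ => rfl⟩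
  have : y ≠ x := fun e => by simp [writes, e] at hy
  simp [this]

theorem frame_iter {x N : ℕ} {p : Cmd} (hp : ∀ σ, Frame p σ (p.eval σ)) (σ : State) (k : ℕ) :
    Frame (loop x N p) σ (iter p.eval x σ k) := by
  induction k with
  | zero => exact frame_setVar_loop σ 0
  | succ k ih =>
    refine (ih.trans ((hp _).weaken ?_ ?_ ?_)).trans (frame_setVar_loop _ _)
    · intro y hy
      simp only [writes, Bool.or_eq_false_iff] at hy
      exact hy.2
    · exact fun a ha => ha
    · exact fun ho => ho

/-- The sets of written variables and arrays are computed by Boolean functions, so for a concrete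
command the side conditions of `Frame` hold by `rfl`. -/
theorem frame (c : Cmd) : ∀ σ, Frame c σ (c.eval σ) := by
  induction c with
  | skip => exact fun σ => Frame.refl _ σ
  | assign x e =>
    intro σ
    refine ⟨fun y hy => ?_, fun _ _ => rfl, fun _ => rfl⟩
    have : y ≠ x := fun e => by simp [writes, e] at hy
    simp [eval, this]
  | store a i e =>
    intro σ
    refine ⟨fun _ _ => rfl, fun a' ha => ?_, fun _ => rfl⟩
    have : a' ≠ a := fun e => by simp [stores, e] at ha
    exact State.setArr_arr_of_ne _ _ _ _ _ this
  | emit e => exact fun σ => ⟨fun _ _ => rfl, fun _ _ => rfl, fun h => by simp [emits] at h⟩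
  | seq p q hp hq =>
    intro σ
    refine ((hp σ).weaken ?_ ?_ ?_).trans ((hq (p.eval σ)).weaken ?_ ?_ ?_) <;>
      simp +contextual [writes, stores, emits]
  | ite e p q hp hq =>
    intro σ
    by_cases h : e.eval σ ≠ 0
    · rw [eval, if_pos h]
      refine (hp σ).weaken ?_ ?_ ?_ <;> simp +contextual [writes, stores, emits]
    · rw [eval, if_neg h]
      refine (hq σ).weaken ?_ ?_ ?_ <;> simp +contextual [writes, stores, emits]
  | loop x N p hp => exact fun σ => frame_iter hp σ _

theorem iter_var_self (f : State → State) (x : ℕ) (σ : State) (k : ℕ) :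
    (iter f x σ k).var x = k := by
  cases k <;> simp [iter]

/-- Induction over the rounds of a loop. -/
theorem loop_induct {x N : ℕ} {p : Cmd} {σ : State} (I : ℕ → State → Prop)
    (h0 : I 0 (σ.setVar x 0))
    (hs : ∀ k < σ.var N, ∀ τ, τ.var x = k → Frame (loop x N p) σ τ → I k τ →
      I (k + 1) ((p.eval τ).setVar x (k + 1))) :
    I (σ.var N) ((loop x N p).eval σ) := by
  have : ∀ k ≤ σ.var N, I k (iter p.eval x σ k) := by
    intro k
    induction k with
    | zero => exact fun _ => h0
    | succ k ih =>
      exact fun hk => hs k hk _ (iter_var_self _ _ _ _) (frame_iter (frame p) σ k) (ih (by omega))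
  exact this _ le_rfl

/-- Induction over the rounds of a loop, with the time spent in the body. -/
theorem loop_induct_time {x N : ℕ} {p : Cmd} {σ : State} (I : ℕ → State → ℕ → Prop)
    (h0 : I 0 (σ.setVar x 0) 0)
    (hs : ∀ k < σ.var N, ∀ τ t, τ.var x = k → Frame (loop x N p) σ τ → I k τ t →
      I (k + 1) ((p.eval τ).setVar x (k + 1)) (t + p.time τ)) :
    ∃ t, I (σ.var N) ((loop x N p).eval σ) t ∧
      (loop x N p).time σ = 6 + (t + σ.var N * 8) := by
  have : ∀ k ≤ σ.var N, I k (iter p.eval x σ k)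
      (∑ i ∈ Finset.range k, p.time (iter p.eval x σ i)) := by
    intro k
    induction k with
    | zero => exact fun _ => h0
    | succ k ih =>
      intro hk
      rw [Finset.sum_range_succ]
      exact hs k hk _ _ (iter_var_self _ _ _ _) (frame_iter (frame p) σ k) (ih (by omega))
  refine ⟨_, this _ le_rfl, ?_⟩
  simp [time, Finset.sum_add_distrib]

/-! #### Running time -/

/-- An upper bound for the running time if the variable `N` holds `β N` for all `N ≤ 2`. -/
def cost (β : ℕ → ℕ) : Cmd → ℕ
  | skip => 1
  | assign _ e => e.cost + 1
  | store _ i e => i.cost + e.cost + 1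
  | emit e => e.cost + 1
  | seq p q => p.cost β + q.cost β
  | ite e p q => e.cost + 1 + (p.cost β + q.cost β)
  | loop _ N p => 6 + β N * (p.cost β + 8)

/-- The loop bounds are among the variables `0`, `1` and `2`, and these are never changed. -/
def static : Cmd → Bool
  | skip => true
  | assign x _ => decide (2 < x)
  | store _ _ _ => true
  | emit _ => true
  | seq p q => p.static && q.static
  | ite _ p q => p.static && q.static
  | loop x N p => decide (2 < x) && decide (N ≤ 2) && p.static

theorem writes_of_static {c : Cmd} (h : c.static = true) : ∀ y ≤ 2, c.writes y = false := by
  induction c with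
  | skip => exact fun _ _ => rfl
  | store => exact fun _ _ => rfl
  | emit => exact fun _ _ => rfl
  | assign x e =>
    intro y hy
    simp only [static, decide_eq_true_eq] at h
    simp only [writes, beq_eq_false_iff_ne]
    omega
  | seq p q hp hq =>
    simp only [static, Bool.and_eq_true] at h
    exact fun y hy => by simp [writes, hp h.1 y hy, hq h.2 y hy]
  | ite e p q hp hq =>
    simp only [static, Bool.and_eq_true] at h
    exact fun y hy => by simp [writes, hp h.1 y hy, hq h.2 y hy]
  | loop x N p hp =>
    intro y hy
    simp only [static, Bool.and_eq_true, decide_eq_true_eq] at h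
    simp only [writes, hp h.2 y hy, Bool.or_false, beq_eq_false_iff_ne]
    omega

theorem time_le_cost {β : ℕ → ℕ} {c : Cmd} (h : c.static = true) :
    ∀ σ : State, (∀ y ≤ 2, σ.var y = β y) → c.time σ ≤ c.cost β := by
  induction c with
  | skip => exact fun _ _ => le_rfl
  | store => exact fun _ _ => le_rfl
  | emit => exact fun _ _ => le_rfl
  | assign x e => exact fun _ _ => le_rfl
  | seq p q hp hq =>
    intro σ hσ
    simp only [static, Bool.and_eq_true] at h
    exact add_le_add (hp h.1 σ hσ) (hq h.2 _ fun y hy =>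
      ((frame p σ).var y (writes_of_static h.1 y hy)).trans (hσ y hy))
  | ite e p q hp hq =>
    intro σ hσ
    simp only [static, Bool.and_eq_true] at h
    have h1 := hp h.1 σ hσ
    have h2 := hq h.2 σ hσ
    simp only [time, cost]
    split_ifs <;> omega
  | loop x N p hp =>
    intro σ hσ
    have h' := h
    simp only [static, Bool.and_eq_true, decide_eq_true_eq] at h
    simp only [time, cost, hσ N h.1.2]
    refine Nat.add_le_add_left ?_ 6
    refine (Finset.sum_le_card_nsmul _ _ (p.cost β + 8) fun k _ => ?_).trans (by simp)
    refine Nat.add_le_add_right (hp h.2 _ fun y hy => ?_) 8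
    exact ((frame_iter (N := N) (frame p) σ k).var y (writes_of_static h' y hy)).trans (hσ y hy)

end Cmd

/-! #### Bounds for the values -/

/-- All memory cells hold numbers that are at most `B`. -/
def State.Bounded (B : ℕ) (σ : State) : Prop := (∀ x, σ.var x ≤ B) ∧ ∀ a i, σ.arr a i ≤ B

theorem State.Bounded.mono {B B' : ℕ} {σ : State} (h : σ.Bounded B) (hB : B ≤ B') :
    σ.Bounded B' := ⟨fun x => (h.1 x).trans hB, fun a i => (h.2 a i).trans hB⟩

theorem State.Bounded.setVar {B : ℕ} {σ : State} (h : σ.Bounded B) {x v : ℕ} (hv : v ≤ B) :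
    (σ.setVar x v).Bounded B := by
  refine ⟨fun y => ?_, h.2⟩
  rw [State.setVar_var]
  split_ifs
  exacts [hv, h.1 y]

theorem State.Bounded.setArr {B : ℕ} {σ : State} (h : σ.Bounded B) {a i v : ℕ} (hv : v ≤ B) :
    (σ.setArr a i v).Bounded B := by
  refine ⟨h.1, fun a' j => ?_⟩
  rw [State.setArr_arr]
  split_ifs
  exacts [hv, h.2 a' j]

namespace Expr

/-- All constants are at most `2`. -/
def small : Expr → Bool
  | lit k => decide (k ≤ 2)
  | var _ => true
  | get _ i => i.small
  | op _ e₁ e₂ => e₁.small && e₂.small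

/-- The value exceeds the values of the memory cells by at most `2`. -/
def slow : Expr → Bool
  | lit k => decide (k ≤ 2)
  | var _ => true
  | get _ _ => true
  | op .lt _ _ => true
  | op .eq _ _ => true
  | op .add (var _) (lit k) => decide (k ≤ 1)
  | _ => false

theorem one_le_cost (e : Expr) : 1 ≤ e.cost := by cases e <;> simp [cost]

/-- A product adds the exponents; a sum at most doubles the larger bound, which the exponent spent
on the operation absorbs as `2 ≤ B + 2`. -/
theorem eval_le {B : ℕ} {σ : State} (h : σ.Bounded B) :
    ∀ e : Expr, e.small = true → e.eval σ ≤ (B + 2) ^ e.cost := by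
  have one : 1 ≤ B + 2 := by omega
  intro e
  induction e with
  | lit k => intro h; simp [small] at h; simp [eval, cost]; omega
  | var x => intro _; simpa [eval, cost] using (h.1 x).trans (by omega)
  | get a i _ =>
    intro _
    refine (h.2 a _).trans ?_
    calc B ≤ (B + 2) ^ 1 := by rw [pow_one]; omega
      _ ≤ _ := Nat.pow_le_pow_right (by omega) (one_le_cost _)
  | op o e₁ e₂ ih₁ ih₂ =>
    intro hs
    simp only [small, Bool.and_eq_true] at hs
    have h₁ := ih₁ hs.1
    have h₂ := ih₂ hs.2
    have p₁ : (B + 2) ^ e₁.cost ≤ (B + 2) ^ (e₁.cost + e₂.cost) :=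
      Nat.pow_le_pow_right (by omega) (by omega)
    have p₂ : (B + 2) ^ e₂.cost ≤ (B + 2) ^ (e₁.cost + e₂.cost) :=
      Nat.pow_le_pow_right (by omega) (by omega)
    have p₃ : 1 ≤ (B + 2) ^ (e₁.cost + e₂.cost) := Nat.one_le_pow _ _ (by omega)
    have p₄ : (B + 2) ^ (e₁.cost + e₂.cost) * 2 ≤ (B + 2) ^ (e₁.cost + e₂.cost + 1) := by
      rw [pow_succ]
      exact Nat.mul_le_mul_left _ (by omega)
    have p₅ : e₁.eval σ * e₂.eval σ ≤ (B + 2) ^ (e₁.cost + e₂.cost) := by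
      rw [pow_add]
      exact Nat.mul_le_mul h₁ h₂
    have p₆ : e₁.eval σ / e₂.eval σ ≤ e₁.eval σ := Nat.div_le_self _ _
    show o.eval (e₁.eval σ) (e₂.eval σ) ≤ (B + 2) ^ (e₁.cost + e₂.cost + 1)
    cases o <;> simp only [Op.eval]
    · omega
    · omega
    · omega
    · omega
    · split_ifs <;> omega
    · split_ifs <;> omega

theorem fits {B W k : ℕ} {σ : State} (h : σ.Bounded B) (hW : (B + 2) ^ k < W) :
    ∀ e : Expr, e.small = true → e.cost ≤ k → e.Fits W σ := by
  have key : ∀ e : Expr, e.small = true → e.cost ≤ k → e.eval σ < W := fun e hs hc =>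
    (eval_le h e hs).trans_lt ((Nat.pow_le_pow_right (by omega) hc).trans_lt hW)
  intro e
  induction e with
  | lit => exact key _
  | var => exact key _
  | get a i ih => exact fun hs hc => ⟨ih hs (by simp only [cost] at hc; omega), key _ hs hc⟩
  | op o e₁ e₂ ih₁ ih₂ =>
    intro hs hc
    have hs' := hs
    simp only [small, Bool.and_eq_true] at hs'
    have hc' := hc
    simp only [cost] at hc'
    exact ⟨ih₁ hs'.1 (by omega), ih₂ hs'.2 (by omega), key _ hs hc⟩

theorem eval_le_of_slow {B : ℕ} {σ : State} (h : σ.Bounded B) {e : Expr} (he : e.slow = true) :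
    e.eval σ ≤ B + 2 := by
  unfold slow at he
  split at he
  · simp only [decide_eq_true_eq] at he
    simp only [eval]
    omega
  · exact (h.1 _).trans (by omega)
  · exact (h.2 _ _).trans (by omega)
  · simp only [eval, Op.eval]
    split_ifs <;> omega
  · simp only [eval, Op.eval]
    split_ifs <;> omega
  · simp only [decide_eq_true_eq] at he
    simp only [eval, Op.eval]
    exact add_le_add (h.1 _) (he.trans one_le_two)
  · cases he

end Expr

namespace Cmd

/-- Only expressions with small constants and cost at most `20` are evaluated, the values in the
memory grow by at most `2` in each step, and the loops are counting loops. -/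
def ok : Cmd → Bool
  | skip => true
  | assign _ e => e.small && e.slow && decide (e.cost ≤ 20)
  | store _ i e => i.small && decide (i.cost ≤ 20) && (e.small && e.slow && decide (e.cost ≤ 20))
  | emit e => e.small && decide (e.cost ≤ 20)
  | seq p q => p.ok && q.ok
  | ite e p q => e.small && decide (e.cost ≤ 20) && (p.ok && q.ok)
  | loop x N p => decide (x ≠ N) && !p.writes x && !p.writes N && p.ok

/-- Memory cells stay below the initial bound plus the elapsed time, and an expression of cost at
most `20` evaluates to at most the twentieth power of that bound plus two. Hence no value overflows,
and one condition on the total time serves all steps. -/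
theorem exec {W : ℕ} (c : Cmd) (hc : c.ok = true) : ∀ (σ : State) (B : ℕ), σ.Bounded B →
    (B + c.time σ + 2) ^ 20 < W →
      Exec W c.compile σ (c.time σ) (c.eval σ) ∧ (c.eval σ).Bounded (B + c.time σ) := by
  have weak : ∀ {B t s : ℕ}, (B + t + 2) ^ 20 < W → s ≤ t → (B + s + 2) ^ 20 < W :=
    fun h hs => (Nat.pow_le_pow_left (by omega) 20).trans_lt h
  have weak₀ : ∀ {B t : ℕ}, (B + t + 2) ^ 20 < W → (B + 2) ^ 20 < W :=
    fun h => (Nat.pow_le_pow_left (by omega) 20).trans_lt h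
  induction c with
  | skip => exact fun σ B hB _ => ⟨Exec.skip, hB.mono (by omega)⟩
  | assign x e =>
    intro σ B hB hW
    simp only [ok, Bool.and_eq_true, decide_eq_true_eq] at hc
    refine ⟨Exec.assign (Expr.fits hB (weak₀ hW) e hc.1.1 hc.2), ?_⟩
    refine (hB.mono (Nat.le_add_right _ _)).setVar ((Expr.eval_le_of_slow hB hc.1.2).trans ?_)
    -- An assignment takes at least two steps, which pays for a growth by two.
    have := e.one_le_cost
    simp only [time]
    omega
  | store a i e =>
    intro σ B hB hW
    simp only [ok, Bool.and_eq_true, decide_eq_true_eq] at hc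
    refine ⟨Exec.store (Expr.fits hB (weak₀ hW) i hc.1.1 hc.1.2)
      (Expr.fits hB (weak₀ hW) e hc.2.1.1 hc.2.2), ?_⟩
    refine (hB.mono (Nat.le_add_right _ _)).setArr ((Expr.eval_le_of_slow hB hc.2.1.2).trans ?_)
    have := e.one_le_cost
    simp only [time]
    omega
  | emit e =>
    intro σ B hB hW
    simp only [ok, Bool.and_eq_true, decide_eq_true_eq] at hc
    exact ⟨Exec.emit (Expr.fits hB (weak₀ hW) e hc.1 hc.2),
      hB.mono (Nat.le_add_right _ _)⟩
  | seq p q hp hq =>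
    intro σ B hB hW
    simp only [ok, Bool.and_eq_true] at hc
    simp only [time] at hW ⊢
    obtain ⟨e1, b1⟩ := hp hc.1 σ B hB (weak hW (Nat.le_add_right _ _))
    obtain ⟨e2, b2⟩ := hq hc.2 (p.eval σ) _ b1 (by rwa [add_assoc B])
    exact ⟨Exec.seq e1 e2, by rwa [← add_assoc]⟩
  | ite e p q hp hq =>
    intro σ B hB hW
    simp only [ok, Bool.and_eq_true, decide_eq_true_eq] at hc
    have he := Expr.fits hB (weak₀ hW) e hc.1.1 hc.1.2
    simp only [time, eval] at hW ⊢
    split_ifs at hW ⊢ with h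
    · obtain ⟨e1, b1⟩ := hp hc.2.1 σ B hB (weak hW (by omega))
      exact ⟨Exec.ite_true he h e1, b1.mono (by omega)⟩
    · obtain ⟨e1, b1⟩ := hq hc.2.2 σ B hB (weak hW (by omega))
      exact ⟨Exec.ite_false he (not_not.1 h) e1, b1.mono (by omega)⟩
  | loop x N p hp =>
    intro σ B hB hW
    simp only [ok, Bool.and_eq_true, decide_eq_true_eq, Bool.not_eq_true'] at hc
    obtain ⟨⟨⟨hxN, hpx⟩, hpN⟩, hpok⟩ := hc
    have hN : ∀ k, (iter p.eval x σ k).var N = σ.var N := fun k => by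
      refine (frame_iter (N := N) (frame p) σ k).var N ?_
      simp [writes, hxN, hpN]
    -- `T k` is the time spent before round `k`, including the 2 steps that clear the counter.
    set T : ℕ → ℕ := fun k => 2 + ∑ i ∈ Finset.range k, (p.time (iter p.eval x σ i) + 8) with hT
    have hTmono : ∀ k, T (k + 1) = T k + (p.time (iter p.eval x σ k) + 8) := fun k => by
      simp only [hT, Finset.sum_range_succ, add_assoc]
    have htime : (loop x N p).time σ = T (σ.var N) + 4 := by
      simp only [time, hT]
      omega
    have hTle : ∀ k ≤ σ.var N, T k ≤ T (σ.var N) := fun k hk => monotone_nat_of_le_succ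
      (fun k => by rw [hTmono]; omega) hk
    rw [htime] at hW ⊢
    have body : ∀ k < σ.var N, (iter p.eval x σ k).Bounded (B + T k) →
        Exec W p.compile (iter p.eval x σ k) (p.time (iter p.eval x σ k))
          (p.eval (iter p.eval x σ k)) ∧
        (p.eval (iter p.eval x σ k)).Bounded (B + T k + p.time (iter p.eval x σ k)) := by
      intro k hk hb
      refine hp hpok _ _ hb ?_
      rw [add_assoc B]
      refine weak hW ?_
      have := hTle (k + 1) hk
      rw [hTmono] at this
      omega
    have bdd : ∀ k ≤ σ.var N, (iter p.eval x σ k).Bounded (B + T k) := by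
      intro k
      induction k with
      | zero => exact fun _ => (hB.mono (by omega)).setVar (by omega)
      | succ k ih =>
        intro hk
        have hb := ih (by omega)
        have hk' : k ≤ B + T k := (iter_var_self p.eval x σ k).symm.trans_le (hb.1 x)
        exact ((body k hk hb).2.mono (by rw [hTmono]; omega)).setVar (by rw [hTmono]; omega)
    have run : ∀ d k, k + d = σ.var N → Exec W (.while (.op .lt (.var x) (.var N))
        (.seq p.compile (.assign x (.op .add (.var x) (.lit 1))))) (iter p.eval x σ k)
        (4 + ∑ i ∈ Finset.Ico k (σ.var N), (p.time (iter p.eval x σ i) + 8))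
        (iter p.eval x σ (σ.var N)) := by
      intro d
      induction d with
      | zero =>
        rintro k hk
        obtain rfl : k = σ.var N := by omega
        rw [Finset.Ico_self, Finset.sum_empty]
        refine Exec.while_false (Expr.fits (k := 20) (bdd _ le_rfl) (weak hW (by omega)) _ ?_ ?_) ?_
        · rfl
        · simp [Expr.cost]
        · simp [Expr.eval, Op.eval, hN, iter_var_self]
      | succ d ih =>
        intro k hk
        have hkN : k < σ.var N := by omega
        rw [Finset.sum_eq_sum_Ico_succ_bot hkN]
        have hle := hTle (k + 1) hkN
        rw [hTmono] at hle
        obtain ⟨e1, b1⟩ := body k hkN (bdd k hkN.le)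
        have e2 : Exec W (.assign x (.op .add (.var x) (.lit 1))) (p.eval (iter p.eval x σ k)) 4
            (iter p.eval x σ (k + 1)) := by
          have hx : (p.eval (iter p.eval x σ k)).var x = k := by
            rw [(frame p _).var x hpx, iter_var_self]
          have := Exec.assign (W := W) (x := x) (e := .op .add (.var x) (.lit 1))
            (σ := p.eval (iter p.eval x σ k)) (Expr.fits (k := 20) b1 (by
              rw [add_assoc B]
              exact weak hW (by omega)) _ rfl (by simp [Expr.cost]))
          simpa [iter, Expr.eval, Op.eval, hx, Expr.cost] using this
        have := Exec.while_true (W := W) (e := .op .lt (.var x) (.var N))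
          (Expr.fits (k := 20) (bdd k hkN.le) (weak hW (by omega)) _ rfl (by simp [Expr.cost])) (by
            simp [Expr.eval, Op.eval, hN, iter_var_self, hkN]) (Exec.seq e1 e2) (ih (k + 1) (by omega))
        refine cast ?_ this
        congr 1
        simp only [Expr.cost]
        omega
    refine ⟨?_, (bdd _ le_rfl).mono (by omega)⟩
    have e0 : Exec W (.assign x (.lit 0)) σ 2 (σ.setVar x 0) :=
      Exec.assign (Expr.fits (k := 20) hB (weak₀ hW) _ rfl (by simp [Expr.cost]))
    have := Exec.seq e0 (run (σ.var N) 0 (by omega))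
    refine cast ?_ this
    congr 1
    simp only [hT, Finset.range_eq_Ico]
    omega

end Cmd

infixr:60 " ;; " => Cmd.seq

/-- The entry in row `x` and column `y` of the matrix stored in the array `a`. -/
def Expr.mat (a : ℕ) (x y : Expr) : Expr := .get a (.op .add (.op .mul x (.var 0)) y)

/-- A loop whose round `k` stores `g k` at place `k` of the array `a`. -/
theorem Cmd.loop_store {x N a : ℕ} {p : Cmd} {σ : State} (g : ℕ → ℕ)
    (hs : ∀ k < σ.var N, ∀ τ, τ.var x = k → Frame (loop x N p) σ τ →
      (∀ j, k ≤ j → τ.arr a j = σ.arr a j) →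
      ∀ j, (p.eval τ).arr a j = if j = k then g k else τ.arr a j) (j : ℕ) :
    ((loop x N p).eval σ).arr a j = if j < σ.var N then g j else σ.arr a j := by
  refine loop_induct (I := fun k τ => ∀ j, τ.arr a j = if j < k then g j else σ.arr a j) ?_ ?_ j
  · intro j
    simp
  · intro k hk τ hx hf hI j
    have h := hs k hk τ hx hf (fun j hj => by rw [hI j, if_neg (by omega)]) j
    rw [State.setVar_arr, h, hI j]
    by_cases h1 : j = k
    · subst h1
      simp
    · by_cases h2 : j < k
      · rw [if_neg h1, if_pos h2, if_pos (by omega)]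
      · rw [if_neg h1, if_neg h2, if_neg (by omega)]

/-! ### Graph search -/

/-- Find a vertex that has been reached but not processed. -/
def findReached : Cmd :=
  .assign 6 (.var 0) ;;
  .loop 7 0 (.ite (.op .eq (.get 4 (.var 7)) (.lit 1)) (.assign 6 (.var 7)) .skip)

/-- Reach all unreached successors of the vertex in variable `6`. -/
def scanRow (a : ℕ) : Cmd :=
  .loop 8 0 (.ite (.get 4 (.var 8)) .skip
    (.ite (.mat a (.var 6) (.var 8))
      (.store 4 (.var 8) (.lit 1) ;; .store 5 (.var 8) (.var 6) ;;
        .store 6 (.var 8) (.op .add (.var 5) (.lit 1)))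
      .skip))

/-- One round of the search: process a vertex that has been reached. -/
def searchRound (a : ℕ) : Cmd :=
  findReached ;;
  .ite (.op .lt (.var 6) (.var 0)) (.store 4 (.var 6) (.lit 2) ;; scanRow a) .skip

/-- The avoided vertex counts as processed from the start, so it is never entered. With `n` in
variable `4` no vertex is avoided. -/
def searchInit : Cmd :=
  .loop 7 0 (.store 4 (.var 7) (.lit 0) ;; .store 5 (.var 7) (.var 7)) ;;
  .store 4 (.var 4) (.lit 2) ;;
  .store 4 (.var 3) (.lit 1) ;;
  .store 6 (.var 3) (.lit 0)

/-- Search from the vertex in variable `3` in the graph with the adjacency matrix in array `a`,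
without the vertex in variable `4`. Array `4` holds the states of the vertices (`0` not reached,
`1` reached, `2` processed), array `5` the parents, array `6` the times. -/
def search (a : ℕ) : Cmd := searchInit ;; .loop 5 0 (searchRound a)

section Search

variable {n : ℕ}

/-- The field `progress` bounds the number of rounds: as long as a vertex is waiting, every round so
far has processed one, so `n` rounds suffice. Vertices reached in round `k` get the time `k + 1`,
which exceeds all earlier times by `ord_le`. -/
structure SearchInv (A : Fin n → Fin n → Prop) (r : Fin n) (b k : ℕ) (st par ord : ℕ → ℕ) :
    Prop where
  st_le : ∀ y : Fin n, st y = 0 ∨ st y = 1 ∨ st y = 2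
  par_lt : ∀ y : Fin n, par y < n
  st_root : st r ≠ 0
  ord_root : ord r = 0
  reach : ∀ y : Fin n, (y : ℕ) ≠ b → st y ≠ 0 → ReachIn A {x | (x : ℕ) ≠ b} r y
  tree : ∀ y : Fin n, (y : ℕ) ≠ b → y ≠ r → st y ≠ 0 →
    ∃ x : Fin n, par y = x ∧ (x : ℕ) ≠ b ∧ st x = 2 ∧ A x y ∧ ord x < ord y
  ord_le : ∀ y : Fin n, (y : ℕ) ≠ b → st y ≠ 0 → ord y ≤ k
  closed : ∀ x y : Fin n, (x : ℕ) ≠ b → (y : ℕ) ≠ b → st x = 2 → A x y → st y ≠ 0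
  progress : (∀ y : Fin n, st y ≠ 1) ∨ k ≤ (Finset.univ.filter fun y : Fin n => st y = 2).card
  st_avoid : ∀ y : Fin n, (y : ℕ) = b → st y = 2

theorem SearchInv.step {A : Fin n → Fin n → Prop} {r : Fin n} {b k : ℕ} {st par ord : ℕ → ℕ}
    (h : SearchInv A r b k st par ord) {c : Fin n} (hc : st c = 1) {st' par' ord' : ℕ → ℕ}
    (h1 : ∀ y : Fin n, st y = 0 → A c y → st' y = 1 ∧ par' y = c ∧ ord' y = k + 1)
    (h2 : ∀ y : Fin n, ¬ (st y = 0 ∧ A c y) →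
      st' y = (if y = c then 2 else st y) ∧ par' y = par y ∧ ord' y = ord y) :
    SearchInv A r b (k + 1) st' par' ord' := by
  have hcb : (c : ℕ) ≠ b := fun e => by
    have := h.st_avoid c e
    omega
  have old : ∀ y : Fin n, st y ≠ 0 → par' y = par y ∧ ord' y = ord y ∧
      st' y = if y = c then 2 else st y := fun y hy =>
    ⟨(h2 y fun e => hy e.1).2.1, (h2 y fun e => hy e.1).2.2, (h2 y fun e => hy e.1).1⟩
  have ne0 : ∀ y : Fin n, st y ≠ 0 → st' y ≠ 0 := fun y hy => by
    rw [(old y hy).2.2]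
    split_ifs <;> simp [hy]
  have two : ∀ y : Fin n, st y = 2 → st' y = 2 := fun y hy => by
    rw [(old y (by omega)).2.2, hy, ite_self]
  have hc2 : st' c = 2 := by rw [(old c (by omega)).2.2, if_pos rfl]
  have two' : ∀ y : Fin n, st' y = 2 → st y = 2 ∨ y = c := fun y hy => by
    by_cases e : st y = 0 ∧ A c y
    · have := (h1 y e.1 e.2).1
      omega
    · rw [(h2 y e).1] at hy
      split_ifs at hy with hyc
      · exact Or.inr hyc
      · exact Or.inl hy
  have new : ∀ y : Fin n, st' y ≠ 0 → st y ≠ 0 ∨ (st y = 0 ∧ A c y) := fun y hy => by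
    by_cases e : st y = 0 ∧ A c y
    · exact Or.inr e
    · left
      intro hy0
      rw [(h2 y e).1] at hy
      split_ifs at hy with hyc
      · rw [hyc] at hy0
        omega
      · exact hy hy0
  constructor
  · intro y
    by_cases e : st y = 0 ∧ A c y
    · rw [(h1 y e.1 e.2).1]
      simp
    · rw [(h2 y e).1]
      split_ifs
      · simp
      · exact h.st_le y
  · intro y
    by_cases e : st y = 0 ∧ A c y
    · rw [(h1 y e.1 e.2).2.1]
      exact c.2
    · rw [(h2 y e).2.1]
      exact h.par_lt y
  · exact ne0 r h.st_root
  · rw [(old r h.st_root).2.1, h.ord_root]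
  · intro y hyb hy
    rcases new y hy with hy' | ⟨-, hA⟩
    · exact h.reach y hyb hy'
    · exact (h.reach c hcb (by omega)).trans (ReachIn.single hcb hyb hA)
  · intro y hyb hyr hy
    rcases new y hy with hy' | ⟨hy0, hA⟩
    · obtain ⟨x, e1, e2, e3, e4, e5⟩ := h.tree y hyb hyr hy'
      refine ⟨x, (old y hy').1.trans e1, e2, two x e3, e4, ?_⟩
      rw [(old x (by omega)).2.1, (old y hy').2.1]
      exact e5
    · obtain ⟨-, e2, e3⟩ := h1 y hy0 hA
      refine ⟨c, e2, hcb, hc2, hA, ?_⟩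
      rw [(old c (by omega)).2.1, e3]
      have := h.ord_le c hcb (by omega)
      omega
  · intro y hyb hy
    rcases new y hy with hy' | ⟨hy0, hA⟩
    · rw [(old y hy').2.1]
      exact (h.ord_le y hyb hy').trans (Nat.le_succ k)
    · rw [(h1 y hy0 hA).2.2]
  · intro x y hxb hyb hx hA
    rcases two' x hx with hx | rfl
    · exact ne0 y (h.closed x y hxb hyb hx hA)
    · by_cases e : st y = 0
      · rw [(h1 y e hA).1]
        simp
      · exact ne0 y e
  · right
    have hk : k ≤ (Finset.univ.filter fun y : Fin n => st y = 2).card :=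
      h.progress.resolve_left fun h => h c hc
    refine Nat.succ_le_of_lt (hk.trans_lt (Finset.card_lt_card ?_))
    refine ⟨fun y hy => ?_, fun hle => ?_⟩
    · simp only [Finset.mem_filter, Finset.mem_univ, true_and] at hy ⊢
      exact two y hy
    · have := @hle c (by simp [hc2])
      simp only [Finset.mem_filter, Finset.mem_univ, true_and] at this
      omega
  · exact fun y hy => two y (h.st_avoid y hy)

theorem SearchInv.weaken {A : Fin n → Fin n → Prop} {r : Fin n} {b k : ℕ} {st par ord : ℕ → ℕ}
    (h : SearchInv A r b k st par ord) (h1 : ∀ y : Fin n, st y ≠ 1) :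
    SearchInv A r b (k + 1) st par ord :=
  { h with
    ord_le := fun y hb hy => (h.ord_le y hb hy).trans (Nat.le_succ k)
    progress := Or.inl h1 }

theorem SearchInv.reach_iff {A : Fin n → Fin n → Prop} {r : Fin n} {b : ℕ} {st par ord : ℕ → ℕ}
    (h : SearchInv A r b n st par ord) (y : Fin n) (hy : (y : ℕ) ≠ b) :
    st y ≠ 0 ↔ ReachIn A {x | (x : ℕ) ≠ b} r y := by
  refine ⟨h.reach y hy, fun hr => ?_⟩
  -- After `n` rounds either nothing is waiting or all `n` vertices are processed.
  have no1 : ∀ y : Fin n, st y ≠ 1 := by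
    rcases h.progress with h1 | h1
    · exact h1
    · have : (Finset.univ.filter fun y : Fin n => st y = 2) = Finset.univ :=
        (Finset.card_eq_iff_eq_univ _).1 (le_antisymm (Finset.card_le_univ _) (by simpa using h1))
      intro y hy
      have := this ▸ Finset.mem_univ y
      simp only [Finset.mem_filter, Finset.mem_univ, true_and] at this
      omega
  refine hr.mem_closed (P := fun y : Fin n => st y ≠ 0) h.st_root fun x hx y hy hxy h0 => ?_
  rcases h.st_le x with e | e | e
  · exact absurd e h0
  · exact absurd e (no1 x)
  · exact h.closed x y hx hy e hxy

/-- The value `n` in variable `6` signals that no vertex is waiting. -/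
theorem findReached_spec (τ : State) :
    ((findReached.eval τ).var 6 = τ.var 0 ∧ ∀ y < τ.var 0, τ.arr 4 y ≠ 1) ∨
      (findReached.eval τ).var 6 < τ.var 0 ∧ τ.arr 4 ((findReached.eval τ).var 6) = 1 := by
  refine Cmd.loop_induct (σ := τ.setVar 6 (τ.var 0)) (N := 0)
    (I := fun k υ => (υ.var 6 = τ.var 0 ∧ ∀ y < k, τ.arr 4 y ≠ 1) ∨
      υ.var 6 < τ.var 0 ∧ τ.arr 4 (υ.var 6) = 1) ?_ ?_
  · left
    simp
  · intro k hk υ hx hf hI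
    have h4 : υ.arr 4 = τ.arr 4 := hf.arr 4 rfl
    have hk' : k < τ.var 0 := by simpa using hk
    by_cases e : τ.arr 4 k = 1
    · right
      simp [Cmd.eval, Expr.eval, Op.eval, h4, hx, e, hk']
    · simp only [Cmd.eval, Expr.eval, Op.eval, h4, hx, e]
      rcases hI with ⟨h1, h2⟩ | h1
      · left
        simp only [if_false, ne_eq, not_true, State.setVar_var, h1]
        refine ⟨rfl, fun y hy => ?_⟩
        rcases Nat.lt_succ_iff_lt_or_eq.1 hy with hy | rfl
        · exact h2 y hy
        · exact e
      · right
        simpa using h1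

theorem scanRow_spec {a : ℕ} (ha : a ≠ 4 ∧ a ≠ 5 ∧ a ≠ 6) (τ : State) (y : ℕ)
    (hy : y < τ.var 0) :
    (τ.arr 4 y = 0 ∧ τ.arr a (τ.var 6 * τ.var 0 + y) ≠ 0 →
      ((scanRow a).eval τ).arr 4 y = 1 ∧ ((scanRow a).eval τ).arr 5 y = τ.var 6 ∧
        ((scanRow a).eval τ).arr 6 y = τ.var 5 + 1) ∧
    (¬ (τ.arr 4 y = 0 ∧ τ.arr a (τ.var 6 * τ.var 0 + y) ≠ 0) →
      ((scanRow a).eval τ).arr 4 y = τ.arr 4 y ∧ ((scanRow a).eval τ).arr 5 y = τ.arr 5 y ∧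
        ((scanRow a).eval τ).arr 6 y = τ.arr 6 y) := by
  set P : ℕ → Prop := fun y => τ.arr 4 y = 0 ∧ τ.arr a (τ.var 6 * τ.var 0 + y) ≠ 0 with hP
  have key := Cmd.loop_induct (x := 8) (N := 0) (σ := τ) (p := .ite (.get 4 (.var 8)) .skip
    (.ite (.mat a (.var 6) (.var 8))
      (.store 4 (.var 8) (.lit 1) ;; .store 5 (.var 8) (.var 6) ;;
        .store 6 (.var 8) (.op .add (.var 5) (.lit 1)))
      .skip)) (I := fun k υ => υ.arr a = τ.arr a ∧ ∀ y,
        (y < k ∧ P y → υ.arr 4 y = 1 ∧ υ.arr 5 y = τ.var 6 ∧ υ.arr 6 y = τ.var 5 + 1) ∧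
        (¬ (y < k ∧ P y) → υ.arr 4 y = τ.arr 4 y ∧ υ.arr 5 y = τ.arr 5 y ∧
          υ.arr 6 y = τ.arr 6 y)) ?_ ?_
  · have := key.2 y
    simp only [hy, true_and] at this
    exact this
  · simp
  · intro k hk υ hx hf hI
    have h0 : υ.var 0 = τ.var 0 := hf.var 0 rfl
    have h6 : υ.var 6 = τ.var 6 := hf.var 6 rfl
    have h5 : υ.var 5 = τ.var 5 := hf.var 5 rfl
    obtain ⟨hIa, hI⟩ := hI
    have h4k : υ.arr 4 k = τ.arr 4 k := ((hI k).2 (by simp)).1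
    by_cases e : P k
    · have e1 : υ.arr 4 k = 0 := h4k.trans e.1
      have e2 := e.2
      simp only [Cmd.eval, Expr.eval, Op.eval, Expr.mat, hx, e1, h0, h6, hIa, ne_eq,
        not_true, if_false, e2, not_false_iff, if_true]
      refine ⟨?_, fun y => ?_⟩
      · rw [State.setVar_arr, State.setArr_arr_of_ne _ _ _ _ _ ha.2.2,
          State.setArr_arr_of_ne _ _ _ _ _ ha.2.1, State.setArr_arr_of_ne _ _ _ _ _ ha.1, hIa]
      · by_cases hyk : y = k
        · subst hyk
          simp [State.setArr_arr, h5, h6, hx, e]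
        · have : y < k + 1 ↔ y < k := by omega
          simpa [State.setArr_arr, hyk, this, hx] using hI y
    · have : (Cmd.ite (.get 4 (.var 8)) .skip
          (.ite (.mat a (.var 6) (.var 8))
            (.store 4 (.var 8) (.lit 1) ;; .store 5 (.var 8) (.var 6) ;;
              .store 6 (.var 8) (.op .add (.var 5) (.lit 1)))
            .skip)).eval υ = υ := by
        by_cases e1 : τ.arr 4 k = 0
        · have e2 : τ.arr a (τ.var 6 * τ.var 0 + k) = 0 := by
            by_contra e2
            exact e ⟨e1, e2⟩
          simp [Cmd.eval, Expr.eval, Op.eval, Expr.mat, hx, h4k, e1, e2, hIa, h0, h6]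
        · simp [Cmd.eval, Expr.eval, hx, h4k, e1]
      rw [this]
      refine ⟨hIa, fun y => ?_⟩
      have : y < k + 1 ∧ P y ↔ y < k ∧ P y := by
        constructor
        · rintro ⟨h1, h2⟩
          have : y ≠ k := fun e' => e (e' ▸ h2)
          exact ⟨by omega, h2⟩
        · rintro ⟨h1, h2⟩
          exact ⟨by omega, h2⟩
      rw [this]
      exact hI y

theorem searchRound_spec {a : ℕ} (ha : a ≠ 4 ∧ a ≠ 5 ∧ a ≠ 6) {A : Fin n → Fin n → Prop}
    {r : Fin n} {b k : ℕ} {τ : State} (h0 : τ.var 0 = n) (h5 : τ.var 5 = k)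
    (hA : ∀ x y : Fin n, τ.arr a (x * n + y) ≠ 0 ↔ A x y)
    (h : SearchInv A r b k (τ.arr 4) (τ.arr 5) (τ.arr 6)) :
    SearchInv A r b (k + 1) (((searchRound a).eval τ).arr 4) (((searchRound a).eval τ).arr 5)
      (((searchRound a).eval τ).arr 6) := by
  have fr := Cmd.frame findReached τ
  have fa : (findReached.eval τ).arr = τ.arr := funext fun a => fr.arr a rfl
  have f0 : (findReached.eval τ).var 0 = n := (fr.var 0 rfl).trans h0
  have f5 : (findReached.eval τ).var 5 = k := (fr.var 5 rfl).trans h5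
  rcases findReached_spec τ with ⟨h1, h2⟩ | ⟨h1, h2⟩
  · have : (searchRound a).eval τ = findReached.eval τ := by
      simp [searchRound, Cmd.eval, Expr.eval, Op.eval, h1, h0, f0]
    rw [this, fa]
    exact h.weaken fun y => h2 y (h0 ▸ y.2)
  · rw [h0] at h1
    obtain ⟨c, hc⟩ : ∃ c : Fin n, (findReached.eval τ).var 6 = c := ⟨⟨_, h1⟩, rfl⟩
    rw [hc] at h2
    set υ := (findReached.eval τ).setArr 4 c 2 with hυ
    have e : (searchRound a).eval τ = (scanRow a).eval υ := by
      simp [searchRound, Cmd.eval, Expr.eval, Op.eval, f0, hc, hυ]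
    have ua : υ.arr a = τ.arr a := by rw [hυ, State.setArr_arr_of_ne _ _ _ _ _ ha.1, fa]
    have u4 : ∀ y : Fin n, υ.arr 4 y = if y = c then 2 else τ.arr 4 y := fun y => by
      rw [hυ, State.setArr_arr, fa]
      simp [Fin.ext_iff]
    have u5 : υ.arr 5 = τ.arr 5 := by rw [hυ, State.setArr_arr_of_ne _ _ _ _ _ (by simp), fa]
    have u6 : υ.arr 6 = τ.arr 6 := by rw [hυ, State.setArr_arr_of_ne _ _ _ _ _ (by simp), fa]
    have v0 : υ.var 0 = n := f0
    have v5 : υ.var 5 = k := f5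
    have v6 : υ.var 6 = c := hc
    rw [e]
    refine h.step h2 (fun y hy hAy => ?_) (fun y hy => ?_)
    · have := (scanRow_spec ha υ y (v0.symm ▸ y.2)).1
      rw [ua, v0, v5, v6] at this
      refine this ⟨?_, (hA c y).2 hAy⟩
      rw [u4, if_neg (fun e => by rw [e] at hy; omega), hy]
    · have := (scanRow_spec ha υ y (v0.symm ▸ y.2)).2
      rw [ua, v0, v6, u4, u5, u6] at this
      refine this fun ⟨h3, h4⟩ => hy ⟨?_, (hA c y).1 h4⟩
      split_ifs at h3 with h5
      exact h3

theorem searchInit_spec {A : Fin n → Fin n → Prop} {r : Fin n} {b : ℕ} {σ : State}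
    (h0 : σ.var 0 = n) (h3 : σ.var 3 = r) (h4 : σ.var 4 = b) (hrb : (r : ℕ) ≠ b) :
    SearchInv A r b 0 ((searchInit.eval σ).arr 4) ((searchInit.eval σ).arr 5)
      ((searchInit.eval σ).arr 6) := by
  set p : Cmd := .store 4 (.var 7) (.lit 0) ;; .store 5 (.var 7) (.var 7) with hp
  set τ := (Cmd.loop 7 0 p).eval σ with hτ
  have l4 : ∀ j, τ.arr 4 j = if j < n then 0 else σ.arr 4 j := by
    rw [← h0]
    refine Cmd.loop_store (fun _ => 0) fun k hk υ hx _ _ j => ?_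
    simp [hp, Cmd.eval, Expr.eval, State.setArr_arr, hx]
  have l5 : ∀ j, τ.arr 5 j = if j < n then j else σ.arr 5 j := by
    rw [← h0]
    refine Cmd.loop_store (fun j => j) fun k hk υ hx _ _ j => ?_
    simp [hp, Cmd.eval, Expr.eval, State.setArr_arr, hx]
  have t3 : τ.var 3 = r := ((Cmd.frame _ σ).var 3 rfl).trans h3
  have t4 : τ.var 4 = b := ((Cmd.frame _ σ).var 4 rfl).trans h4
  have e : searchInit.eval σ = ((τ.setArr 4 b 2).setArr 4 r 1).setArr 6 r 0 := by
    simp [searchInit, Cmd.eval, Expr.eval, ← hp, ← t3, ← t4, hτ]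
  have s4 : ∀ y : Fin n, (searchInit.eval σ).arr 4 y =
      if y = r then 1 else if (y : ℕ) = b then 2 else 0 := fun y => by
    rw [e]
    simp [State.setArr_arr, l4, Fin.ext_iff]
  have s5 : ∀ y : Fin n, (searchInit.eval σ).arr 5 y = y := fun y => by
    rw [e]
    simp [State.setArr_arr, l5]
  have s6 : (searchInit.eval σ).arr 6 r = 0 := by
    rw [e]
    simp [State.setArr_arr]
  have only : ∀ y : Fin n, (y : ℕ) ≠ b → (searchInit.eval σ).arr 4 y ≠ 0 → y = r :=
    fun y hyb hy => by
      by_contra hyr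
      rw [s4, if_neg hyr, if_neg hyb] at hy
      exact hy rfl
  constructor
  · intro y
    rw [s4]
    split_ifs <;> simp
  · intro y
    rw [s5]
    exact y.2
  · simp [s4]
  · exact s6
  · intro y hyb hy
    rw [only y hyb hy]
    exact ReachIn.refl r
  · exact fun y hyb hyr hy => absurd (only y hyb hy) hyr
  · intro y hyb hy
    rw [only y hyb hy, s6]
  · intro x y hxb _ hx _
    have := only x hxb (by omega)
    rw [this, s4, if_pos rfl] at hx
    omega
  · exact Or.inr (Nat.zero_le _)
  · intro y hy
    rw [s4, if_neg (fun e => hrb (by rw [← e, hy])), if_pos hy]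

theorem search_inv {a : ℕ} (ha : a ≠ 4 ∧ a ≠ 5 ∧ a ≠ 6) {A : Fin n → Fin n → Prop}
    {r : Fin n} {b : ℕ} {σ : State} (h0 : σ.var 0 = n) (h3 : σ.var 3 = r) (h4 : σ.var 4 = b)
    (hrb : (r : ℕ) ≠ b) (hA : ∀ x y : Fin n, σ.arr a (x * n + y) ≠ 0 ↔ A x y) :
    SearchInv A r b n (((search a).eval σ).arr 4) (((search a).eval σ).arr 5)
      (((search a).eval σ).arr 6) := by
  have t0 : (searchInit.eval σ).var 0 = n := ((Cmd.frame _ σ).var 0 rfl).trans h0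
  have ta : (searchInit.eval σ).arr a = σ.arr a := (Cmd.frame searchInit σ).arr a (by
    simp [searchInit, Cmd.stores, ha.1.symm, ha.2.1.symm, ha.2.2.symm])
  have := Cmd.loop_induct (x := 5) (N := 0) (p := searchRound a) (σ := searchInit.eval σ)
    (I := fun k τ => SearchInv A r b k (τ.arr 4) (τ.arr 5) (τ.arr 6))
    (searchInit_spec h0 h3 h4 hrb) ?_
  · rwa [t0] at this
  · intro k _ τ hx hf hI
    refine searchRound_spec ha ((hf.var 0 rfl).trans t0) hx (fun x y => ?_) hI
    rw [hf.arr a (by simp [searchRound, findReached, scanRow, Cmd.stores, ha.1.symm, ha.2.1.symm,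
      ha.2.2.symm]), ta]
    exact hA x y

/-- What a search from `r` in the graph with edges `A` and without `b` finds. -/
theorem search_spec {a : ℕ} (ha : a ≠ 4 ∧ a ≠ 5 ∧ a ≠ 6) {A : Fin n → Fin n → Prop}
    {r : Fin n} {b : ℕ} {σ : State} (h0 : σ.var 0 = n) (h3 : σ.var 3 = r) (h4 : σ.var 4 = b)
    (hrb : (r : ℕ) ≠ b) (hA : ∀ x y : Fin n, σ.arr a (x * n + y) ≠ 0 ↔ A x y) :
    ∃ p : Fin n → Fin n, (∀ y : Fin n, ((search a).eval σ).arr 5 y = p y) ∧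
      ((search a).eval σ).arr 6 r = 0 ∧
      ∀ y : Fin n, (y : ℕ) ≠ b →
        (((search a).eval σ).arr 4 y ≠ 0 ↔ ReachIn A {x | (x : ℕ) ≠ b} r y) ∧
        (ReachIn A {x | (x : ℕ) ≠ b} r y → ((search a).eval σ).arr 6 y ≤ n ∧
          (y ≠ r → (p y : ℕ) ≠ b ∧ ReachIn A {x | (x : ℕ) ≠ b} r (p y) ∧ A (p y) y ∧
            ((search a).eval σ).arr 6 (p y) < ((search a).eval σ).arr 6 y)) := by
  have h := search_inv ha h0 h3 h4 hrb hA
  refine ⟨fun y => ⟨_, h.par_lt y⟩, fun _ => rfl, h.ord_root, fun y hy =>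
    ⟨h.reach_iff y hy, fun hr => ?_⟩⟩
  have hy0 := (h.reach_iff y hy).2 hr
  refine ⟨h.ord_le y hy hy0, fun hyr => ?_⟩
  obtain ⟨x, e1, e2, e3, e4, e5⟩ := h.tree y hy hyr hy0
  have : (⟨_, h.par_lt y⟩ : Fin n) = x := Fin.ext e1
  subst this
  exact ⟨e2, h.reach _ e2 (by rw [e3]; simp), e4, e5⟩

end Search

/-! ### Finding a minimal 2-vertex-connected spanning subgraph -/

/-- Store in row `x` and column `y` of the matrix in the array `a`. -/
def Cmd.storeMat (a : ℕ) (x y e : Expr) : Cmd := .store a (.op .add (.op .mul x (.var 0)) y) e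

section Input

variable {n : ℕ} {L : List (Fin n × Fin n)} {σ τ : State} {F : Finset (Fin n × Fin n)}

/-- The state contains the input graph. -/
structure HasInput (L : List (Fin n × Fin n)) (σ : State) : Prop where
  var_zero : σ.var 0 = n
  var_one : σ.var 1 = L.length
  var_two : σ.var 2 = n + n
  tail : ∀ (i : ℕ) (h : i < L.length), σ.arr 0 i = L[i].1
  head : ∀ (i : ℕ) (h : i < L.length), σ.arr 1 i = L[i].2

theorem HasInput.frame {c : Cmd} (h : HasInput L σ) (hf : Cmd.Frame c σ τ)
    (hc : (c.writes 0 || c.writes 1 || c.writes 2 || c.stores 0 || c.stores 1) = false) :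
    HasInput L τ := by
  simp only [Bool.or_eq_false_iff] at hc
  obtain ⟨⟨⟨⟨h0, h1⟩, h2⟩, h3⟩, h4⟩ := hc
  refine ⟨(hf.var 0 h0).trans h.var_zero, (hf.var 1 h1).trans h.var_one,
    (hf.var 2 h2).trans h.var_two, ?_, ?_⟩
  · rw [hf.arr 0 h3]
    exact h.tail
  · rw [hf.arr 1 h4]
    exact h.head

/-- Array `a` holds the adjacency matrix of the edge set `F`. -/
def IsMatrix (a : ℕ) (F : Finset (Fin n × Fin n)) (σ : State) : Prop :=
  ∀ x y : Fin n, σ.arr a (x * n + y) ≠ 0 ↔ (x, y) ∈ F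

theorem index_eq_iff (x y x' y' : Fin n) : (x : ℕ) * n + y = x' * n + y' ↔ x = x' ∧ y = y' := by
  refine ⟨fun h => ?_, by rintro ⟨rfl, rfl⟩; rfl⟩
  have hn : 0 < n := y.pos
  have hy : (y : ℕ) = y' := by
    have := congrArg (· % n) h
    simpa [Nat.mul_comm _ n, Nat.mod_eq_of_lt y.2, Nat.mod_eq_of_lt y'.2] using this
  rw [hy] at h
  exact ⟨Fin.ext (Nat.eq_of_mul_eq_mul_right hn (Nat.add_right_cancel h)), Fin.ext hy⟩

theorem setArr_index (σ : State) (a : ℕ) (x y x' y' : Fin n) (v : ℕ) :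
    (σ.setArr a (x' * n + y') v).arr a (x * n + y) =
      if (x, y) = (x', y') then v else σ.arr a (x * n + y) := by
  rw [State.setArr_arr]
  simp only [true_and, index_eq_iff, Prod.mk.injEq]

theorem IsMatrix.insert {a : ℕ} (h : IsMatrix a F σ) (u w : Fin n) :
    IsMatrix a (insert (u, w) F) (σ.setArr a (u * n + w) 1) := by
  intro x y
  rw [setArr_index, Finset.mem_insert]
  split_ifs with e
  · simp [e]
  · simp [e, h x y]

theorem IsMatrix.erase {a : ℕ} (h : IsMatrix a F σ) (u w : Fin n) :
    IsMatrix a (F.erase (u, w)) (σ.setArr a (u * n + w) 0) := by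
  intro x y
  rw [setArr_index, Finset.mem_erase]
  split_ifs with e
  · simp [e]
  · simp [e, h x y]

theorem IsMatrix.congr {a : ℕ} (h : IsMatrix a F σ) (e : τ.arr a = σ.arr a) : IsMatrix a F τ := by
  unfold IsMatrix
  rwa [e]

end Input

/-! #### The residual graph -/

def nextInit : Cmd := .loop 7 0 (.store 7 (.var 7) (.var 7))

/-- Follow the search path back from the vertex in variable `11` to the one in variable `10`,
and store the successors of the vertices on the path in array `7`. -/
def pathNext : Cmd :=
  .loop 16 0 (.ite (.op .eq (.var 12) (.var 10)) .skip
    (.store 7 (.get 5 (.var 12)) (.var 12) ;; .assign 12 (.get 5 (.var 12))))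

def shiftMatrix : Cmd :=
  .loop 7 0 (.loop 8 0 (.storeMat 3 (.var 7) (.var 8) (.mat 2 (.var 7) (.get 7 (.var 8)))))

def pathBack : Cmd :=
  .loop 16 0 (.ite (.op .eq (.var 12) (.var 10)) .skip
    (.storeMat 3 (.var 12) (.get 5 (.var 12)) (.lit 1) ;; .assign 12 (.get 5 (.var 12))))

/-- Store the residual graph of the search path in array `3`. -/
def residual : Cmd :=
  nextInit ;; .assign 12 (.var 11) ;; pathNext ;; shiftMatrix ;;
  .assign 12 (.var 11) ;; pathBack

section Residual

variable {n k : ℕ} {q : ℕ → Fin n} {σ : State}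

theorem pathNext_spec (h0 : σ.var 0 = n) (h10 : σ.var 10 = q 0) (h12 : σ.var 12 = q k)
    (h5 : ∀ j < k, σ.arr 5 (q (j + 1)) = q j) (hk : k ≤ n)
    (hinj : ∀ i ≤ k, ∀ j ≤ k, q i = q j → i = j) (h7 : ∀ y : Fin n, σ.arr 7 y = y) :
    (∀ j < k, (pathNext.eval σ).arr 7 (q j) = q (j + 1)) ∧
      ∀ y : Fin n, (∀ j < k, y ≠ q j) → (pathNext.eval σ).arr 7 y = y := by
  have key := Cmd.loop_induct (x := 16) (N := 0) (σ := σ)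
    (p := .ite (.op .eq (.var 12) (.var 10)) .skip
      (.store 7 (.get 5 (.var 12)) (.var 12) ;; .assign 12 (.get 5 (.var 12))))
    -- With truncated subtraction the position stays at `q 0` once it is there, so `n` rounds serve
    -- every path length `k ≤ n`.
    (I := fun i τ => τ.var 12 = q (k - i) ∧ (∀ j < k, k - i ≤ j → τ.arr 7 (q j) = q (j + 1)) ∧
      ∀ y : Fin n, (∀ j < k, k - i ≤ j → y ≠ q j) → τ.arr 7 y = y) ?_ ?_
  · rw [h0] at key
    obtain ⟨-, k1, k2⟩ := key
    exact ⟨fun j hj => k1 j hj (by omega), fun y hy => k2 y fun j hj _ => hy j hj⟩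
  · refine ⟨by simpa using h12, fun j hj hj' => by omega, fun y _ => by simpa using h7 y⟩
  · rintro i hi τ hx hf ⟨hI1, hI2, hI3⟩
    have t10 : τ.var 10 = q 0 := (hf.var 10 rfl).trans h10
    have t5 : τ.arr 5 = σ.arr 5 := hf.arr 5 rfl
    by_cases hki : k - i = 0
    · have e : k - (i + 1) = k - i := by omega
      rw [e]
      simp [Cmd.eval, Expr.eval, Op.eval, hI1, t10, hki]
      rw [hki] at hI2 hI3
      exact ⟨fun j hj => hI2 j hj (by omega), fun y hy => hI3 y fun j hj _ => hy j hj⟩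
    · obtain ⟨j, hj⟩ : ∃ j, k - i = j + 1 := ⟨k - i - 1, by omega⟩
      have hjk : j < k := by omega
      have e : k - (i + 1) = j := by omega
      have ne : ¬ (q (j + 1) : ℕ) = q 0 := fun e' => by
        have := hinj (j + 1) hjk 0 (by omega) (Fin.ext e')
        omega
      rw [hj] at hI1 hI2 hI3
      rw [e]
      simp only [Cmd.eval, Expr.eval, Op.eval, hI1, t10, ne, if_false, ne_eq, not_true,
        State.setArr_var, t5, h5 j hjk]
      have t5' : ∀ (i v : ℕ) , (τ.setArr 7 i v).arr 5 = σ.arr 5 := fun i v => by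
        rw [State.setArr_arr_of_ne _ _ _ _ _ (by simp), t5]
      refine ⟨by simp [t5', h5 j hjk], fun l hl hjl => ?_, fun y hy => ?_⟩
      · simp only [State.setVar_arr, State.setArr_arr, true_and]
        by_cases e' : l = j
        · simp [e']
        · rw [if_neg fun e'' => e' (hinj l hl.le j hjk.le (Fin.ext e''))]
          exact hI2 l hl (by omega)
      · simp only [State.setVar_arr, State.setArr_arr, true_and]
        rw [if_neg fun e'' => hy j hjk le_rfl (Fin.ext e'')]
        exact hI3 y fun l hl hjl => hy l hl (by omega)

theorem shiftMatrix_spec (h0 : σ.var 0 = n) {nxt : Fin n → Fin n}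
    (h7 : ∀ y : Fin n, σ.arr 7 y = nxt y) (x y : Fin n) :
    (shiftMatrix.eval σ).arr 3 (x * n + y) = σ.arr 2 (x * n + nxt y) := by
  set p : Cmd := .storeMat 3 (.var 7) (.var 8) (.mat 2 (.var 7) (.get 7 (.var 8))) with hp
  have inner : ∀ τ : State, τ.var 0 = n → τ.arr 2 = σ.arr 2 → τ.arr 7 = σ.arr 7 →
      ∀ x₀ : Fin n, τ.var 7 = x₀ → ∀ x y : Fin n,
        ((Cmd.loop 8 0 p).eval τ).arr 3 (x * n + y) =
          if x = x₀ then σ.arr 2 (x * n + nxt y) else τ.arr 3 (x * n + y) := by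
    intro τ t0 t2 t7 x₀ hx₀ x y
    have key := Cmd.loop_induct (x := 8) (N := 0) (σ := τ) (p := p)
      (I := fun i υ => ∀ x y : Fin n, υ.arr 3 (x * n + y) =
        if x = x₀ ∧ (y : ℕ) < i then σ.arr 2 (x * n + nxt y) else τ.arr 3 (x * n + y)) ?_ ?_
    · have := key x y
      rw [t0] at this
      simpa using this
    · simp
    · intro i hi υ hx hf hI x y
      rw [t0] at hi
      obtain ⟨y₀, rfl⟩ : ∃ y₀ : Fin n, i = y₀ := ⟨⟨i, hi⟩, rfl⟩
      have u0 : υ.var 0 = n := (hf.var 0 rfl).trans t0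
      have u7 : υ.var 7 = x₀ := (hf.var 7 rfl).trans hx₀
      have ua2 : υ.arr 2 = σ.arr 2 := (hf.arr 2 rfl).trans t2
      have ua7 : υ.arr 7 = σ.arr 7 := (hf.arr 7 rfl).trans t7
      simp only [hp, Cmd.storeMat, Cmd.eval, Expr.mat, Expr.eval, Op.eval, u0, u7, hx, ua2, ua7,
        State.setVar_arr, h7, setArr_index, hI, Prod.mk.injEq]
      by_cases e1 : x = x₀
      · by_cases e2 : y = y₀
        · simp [e1, e2]
        · have e2' : (y : ℕ) ≠ y₀ := fun e => e2 (Fin.ext e)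
          have : (y : ℕ) < y₀ + 1 ↔ (y : ℕ) < y₀ := by omega
          simp only [e1, e2, this, true_and, if_false]
      · simp [e1]
  have key := Cmd.loop_induct (x := 7) (N := 0) (σ := σ) (p := .loop 8 0 p)
    (I := fun i υ => ∀ x y : Fin n, (x : ℕ) < i → υ.arr 3 (x * n + y) =
      σ.arr 2 (x * n + nxt y)) ?_ ?_
  · exact key x y (by rw [h0]; exact x.2)
  · simp
  · intro i hi τ hx hf hI x y hxi
    rw [h0] at hi
    have := inner τ ((hf.var 0 rfl).trans h0) (hf.arr 2 rfl) (hf.arr 7 rfl) ⟨i, hi⟩ hx x y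
    rw [State.setVar_arr, this]
    by_cases e : x = ⟨i, hi⟩
    · rw [if_pos e]
    · rw [if_neg e]
      have : (x : ℕ) ≠ i := fun e' => e (Fin.ext e')
      exact hI x y (by omega)

theorem pathBack_spec (h0 : σ.var 0 = n) (h10 : σ.var 10 = q 0) (h12 : σ.var 12 = q k)
    (h5 : ∀ j < k, σ.arr 5 (q (j + 1)) = q j) (hk : k ≤ n)
    (hinj : ∀ i ≤ k, ∀ j ≤ k, q i = q j → i = j) (x y : Fin n) :
    (pathBack.eval σ).arr 3 (x * n + y) ≠ 0 ↔
      σ.arr 3 (x * n + y) ≠ 0 ∨ ∃ j < k, x = q (j + 1) ∧ y = q j := by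
  have key := Cmd.loop_induct (x := 16) (N := 0) (σ := σ)
    (p := .ite (.op .eq (.var 12) (.var 10)) .skip
      (.storeMat 3 (.var 12) (.get 5 (.var 12)) (.lit 1) ;; .assign 12 (.get 5 (.var 12))))
    (I := fun i τ => τ.var 12 = q (k - i) ∧ ∀ x y : Fin n, τ.arr 3 (x * n + y) ≠ 0 ↔
      σ.arr 3 (x * n + y) ≠ 0 ∨ ∃ j < k, k - i ≤ j ∧ x = q (j + 1) ∧ y = q j) ?_ ?_
  · rw [h0] at key
    have := key.2 x y
    have e : k - n = 0 := by omega
    rw [e] at this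
    simpa [pathBack] using this
  · refine ⟨by simpa using h12, fun x y => ?_⟩
    simp only [State.setVar_arr, iff_self_or, forall_exists_index, and_imp]
    intro j hj hj'
    omega
  · rintro i hi τ hx hf ⟨hI1, hI2⟩
    have t0 : τ.var 0 = n := (hf.var 0 rfl).trans h0
    have t10 : τ.var 10 = q 0 := (hf.var 10 rfl).trans h10
    have t5 : τ.arr 5 = σ.arr 5 := hf.arr 5 rfl
    by_cases hki : k - i = 0
    · have e : k - (i + 1) = k - i := by omega
      rw [e]
      have : (Cmd.ite (.op .eq (.var 12) (.var 10)) .skip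
          (.storeMat 3 (.var 12) (.get 5 (.var 12)) (.lit 1) ;;
            .assign 12 (.get 5 (.var 12)))).eval τ = τ := by
        simp [Cmd.eval, Expr.eval, Op.eval, hI1, t10, hki]
      rw [this]
      exact ⟨by simpa using hI1, hI2⟩
    · obtain ⟨j, hj⟩ : ∃ j, k - i = j + 1 := ⟨k - i - 1, by omega⟩
      have hjk : j < k := by omega
      have e : k - (i + 1) = j := by omega
      have ne : ¬ (q (j + 1) : ℕ) = q 0 := fun e' => by
        have := hinj (j + 1) hjk 0 (by omega) (Fin.ext e')
        omega
      rw [hj] at hI1 hI2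
      rw [e]
      simp only [Cmd.storeMat, Cmd.eval, Expr.eval, Op.eval, hI1, t10, ne, if_false, ne_eq,
        not_true, State.setArr_var, t5, h5 j hjk, t0]
      have t5' : ∀ (i v : ℕ) , (τ.setArr 3 i v).arr 5 = σ.arr 5 := fun i v => by
        rw [State.setArr_arr_of_ne _ _ _ _ _ (by simp), t5]
      refine ⟨by simp [t5', h5 j hjk], fun x y => ?_⟩
      simp only [State.setVar_arr, setArr_index, Prod.mk.injEq]
      by_cases e' : x = q (j + 1) ∧ y = q j
      · rw [if_pos e']
        simp only [one_ne_zero, not_false_iff, true_iff]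
        exact Or.inr ⟨j, hjk, le_rfl, e'⟩
      · rw [if_neg e', ← ne_eq, hI2]
        refine or_congr Iff.rfl ⟨?_, ?_⟩
        · rintro ⟨l, h1, h2, h3⟩
          exact ⟨l, h1, by omega, h3⟩
        · rintro ⟨l, h1, h2, h3⟩
          refine ⟨l, h1, ?_, h3⟩
          by_contra h4
          have : l = j := by omega
          exact e' (this ▸ h3)

theorem residual_spec (h0 : σ.var 0 = n) (h10 : σ.var 10 = q 0) (h11 : σ.var 11 = q k)
    (h5 : ∀ j < k, σ.arr 5 (q (j + 1)) = q j) (hk : k ≤ n)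
    (hinj : ∀ i ≤ k, ∀ j ≤ k, q i = q j → i = j) :
    ∃ nxt : Fin n → Fin n, (∀ j < k, nxt (q j) = q (j + 1)) ∧
      (∀ y, (∀ j < k, y ≠ q j) → nxt y = y) ∧
      ∀ x y : Fin n, (residual.eval σ).arr 3 (x * n + y) ≠ 0 ↔
        σ.arr 2 (x * n + nxt y) ≠ 0 ∨ ∃ j < k, x = q (j + 1) ∧ y = q j := by
  have l7 : ∀ y : Fin n, (nextInit.eval σ).arr 7 y = y := fun y => by
    have := Cmd.loop_store (x := 7) (N := 0) (a := 7) (p := .store 7 (.var 7) (.var 7)) (σ := σ)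
      (fun j => j) (fun k hk υ hx _ _ j => by simp [Cmd.eval, Expr.eval, State.setArr_arr, hx]) y
    rw [h0, if_pos y.2] at this
    exact this
  have f₁ := Cmd.frame nextInit σ
  set σ₁ := (nextInit.eval σ).setVar 12 (q k) with hσ₁
  have v11 : (nextInit.eval σ).var 11 = q k := (f₁.var 11 rfl).trans h11
  have f₂ := Cmd.frame pathNext σ₁
  have a5 : σ₁.arr 5 = σ.arr 5 := f₁.arr 5 rfl
  have v0 : σ₁.var 0 = n := (f₁.var 0 rfl).trans h0
  have v10 : σ₁.var 10 = q 0 := (f₁.var 10 rfl).trans h10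
  obtain ⟨n1, n2⟩ := pathNext_spec (k := k) (q := q) (σ := σ₁) v0 v10
    (by simp [hσ₁]) (by rw [a5]; exact h5) hk hinj l7
  set σ₂ := pathNext.eval σ₁ with hσ₂
  have lt : ∀ y : Fin n, σ₂.arr 7 y < n := fun y => by
    by_cases h : ∃ j < k, y = q j
    · obtain ⟨j, hj, rfl⟩ := h
      rw [n1 j hj]
      exact (q (j + 1)).2
    · push Not at h
      rw [n2 y h]
      exact y.2
  refine ⟨fun y => ⟨_, lt y⟩, fun j hj => Fin.ext (n1 j hj), fun y hy => Fin.ext (n2 y hy), ?_⟩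
  have w0 : σ₂.var 0 = n := (f₂.var 0 rfl).trans v0
  have m := shiftMatrix_spec w0 (nxt := fun y => ⟨_, lt y⟩) fun y => rfl
  have f₃ := Cmd.frame shiftMatrix σ₂
  set σ₃ := shiftMatrix.eval σ₂ with hσ₃
  have x11 : σ₃.var 11 = q k := (f₃.var 11 rfl).trans ((f₂.var 11 rfl).trans v11)
  have e : residual.eval σ = pathBack.eval (σ₃.setVar 12 (q k)) := by
    simp only [residual, Cmd.eval, Expr.eval]
    rw [v11, ← hσ₁, ← hσ₂, ← hσ₃, x11]
  intro x y
  have a2 : σ₂.arr 2 = σ.arr 2 := (f₂.arr 2 rfl).trans (f₁.arr 2 rfl)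
  rw [e, pathBack_spec (k := k) (q := q) (σ := σ₃.setVar 12 (q k)) ((f₃.var 0 rfl).trans w0)
    ((f₃.var 10 rfl).trans ((f₂.var 10 rfl).trans v10)) (by simp) ?_ hk hinj, State.setVar_arr,
    m, a2]
  rw [State.setVar_arr, f₃.arr 5 rfl, f₂.arr 5 rfl, a5]
  exact h5

/-- The path from `u` to `w` found by a search. -/
theorem exists_search_path {A : Fin n → Fin n → Prop} {S : Fin n → Prop} {u : Fin n}
    {p : Fin n → Fin n} {ord : Fin n → ℕ}
    (h : ∀ y, S y → y ≠ u → S (p y) ∧ A (p y) y ∧ ord (p y) < ord y) (w : Fin n) (hw : S w) :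
    ∃ (k : ℕ) (q : ℕ → Fin n), q 0 = u ∧ q k = w ∧ k ≤ ord w ∧ (∀ j < k, p (q (j + 1)) = q j) ∧
      (∀ j < k, A (q j) (q (j + 1))) ∧ ∀ i ≤ k, ∀ j ≤ k, i < j → ord (q i) < ord (q j) := by
  suffices H : ∀ m w, ord w < m → S w → ∃ (k : ℕ) (q : ℕ → Fin n), q 0 = u ∧ q k = w ∧
      k ≤ ord w ∧ (∀ j < k, p (q (j + 1)) = q j) ∧ (∀ j < k, A (q j) (q (j + 1))) ∧
      ∀ i ≤ k, ∀ j ≤ k, i < j → ord (q i) < ord (q j) from H _ w (Nat.lt_succ_self _) hw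
  intro m
  induction m with
  | zero => intro w hm; omega
  | succ m ih =>
    intro w hm hw
    by_cases hwu : w = u
    · exact ⟨0, fun _ => u, rfl, hwu.symm, Nat.zero_le _, by simp, by simp, by
        intro i hi j hj hij; omega⟩
    · obtain ⟨h1, h2, h3⟩ := h w hw hwu
      obtain ⟨k, q, q0, qk, hk, hp, hA, ho⟩ := ih (p w) (by omega) h1
      have low : ∀ j ≤ k, (if j ≤ k then q j else w) = q j := fun j hj => if_pos hj
      have top : (if k + 1 ≤ k then q (k + 1) else w) = w := if_neg (by omega)
      refine ⟨k + 1, fun j => if j ≤ k then q j else w, ?_, top, by omega, ?_, ?_, ?_⟩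
      · exact (low 0 (Nat.zero_le _)).trans q0
      · intro j hj
        dsimp only
        rw [low j (by omega)]
        by_cases e : j = k
        · rw [e, top, qk]
        · rw [low (j + 1) (by omega), hp j (by omega)]
      · intro j hj
        dsimp only
        rw [low j (by omega)]
        by_cases e : j = k
        · rw [e, top, qk]
          exact h2
        · rw [low (j + 1) (by omega)]
          exact hA j (by omega)
      · intro i hi j hj hij
        dsimp only
        rw [low i (by omega)]
        by_cases e : j = k + 1
        · rw [e, top]
          rcases Nat.lt_or_ge i k with hik | hik
          · have := ho i (by omega) k le_rfl hik
            rw [qk] at this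
            omega
          · have : i = k := by omega
            rw [this, qk]
            exact h3
        · rw [low j (by omega)]
          exact ho i (by omega) j (by omega) hij

end Residual

/-! #### The removal of edges -/

/-- Delete the edge with the number in variable `9` and prepare a search. -/
def deleteEdge : Cmd :=
  .assign 10 (.get 0 (.var 9)) ;; .assign 11 (.get 1 (.var 9)) ;;
  .assign 3 (.var 10) ;; .assign 4 (.var 0) ;; .storeMat 2 (.var 10) (.var 11) (.lit 0)

def restoreEdge : Cmd := .storeMat 2 (.var 10) (.var 11) (.lit 1)

/-- Restore the edge unless its head is reached in the residual graph. -/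
def testResidual : Cmd := residual ;; search 3 ;; .ite (.get 4 (.var 11)) .skip restoreEdge

/-- Remove the edge with the number in variable `9` if the graph remains 2-vertex-connected. -/
def removeStep : Cmd :=
  deleteEdge ;; search 2 ;; .ite (.get 4 (.var 11)) testResidual restoreEdge

/-- Store the adjacency matrix of the graph and find a minimal 2-vertex-connected subgraph. -/
def minimize : Cmd :=
  .loop 9 1 (.storeMat 2 (.get 0 (.var 9)) (.get 1 (.var 9)) (.lit 1)) ;; .loop 9 1 removeStep

section Minimize

variable {n : ℕ} {L : List (Fin n × Fin n)} {σ τ : State} {F : Finset (Fin n × Fin n)}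

open Classical in
-- The first search decides whether `w` is still reachable; its path defines the residual graph, in
-- which the second search decides whether some vertex separates `u` from `w`.
theorem removeStep_spec (hin : HasInput L σ) (hF : IsMatrix 2 F σ)
    (hT : TwoVertexConnected (graph F)) {i : ℕ} (hi : i < L.length) (h9 : σ.var 9 = i)
    (hiF : L[i] ∈ F) :
    IsMatrix 2 (if TwoVertexConnected (graph (F.erase L[i])) then F.erase L[i] else F)
      (removeStep.eval σ) := by
  obtain ⟨u, hu⟩ : ∃ u, u = L[i].1 := ⟨_, rfl⟩
  obtain ⟨w, hw⟩ : ∃ w, w = L[i].2 := ⟨_, rfl⟩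
  have huw : L[i] = (u, w) := by rw [hu, hw]
  rw [huw] at hiF ⊢
  set σ₁ := ((((σ.setVar 10 u).setVar 11 w).setVar 3 u).setVar 4 n).setArr 2 (u * n + w) 0
    with hσ₁
  have e₁ : deleteEdge.eval σ = σ₁ := by
    simp [deleteEdge, Cmd.eval_seq, Cmd.eval_assign, Cmd.storeMat, Cmd.eval_store, Expr.eval,
      Op.eval, h9, hin.tail i hi, hin.head i hi, hin.var_zero, ← hu, ← hw, hσ₁]
  have z₁ : σ₁.var 0 = n := by simp [hσ₁, hin.var_zero]
  have m₁ : IsMatrix 2 (F.erase (u, w)) σ₁ := IsMatrix.erase (F := F) (by exact hF) u w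
  have s₁ := search_spec (a := 2) (b := n) (by simp) (A := fun x y => (x, y) ∈ F.erase (u, w))
    (r := u) (σ := σ₁) z₁ (by simp [hσ₁]) (by simp [hσ₁]) u.2.ne m₁
  have f₂ := Cmd.frame (search 2) σ₁
  set σ₂ := (search 2).eval σ₁ with hσ₂
  have m₂ : IsMatrix 2 (F.erase (u, w)) σ₂ := m₁.congr (f₂.arr 2 rfl)
  have v0 : σ₂.var 0 = n := (f₂.var 0 rfl).trans z₁
  have v10 : σ₂.var 10 = u := (f₂.var 10 rfl).trans (by simp [hσ₁])
  have v11 : σ₂.var 11 = w := (f₂.var 11 rfl).trans (by simp [hσ₁])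
  have v3 : σ₂.var 3 = u := (f₂.var 3 rfl).trans (by simp [hσ₁])
  have v4 : σ₂.var 4 = n := (f₂.var 4 rfl).trans (by simp [hσ₁])
  have restore : ∀ {υ : State}, IsMatrix 2 (F.erase (u, w)) υ → υ.var 0 = n → υ.var 10 = u →
      υ.var 11 = w → IsMatrix 2 F (restoreEdge.eval υ) := by
    intro υ hm h0 h10 h11
    have := hm.insert u w
    rw [Finset.insert_erase hiF] at this
    simpa [restoreEdge, Cmd.storeMat, Cmd.eval_store, Expr.eval, Op.eval, h0, h10, h11] using this
  -- `deleteEdge` puts `n` into variable `4`, so these searches avoid no vertex.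
  have univ : {x : Fin n | (x : ℕ) ≠ n} = Set.univ := by
    ext x
    simp [x.2.ne]
  rw [univ] at s₁
  obtain ⟨p, hp, -, hs⟩ := s₁
  rw [twoVertexConnected_erase_iff hT, removeStep, Cmd.eval_seq, Cmd.eval_seq, e₁, ← hσ₂,
    Cmd.eval_ite, Expr.eval, Expr.eval, v11]
  by_cases hr : ReachIn (fun x y => (x, y) ∈ F.erase (u, w)) Set.univ u w
  · have h4 : σ₂.arr 4 w ≠ 0 := (hs w w.2.ne).1.2 hr
    obtain ⟨k, q, q0, qk, hk, hqp, hqA, hqo⟩ := exists_search_path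
      (A := fun x y => (x, y) ∈ F.erase (u, w))
      (S := fun y => ReachIn (fun x y => (x, y) ∈ F.erase (u, w)) Set.univ u y) (u := u) (p := p)
      (ord := fun y => σ₂.arr 6 y) (fun y hy hyu => ((hs y y.2.ne).2 hy).2 hyu |>.2) w hr
    have hinj : ∀ i ≤ k, ∀ j ≤ k, q i = q j → i = j := fun i hi j hj e => by
      rcases lt_trichotomy i j with h | h | h
      · have := hqo i hi j hj h
        rw [e] at this
        omega
      · exact h
      · have := hqo j hj i hi h
        rw [e] at this
        omega
    obtain ⟨nxt, n1, n2, n3⟩ := residual_spec (σ := σ₂) (k := k) (q := q) v0 (by rw [v10, q0])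
      (by rw [v11, qk]) (fun j hj => by rw [hp, hqp j hj])
      (hk.trans ((hs w w.2.ne).2 hr).1) hinj
    have f₃ := Cmd.frame residual σ₂
    set σ₃ := residual.eval σ₂ with hσ₃
    have s₃ := search_spec (a := 3) (b := n) (by simp)
      (A := fun x y => (x, nxt y) ∈ F.erase (u, w) ∨ ∃ j < k, x = q (j + 1) ∧ y = q j)
      (r := u) (σ := σ₃) ((f₃.var 0 rfl).trans v0) ((f₃.var 3 rfl).trans v3)
      ((f₃.var 4 rfl).trans v4) u.2.ne (fun x y => by rw [n3, m₂])
    rw [univ] at s₃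
    obtain ⟨_, _, _, hs₃⟩ := s₃
    have f₄ := Cmd.frame (search 3) σ₃
    set σ₄ := (search 3).eval σ₃ with hσ₄
    have m₄ : IsMatrix 2 (F.erase (u, w)) σ₄ :=
      m₂.congr ((f₄.arr 2 rfl).trans (f₃.arr 2 rfl))
    have w11 : σ₄.var 11 = w := (f₄.var 11 rfl).trans ((f₃.var 11 rfl).trans v11)
    have key := residual_reachIn_iff (R := fun x y => (x, y) ∈ F.erase (u, w)) hqA hinj n1 n2
      (R' := fun x y => (x, nxt y) ∈ F.erase (u, w) ∨ ∃ j < k, x = q (j + 1) ∧ y = q j)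
      fun x y => Iff.rfl
    rw [q0, qk] at key
    rw [if_pos h4, testResidual, Cmd.eval_seq, Cmd.eval_seq, ← hσ₃, ← hσ₄, Cmd.eval_ite,
      Expr.eval, Expr.eval, w11, Cmd.eval_skip]
    by_cases h : σ₄.arr 4 w ≠ 0
    · rw [if_pos h, if_pos ⟨hr, key.1 ((hs₃ w w.2.ne).1.1 h)⟩]
      exact m₄
    · rw [if_neg h, if_neg fun h' => h ((hs₃ w w.2.ne).1.2 (key.2 h'.2))]
      exact restore m₄ ((f₄.var 0 rfl).trans ((f₃.var 0 rfl).trans v0))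
        ((f₄.var 10 rfl).trans ((f₃.var 10 rfl).trans v10)) w11
  · have h4 : ¬ σ₂.arr 4 w ≠ 0 := fun h => hr ((hs w w.2.ne).1.1 h)
    rw [if_neg h4, if_neg fun h => hr h.1]
    exact restore m₂ v0 v10 v11

/-- The invariant says that the edges not yet examined are all present, and that those examined and
kept are indispensable. The latter persists under further deletions by monotonicity, so one pass
gives minimality. -/
theorem minimize_spec (hin : HasInput L σ) (h2 : ∀ i, σ.arr 2 i = 0)
    (hT : TwoVertexConnected (graph L.toFinset)) (hL : L.Nodup) :
    ∃ F, IsMinimalTwoVertexConnected L.toFinset F ∧ IsMatrix 2 F (minimize.eval σ) := by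
  set c₁ : Cmd := .loop 9 1 (.storeMat 2 (.get 0 (.var 9)) (.get 1 (.var 9)) (.lit 1)) with hc₁
  have m₁ : IsMatrix 2 L.toFinset (c₁.eval σ) := by
    have key := Cmd.loop_induct (x := 9) (N := 1) (σ := σ)
      (p := .storeMat 2 (.get 0 (.var 9)) (.get 1 (.var 9)) (.lit 1))
      (I := fun i τ => IsMatrix 2 (L.take i).toFinset τ) ?_ ?_
    · rw [hin.var_one, List.take_length] at key
      exact key
    · intro x y
      simp [h2]
    · intro i hi τ hx hf hI
      rw [hin.var_one] at hi
      have hin' := hin.frame hf rfl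
      have e : (L.take (i + 1)).toFinset = insert (L[i].1, L[i].2) (L.take i).toFinset := by
        ext x
        rw [List.take_succ_eq_append_getElem hi, List.mem_toFinset, List.mem_append,
          List.mem_singleton, Finset.mem_insert, List.mem_toFinset, or_comm]
      rw [e]
      have := hI.insert L[i].1 L[i].2
      refine IsMatrix.congr (σ := Cmd.eval (.storeMat 2 (.get 0 (.var 9)) (.get 1 (.var 9)) (.lit 1)) τ) ?_ (by rw [State.setVar_arr])
      simpa [Cmd.storeMat, Cmd.eval, Expr.eval, Op.eval, hx, hin'.tail i hi, hin'.head i hi,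
        hin'.var_zero] using this
  have hin₁ := hin.frame (Cmd.frame c₁ σ) rfl
  have key := Cmd.loop_induct (x := 9) (N := 1) (σ := c₁.eval σ) (p := removeStep)
    (I := fun i τ => ∃ F, IsMatrix 2 F τ ∧ F ⊆ L.toFinset ∧ TwoVertexConnected (graph F) ∧
      (∀ e ∈ L.drop i, e ∈ F) ∧
      ∀ e ∈ L.take i, e ∈ F → ¬ TwoVertexConnected (graph (F.erase e))) ?_ ?_
  · obtain ⟨F, h1, h3, h4, -, h5⟩ := key
    rw [hin₁.var_one, List.take_length] at h5
    exact ⟨F, isMinimalTwoVertexConnected_of_erase h3 h4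
      fun e he => h5 e (List.mem_toFinset.1 (h3 he)) he, h1⟩
  · exact ⟨L.toFinset, m₁, le_rfl, hT, by simp, by simp⟩
  · rintro i hi τ hx hf ⟨F, h1, h3, h4, h5, h6⟩
    rw [hin₁.var_one] at hi
    have hd : L.drop i = L[i] :: L.drop (i + 1) := List.drop_eq_getElem_cons hi
    -- As the list has no repetitions, a deleted edge is not among those still to be examined.
    have hnot : L[i] ∉ L.drop (i + 1) := by
      have := hL.sublist (List.drop_sublist i L)
      rw [hd] at this
      exact (List.nodup_cons.1 this).1
    have hiF : L[i] ∈ F := h5 _ (by rw [hd]; exact List.mem_cons_self)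
    have hst := removeStep_spec (hin₁.frame hf rfl) h1 h4 hi hx hiF
    refine ⟨_, hst, ?_⟩
    split_ifs with hR
    · refine ⟨(Finset.erase_subset _ _).trans h3, hR, fun e he => Finset.mem_erase.2
        ⟨fun e' => hnot (e' ▸ he), h5 e (by rw [hd]; exact List.mem_cons_of_mem _ he)⟩, fun e he heF hcon => ?_⟩
      rw [List.take_succ_eq_append_getElem hi, List.mem_append, List.mem_singleton] at he
      rcases he with he | rfl
      · refine h6 e he (Finset.mem_of_mem_erase heF) (hcon.mono ?_)
        exact Finset.erase_subset_erase e (Finset.erase_subset _ _)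
      · simp at heF
    · refine ⟨h3, h4, fun e he => h5 e (by rw [hd]; exact List.mem_cons_of_mem _ he), fun e he heF => ?_⟩
      rw [List.take_succ_eq_append_getElem hi, List.mem_append, List.mem_singleton] at he
      rcases he with he | rfl
      · exact h6 e he heF
      · exact hR

end Minimize

/-! ### Output of lists -/

/-- Output the number of entries of array `a` that are not zero. -/
def emitCount (a : ℕ) : Cmd :=
  .assign 18 (.lit 0) ;;
  .loop 19 0 (.ite (.get a (.var 19)) (.assign 18 (.op .add (.var 18) (.lit 1))) .skip) ;;
  .emit (.var 18)

def emitMembers (a : ℕ) : Cmd := .loop 19 0 (.ite (.get a (.var 19)) (.emit (.var 19)) .skip)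

/-- Output the list of the vertices whose entry in array `a` is not zero. -/
def emitSet (a : ℕ) : Cmd := emitCount a ;; emitMembers a

/-- The matrix entry for the edge with the number in variable `9`. -/
def edgeEntry : Expr := .mat 2 (.get 0 (.var 9)) (.get 1 (.var 9))

def countEdges : Cmd :=
  .loop 9 1 (.ite edgeEntry (.assign 18 (.op .add (.var 18) (.lit 1))) .skip)

def listEdges : Cmd :=
  .loop 9 1 (.ite edgeEntry (.emit (.get 0 (.var 9)) ;; .emit (.get 1 (.var 9))) .skip)

/-- Output the list of the edges of the current graph. -/
def emitEdges : Cmd := .assign 18 (.lit 0) ;; countEdges ;; .emit (.var 18) ;; listEdges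

section Emit

variable {n : ℕ} {L : List (Fin n × Fin n)} {σ τ : State} {F : Finset (Fin n × Fin n)}

/-- The vertices whose entry in array `a` is not zero. -/
def members (n a : ℕ) (σ : State) : List (Fin n) :=
  (List.finRange n).filter fun z => σ.arr a z ≠ 0

theorem take_finRange_succ {k : ℕ} (hk : k < n) :
    (List.finRange n).take (k + 1) = (List.finRange n).take k ++ [⟨k, hk⟩] := by
  rw [List.take_succ_eq_append_getElem (by simpa using hk)]
  simp

theorem take_finRange_self : (List.finRange n).take n = List.finRange n :=
  List.take_of_length_le (by simp)

theorem emitCount_out {a : ℕ} (h0 : σ.var 0 = n) :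
    ((emitCount a).eval σ).out = σ.out ++ [(members n a σ).length] := by
  have key := Cmd.loop_induct (x := 19) (N := 0) (σ := σ.setVar 18 0)
    (p := .ite (.get a (.var 19)) (.assign 18 (.op .add (.var 18) (.lit 1))) .skip)
    (I := fun k τ => τ.var 18 =
      (((List.finRange n).take k).filter fun z : Fin n => σ.arr a z ≠ 0).length) (by simp) ?_
  · have hf := Cmd.frame (Cmd.loop 19 0 (.ite (.get a (.var 19))
      (.assign 18 (.op .add (.var 18) (.lit 1))) .skip)) (σ.setVar 18 0)
    rw [emitCount, Cmd.eval_seq, Cmd.eval_seq, Cmd.eval_emit, Cmd.eval_assign]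
    simp only [Expr.eval, State.write_out]
    rw [hf.out rfl, key]
    simp [h0, members, take_finRange_self]
  · intro k hk τ hx hf hI
    have hk' : k < n := by simpa [h0] using hk
    have ha : τ.arr a = σ.arr a := hf.arr a rfl
    rw [take_finRange_succ hk', List.filter_append, List.length_append, ← hI]
    by_cases e : σ.arr a k = 0 <;> simp [Cmd.eval_ite, Cmd.eval_assign, Cmd.eval_skip, Expr.eval,
      Op.eval, hx, ha, e]

theorem emitMembers_out {a : ℕ} (h0 : σ.var 0 = n) :
    ((emitMembers a).eval σ).out = σ.out ++ (members n a σ).map Fin.val := by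
  have key := Cmd.loop_induct (x := 19) (N := 0) (σ := σ)
    (p := .ite (.get a (.var 19)) (.emit (.var 19)) .skip)
    (I := fun k τ => τ.out = σ.out ++
      (((List.finRange n).take k).filter fun z : Fin n => σ.arr a z ≠ 0).map Fin.val) (by simp) ?_
  · rw [emitMembers, key]
    simp [h0, members, take_finRange_self]
  · intro k hk τ hx hf hI
    have hk' : k < n := by simpa [h0] using hk
    have ha : τ.arr a = σ.arr a := hf.arr a rfl
    rw [take_finRange_succ hk', List.filter_append, List.map_append, ← List.append_assoc, ← hI]
    by_cases e : σ.arr a k = 0 <;> simp [Cmd.eval_ite, Cmd.eval_emit, Cmd.eval_skip, Expr.eval,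
      hx, ha, e]

theorem emitSet_out {a : ℕ} (h0 : σ.var 0 = n) :
    ((emitSet a).eval σ).out = σ.out ++ encodeVertices (members n a σ) := by
  have hf := Cmd.frame (emitCount a) σ
  rw [emitSet, Cmd.eval_seq, emitMembers_out ((hf.var 0 rfl).trans h0), emitCount_out h0]
  have : members n a ((emitCount a).eval σ) = members n a σ := by
    rw [members, hf.arr a rfl, members]
  simp [this, encodeVertices]

theorem edgeEntry_eval (hin : HasInput L σ) (hF : IsMatrix 2 F σ) {i : ℕ} (hi : i < L.length)
    (h9 : σ.var 9 = i) : edgeEntry.eval σ ≠ 0 ↔ L[i] ∈ F := by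
  simp only [edgeEntry, Expr.mat, Expr.eval, Op.eval, h9, hin.tail i hi, hin.head i hi,
    hin.var_zero]
  exact hF _ _

theorem emitEdges_out (hin : HasInput L σ) (hF : IsMatrix 2 F σ) :
    (emitEdges.eval σ).out = σ.out ++ encodeEdges (L.filter (· ∈ F)) := by
  have k₁ : (countEdges.eval (σ.setVar 18 0)).var 18 = (L.filter (· ∈ F)).length := by
    have key := Cmd.loop_induct (x := 9) (N := 1) (σ := σ.setVar 18 0)
      (p := .ite edgeEntry (.assign 18 (.op .add (.var 18) (.lit 1))) .skip)
      (I := fun k τ => τ.var 18 = ((L.take k).filter (· ∈ F)).length) (by simp) ?_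
    · rw [countEdges, key]
      simp [hin.var_one]
    · intro k hk τ hx hf hI
      have hk' : k < L.length := by simpa [hin.var_one] using hk
      have he := edgeEntry_eval ((hin.frame (c := .assign 18 (.lit 0))
        (Cmd.frame (.assign 18 (.lit 0)) σ) rfl).frame hf rfl)
        ((IsMatrix.congr hF (σ := σ) (a := 2) rfl).congr (hf.arr 2 rfl)) hk' hx
      rw [List.take_succ_eq_append_getElem hk', List.filter_append, List.length_append, ← hI,
        Cmd.eval_ite]
      by_cases e : L[k] ∈ F
      · rw [if_pos (he.2 e)]
        simp [Cmd.eval_assign, Expr.eval, Op.eval, e]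
      · rw [if_neg fun h => e (he.1 h)]
        simp [Cmd.eval_skip, e]
  have f₁ := Cmd.frame countEdges (σ.setVar 18 0)
  set σ₁ := countEdges.eval (σ.setVar 18 0) with hσ₁
  have hin₁ : HasInput L (σ₁.write (σ₁.var 18)) := by
    have := (hin.frame (Cmd.frame (.assign 18 (.lit 0)) σ) rfl).frame f₁ rfl
    exact this.frame (Cmd.frame (.emit (.var 18)) σ₁) rfl
  have hF₁ : IsMatrix 2 F (σ₁.write (σ₁.var 18)) := hF.congr (f₁.arr 2 rfl)
  have k₂ : (listEdges.eval (σ₁.write (σ₁.var 18))).out =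
      (σ₁.write (σ₁.var 18)).out ++ (L.filter (· ∈ F)).flatMap encodeEdge := by
    have key := Cmd.loop_induct (x := 9) (N := 1) (σ := σ₁.write (σ₁.var 18))
      (p := .ite edgeEntry (.emit (.get 0 (.var 9)) ;; .emit (.get 1 (.var 9))) .skip)
      (I := fun k τ => τ.out = (σ₁.write (σ₁.var 18)).out ++
        ((L.take k).filter (· ∈ F)).flatMap encodeEdge) (by simp) ?_
    · rw [listEdges, key, hin₁.var_one, List.take_length]
    · intro k hk τ hx hf hI
      have hk' : k < L.length := by rwa [hin₁.var_one] at hk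
      have hin' := hin₁.frame hf rfl
      have he := edgeEntry_eval hin' (hF₁.congr (hf.arr 2 rfl)) hk' hx
      rw [List.take_succ_eq_append_getElem hk', List.filter_append, List.flatMap_append,
        ← List.append_assoc, ← hI, Cmd.eval_ite]
      by_cases e : L[k] ∈ F
      · rw [if_pos (he.2 e)]
        simp [Cmd.eval_seq, Cmd.eval_emit, Expr.eval, e, hx, hin'.tail k hk', hin'.head k hk',
          encodeEdge]
      · rw [if_neg fun h => e (he.1 h)]
        simp [Cmd.eval_skip, e]
  rw [emitEdges, Cmd.eval_seq, Cmd.eval_seq, Cmd.eval_seq, Cmd.eval_assign, Cmd.eval_emit]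
  simp only [Expr.eval]
  rw [← hσ₁, k₂, State.write_out, k₁, f₁.out rfl]
  simp [encodeEdges]

end Emit

/-! ### Labels of tree edges -/

/-- One step on the tree path between the vertices in the variables `12` and `13`. -/
def climbMove : Cmd :=
  .ite (.op .lt (.get 6 (.var 13)) (.get 6 (.var 12)))
    (.assign 17 (.var 12) ;; .assign 12 (.get 5 (.var 12)))
    (.assign 17 (.var 13) ;; .assign 13 (.get 5 (.var 13)))

/-- Record the label of the tree edge in variable `17`. -/
def climbMark : Cmd :=
  .ite (.op .eq (.var 14) (.var 0)) .skip
    (.ite (.op .eq (.get 8 (.var 17)) (.var 14)) .skip (.assign 15 (.lit 1))) ;;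
  .assign 14 (.get 8 (.var 17)) ;; .store 9 (.var 14) (.lit 1)

def climbStep : Cmd := .ite (.op .eq (.var 12) (.var 13)) .skip (climbMove ;; climbMark)

/-- The value `n` in variable `14` is no label; it means that no tree edge has been seen yet. -/
def walkInit : Cmd :=
  .loop 7 0 (.store 9 (.var 7) (.lit 0)) ;; .assign 12 (.var 10) ;; .assign 13 (.var 11) ;;
  .assign 14 (.var 0) ;; .assign 15 (.lit 0)

/-- Mark in array `9` the labels on the tree path between the vertices in the variables `10` and
`11`. Variable `14` gets one of them, and variable `15` tells whether there are several. -/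
def walk : Cmd := walkInit ;; .loop 16 2 climbStep

/-- Replace all marked labels by the one in variable `14`. -/
def relabel : Cmd := .loop 7 0 (.ite (.get 9 (.get 8 (.var 7))) (.store 8 (.var 7) (.var 14)) .skip)

section Walk

variable {n : ℕ} {F F₁ : Finset (Fin n × Fin n)} {b r u w : Fin n} {p : Fin n → Fin n}
  {ord : Fin n → ℕ} {lab : Fin n → Fin n} {σ τ : State}

/-- The labelled spanning tree `p`, `ord`, `lab` is stored in the state. -/
structure HasTree (b r : Fin n) (p : Fin n → Fin n) (ord : Fin n → ℕ) (lab : Fin n → Fin n)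
    (σ : State) : Prop where
  var_zero : σ.var 0 = n
  var_two : σ.var 2 = n + n
  root : σ.var 3 = r
  avoid : σ.var 4 = b
  par : ∀ y : Fin n, σ.arr 5 y = p y
  ord : ∀ y : Fin n, σ.arr 6 y = ord y
  lab : ∀ y : Fin n, σ.arr 8 y = lab y

theorem HasTree.frame {c : Cmd} (h : HasTree b r p ord lab σ) (hf : Cmd.Frame c σ τ)
    (hc : (c.writes 0 || c.writes 2 || c.writes 3 || c.writes 4 || c.stores 5 || c.stores 6 ||
      c.stores 8) = false) : HasTree b r p ord lab τ := by
  simp only [Bool.or_eq_false_iff] at hc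
  obtain ⟨⟨⟨⟨⟨⟨h0, h2⟩, h3⟩, h4⟩, h5⟩, h6⟩, h8⟩ := hc
  refine ⟨(hf.var 0 h0).trans h.var_zero, (hf.var 2 h2).trans h.var_two,
    (hf.var 3 h3).trans h.root, (hf.var 4 h4).trans h.avoid, ?_, ?_, ?_⟩
  · rw [hf.arr 5 h5]
    exact h.par
  · rw [hf.arr 6 h6]
    exact h.ord
  · rw [hf.arr 8 h8]
    exact h.lab

/-- What `walk` knows after it has seen the tree edges in `l`. -/
structure Marks (lab : Fin n → Fin n) (l : List (Fin n)) (σ : State) : Prop where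
  mark : ∀ c : Fin n, σ.arr 9 c ≠ 0 ↔ ∃ z ∈ l, lab z = c
  sep : σ.var 15 = 0 ↔ Mono lab l
  last : (l = [] ∧ σ.var 14 = n) ∨ ∃ z ∈ l, σ.var 14 = lab z

theorem mono_append_iff {l : List (Fin n)} {z x : Fin n} (hx : x ∈ l) :
    Mono lab (l ++ [z]) ↔ Mono lab l ∧ lab z = lab x := by
  constructor
  · intro h
    exact ⟨fun a ha c hc => h a (by simp [ha]) c (by simp [hc]), h z (by simp) x (by simp [hx])⟩
  · rintro ⟨h1, h2⟩
    have : ∀ a ∈ l ++ [z], lab a = lab x := by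
      intro a ha
      rcases List.mem_append.1 ha with ha | ha
      · exact h1 a ha x hx
      · rw [List.mem_singleton.1 ha, h2]
    exact fun a ha c hc => (this a ha).trans (this c hc).symm

theorem climbMark_spec {l : List (Fin n)} {z : Fin n} (hm : Marks lab l σ) (h0 : σ.var 0 = n)
    (h17 : σ.var 17 = z) (h8 : ∀ y : Fin n, σ.arr 8 y = lab y) :
    Marks lab (l ++ [z]) (climbMark.eval σ) := by
  have mark : ∀ v15 : ℕ, ∀ c : Fin n, (((σ.setVar 15 v15).setVar 14 (lab z)).setArr 9 (lab z) 1).arr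
      9 c ≠ 0 ↔ ∃ x ∈ l ++ [z], lab x = c := by
    intro v c
    rw [State.setArr_arr]
    by_cases e : lab z = c
    · simp only [e, and_self, if_true, ne_eq, one_ne_zero, not_false_iff, true_iff]
      exact ⟨z, by simp, e⟩
    · have e' : ¬ (c : ℕ) = lab z := fun e' => e (Fin.ext e'.symm)
      simp only [true_and, e', if_false, State.setVar_arr, hm.mark c, List.mem_append,
        List.mem_singleton]
      constructor
      · rintro ⟨x, hx, hc⟩
        exact ⟨x, Or.inl hx, hc⟩
      · rintro ⟨x, hx | rfl, hc⟩
        · exact ⟨x, hx, hc⟩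
        · exact absurd hc e
  obtain ⟨v, hv, hsep⟩ : ∃ v, climbMark.eval σ =
      ((σ.setVar 15 v).setVar 14 (lab z)).setArr 9 (lab z) 1 ∧ (v = 0 ↔ Mono lab (l ++ [z])) := by
    have same : ∀ υ : State, υ = υ.setVar 15 (υ.var 15) := fun υ => by
      simp [State.setVar, Function.update_eq_self]
    rcases hm.last with ⟨hl, h14⟩ | ⟨x, hx, h14⟩
    · refine ⟨σ.var 15, ?_, ?_⟩
      · rw [← same]
        simp [climbMark, Cmd.eval_seq, Cmd.eval_ite, Cmd.eval_assign, Cmd.eval_store,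
          Cmd.eval_skip, Expr.eval, Op.eval, h14, h0, h17, h8]
      · rw [hm.sep, hl]
        simp [Mono]
    · have hne : ¬ (lab x : ℕ) = n := (lab x).2.ne
      by_cases e : lab z = lab x
      · refine ⟨σ.var 15, ?_, ?_⟩
        · rw [← same]
          simp [climbMark, Cmd.eval_seq, Cmd.eval_ite, Cmd.eval_assign, Cmd.eval_store,
            Cmd.eval_skip, Expr.eval, Op.eval, h14, h0, h17, h8, hne, e]
        · rw [hm.sep, mono_append_iff hx]
          simp [e]
      · have e' : ¬ (lab z : ℕ) = lab x := fun e' => e (Fin.ext e')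
        refine ⟨1, ?_, ?_⟩
        · simp [climbMark, Cmd.eval_seq, Cmd.eval_ite, Cmd.eval_assign, Cmd.eval_store,
            Expr.eval, Op.eval, h14, h0, h17, h8, hne, e']
        · rw [mono_append_iff hx]
          simp [e]
  rw [hv]
  refine ⟨mark v, ?_, Or.inr ⟨z, by simp, by simp⟩⟩
  simpa using hsep

theorem climbMove_spec (ht : HasTree b r p ord lab σ) (h12 : σ.var 12 = u) (h13 : σ.var 13 = w) :
    climbMove.eval σ = if ord w < ord u then (σ.setVar 17 u).setVar 12 (p u)
      else (σ.setVar 17 w).setVar 13 (p w) := by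
  rw [climbMove, Cmd.eval_ite]
  by_cases h : ord w < ord u <;>
  simp [Cmd.eval_seq, Cmd.eval_assign, Expr.eval, Op.eval, h12, h13, ht.ord, ht.par, h]

theorem Marks.congr {l : List (Fin n)} (h : Marks lab l σ) (h9 : τ.arr 9 = σ.arr 9)
    (h15 : τ.var 15 = σ.var 15) (h14 : τ.var 14 = σ.var 14) : Marks lab l τ := by
  refine ⟨?_, ?_, ?_⟩
  · rw [h9]
    exact h.mark
  · rw [h15]
    exact h.sep
  · rw [h14]
    exact h.last

/-- The invariant of the loop in `walk`. -/
def WalkInv (p : Fin n → Fin n) (ord : Fin n → ℕ) (lab : Fin n → Fin n) (b u w : Fin n) (k : ℕ)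
    (σ : State) : Prop :=
  ∃ (u' w' : Fin n) (l : List (Fin n)), σ.var 12 = u' ∧ σ.var 13 = w' ∧ u' ≠ b ∧ w' ≠ b ∧
    (u' = w' ∨ ord u' + ord w' + k ≤ n + n) ∧
    -- `Climb` is built from its innermost part, so the part already walked is described by what it
    -- adds to any continuation.
    (∀ l', Climb p ord u' w' l' → Climb p ord u w (l ++ l')) ∧ Marks lab l σ

theorem climbStep_spec (hT : IsTree F b r p ord) (ht : HasTree b r p ord lab σ) {k : ℕ}
    (h : WalkInv p ord lab b u w k σ) : WalkInv p ord lab b u w (k + 1) (climbStep.eval σ) := by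
  obtain ⟨u', w', l, h12, h13, hu, hw, hord, hl, hm⟩ := h
  by_cases e : u' = w'
  · have : climbStep.eval σ = σ := by
      simp [climbStep, Cmd.eval_ite, Cmd.eval_skip, Expr.eval, Op.eval, h12, h13, e]
    rw [this]
    exact ⟨u', w', l, h12, h13, hu, hw, Or.inl e, hl, hm⟩
  · have e' : ¬ (u' : ℕ) = w' := fun e' => e (Fin.ext e')
    have hs : climbStep.eval σ = climbMark.eval (climbMove.eval σ) := by
      simp [climbStep, Cmd.eval_ite, Cmd.eval_seq, Expr.eval, Op.eval, h12, h13, e']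
    have hord' := hord.resolve_left e
    rw [hs, climbMove_spec ht h12 h13]
    split_ifs with hlt
    · have hr := hT.ne_root_of_lt hlt
      have := hT.lt u' hu hr
      set υ := (σ.setVar 17 u').setVar 12 (p u') with hυ
      have hf := Cmd.frame climbMark υ
      refine ⟨p u', w', l ++ [u'], (hf.var 12 rfl).trans (by simp [hυ]),
        (hf.var 13 rfl).trans (by simp [hυ, h13]), hT.par_ne u' hu hr, hw, Or.inr (by omega),
        fun l' hl' => ?_, ?_⟩
      · rw [List.append_assoc]
        exact hl _ (Climb.left e hlt hl')
      · exact climbMark_spec (hm.congr (by simp [hυ]) (by simp [hυ]) (by simp [hυ]))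
          (by simp [hυ, ht.var_zero]) (by simp [hυ]) (by simpa [hυ] using ht.lab)
    · have hr := hT.ne_root_of_le hu e (not_lt.1 hlt)
      have := hT.lt w' hw hr
      set υ := (σ.setVar 17 w').setVar 13 (p w') with hυ
      have hf := Cmd.frame climbMark υ
      refine ⟨u', p w', l ++ [w'], (hf.var 12 rfl).trans (by simp [hυ, h12]),
        (hf.var 13 rfl).trans (by simp [hυ]), hu, hT.par_ne w' hw hr, Or.inr (by omega),
        fun l' hl' => ?_, ?_⟩
      · rw [List.append_assoc]
        exact hl _ (Climb.right e (not_lt.1 hlt) hl')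
      · exact climbMark_spec (hm.congr (by simp [hυ]) (by simp [hυ]) (by simp [hυ]))
          (by simp [hυ, ht.var_zero]) (by simp [hυ]) (by simpa [hυ] using ht.lab)

theorem walk_spec (hT : IsTree F b r p ord) (hord : ∀ y, y ≠ b → ord y ≤ n)
    (ht : HasTree b r p ord lab σ) (h10 : σ.var 10 = u) (h11 : σ.var 11 = w) (hu : u ≠ b)
    (hw : w ≠ b) : ∃ l, Climb p ord u w l ∧ Marks lab l (walk.eval σ) := by
  have l9 : ∀ j, ((Cmd.loop 7 0 (.store 9 (.var 7) (.lit 0))).eval σ).arr 9 j =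
      if j < n then 0 else σ.arr 9 j := by
    rw [← ht.var_zero]
    refine Cmd.loop_store (fun _ => 0) fun k hk υ hx _ _ j => ?_
    simp [Cmd.eval_store, Expr.eval, State.setArr_arr, hx]
  have fr := Cmd.frame (Cmd.loop 7 0 (.store 9 (.var 7) (.lit 0))) σ
  have ht₁ := ht.frame (Cmd.frame walkInit σ) rfl
  set υ := (Cmd.loop 7 0 (.store 9 (.var 7) (.lit 0))).eval σ with hυ
  have υ0 : υ.var 0 = n := (fr.var 0 rfl).trans ht.var_zero
  have υ10 : υ.var 10 = u := (fr.var 10 rfl).trans h10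
  have υ11 : υ.var 11 = w := (fr.var 11 rfl).trans h11
  have e : walkInit.eval σ = (((υ.setVar 12 u).setVar 13 w).setVar 14 n).setVar 15 0 := by
    rw [walkInit, Cmd.eval_seq, ← hυ]
    simp [Cmd.eval_seq, Cmd.eval_assign, Expr.eval, υ0, υ10, υ11]
  have key := Cmd.loop_induct (x := 16) (N := 2) (σ := walkInit.eval σ) (p := climbStep)
    (I := WalkInv p ord lab b u w) ?_ ?_
  · rw [ht₁.var_two] at key
    obtain ⟨u', w', l, h12, h13, hu', hw', ho, hl, hm⟩ := key
    have hm' : Marks lab l (walk.eval σ) := by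
      rw [walk, Cmd.eval_seq]
      exact hm
    -- Each step before the ends meet lowers the sum of their `ord`s, at most `n + n` at the start.
    -- After `n + n` rounds distinct ends would have sum `0`, but one of them is not the root and
    -- has positive `ord`.
    have : u' = w' := by
      rcases ho with ho | ho
      · exact ho
      · by_contra hne
        rcases Nat.lt_or_ge (ord w') (ord u') with hlt | hle
        · omega
        · have := hT.lt w' hw' (hT.ne_root_of_le hu' hne hle)
          omega
    subst this
    have := hl [] (Climb.nil u')
    rw [List.append_nil] at this
    exact ⟨l, this, hm'⟩
  · refine ⟨u, w, [], by simp [e], by simp [e], hu, hw, Or.inr ?_, fun l' hl' => hl', ?_⟩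
    · have := hord u hu
      have := hord w hw
      omega
    · refine ⟨fun c => ?_, ?_, Or.inl ⟨rfl, by simp [e]⟩⟩
      · simp [e, l9]
      · simp [e, Mono]
  · intro k hk τ hx hf hI
    obtain ⟨u', w', l, h12, h13, hrest⟩ := climbStep_spec hT (ht₁.frame hf rfl) hI
    refine ⟨u', w', l, by simpa using h12, by simpa using h13, ?_⟩
    obtain ⟨a1, a2, a3, a4, a5⟩ := hrest
    exact ⟨a1, a2, a3, a4, a5.congr rfl (by simp) (by simp)⟩

open Classical in
theorem relabel_spec (ht : HasTree b r p ord lab σ) {l : List (Fin n)} (hm : Marks lab l σ) :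
    ∃ lab' : Fin n → Fin n, HasTree b r p ord lab' (relabel.eval σ) ∧ ∃ c,
      (∀ y, (∃ z ∈ l, lab y = lab z) → lab' y = c) ∧
      (∀ y, (¬ ∃ z ∈ l, lab y = lab z) → lab' y = lab y) ∧ (l ≠ [] → ∃ z ∈ l, lab z = c) := by
  have hf := Cmd.frame relabel σ
  have l8 : ∀ y : Fin n, (relabel.eval σ).arr 8 y =
      if σ.arr 9 (lab y) ≠ 0 then σ.var 14 else lab y := by
    intro y
    have := Cmd.loop_store (x := 7) (N := 0) (a := 8) (σ := σ)
      (p := .ite (.get 9 (.get 8 (.var 7))) (.store 8 (.var 7) (.var 14)) .skip)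
      (fun j => if σ.arr 9 (σ.arr 8 j) ≠ 0 then σ.var 14 else σ.arr 8 j)
      (fun k hk υ hx hfr hj j => ?_) y
    · rw [ht.var_zero, if_pos y.2, ht.lab] at this
      exact this
    · have u9 : υ.arr 9 = σ.arr 9 := hfr.arr 9 rfl
      have u14 : υ.var 14 = σ.var 14 := hfr.var 14 rfl
      by_cases e : σ.arr 9 (σ.arr 8 k) = 0
      · by_cases e' : j = k
        · subst e'
          simp [Cmd.eval_ite, Cmd.eval_skip, Expr.eval, hx, hj j le_rfl, u9, e]
        · simp [Cmd.eval_ite, Cmd.eval_skip, Expr.eval, hx, hj k le_rfl, u9, e, e']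
      · simp [Cmd.eval_ite, Cmd.eval_store, Expr.eval, hx, hj k le_rfl, u9, u14, e,
          State.setArr_arr]
  have mk : ∀ lab' : Fin n → Fin n, (∀ y : Fin n, (relabel.eval σ).arr 8 y = lab' y) →
      HasTree b r p ord lab' (relabel.eval σ) := by
    intro lab' h
    refine ⟨(hf.var 0 rfl).trans ht.var_zero, (hf.var 2 rfl).trans ht.var_two,
      (hf.var 3 rfl).trans ht.root, (hf.var 4 rfl).trans ht.avoid, ?_, ?_, h⟩
    · rw [hf.arr 5 rfl]
      exact ht.par
    · rw [hf.arr 6 rfl]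
      exact ht.ord
  have iff : ∀ y, σ.arr 9 (lab y) ≠ 0 ↔ ∃ z ∈ l, lab y = lab z := fun y => by
    rw [hm.mark]
    simp only [eq_comm]
  rcases hm.last with ⟨hl, -⟩ | ⟨x, hx, h14⟩
  · subst hl
    have no : ∀ y, ¬ ∃ z ∈ ([] : List (Fin n)), lab y = lab z := by simp
    refine ⟨lab, mk lab fun y => ?_, r, fun y hy => absurd hy (no y), fun _ _ => rfl,
      fun h => absurd rfl h⟩
    rw [l8, if_neg fun h => no y ((iff y).1 h)]
  · refine ⟨fun y => if ∃ z ∈ l, lab y = lab z then lab x else lab y, mk _ fun y => ?_, lab x,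
      fun y hy => if_pos hy, fun y hy => if_neg hy, fun _ => ⟨x, hx, rfl⟩⟩
    rw [l8, h14]
    by_cases h : ∃ z ∈ l, lab y = lab z
    · rw [if_pos ((iff y).2 h), if_pos h]
    · rw [if_neg fun h' => h ((iff y).1 h'), if_neg h]

/-- The state contains a labelled spanning tree of the graph with the edges `F` and without `b`.
The labels describe its blocks as far as the edges in `F₁` are concerned. -/
structure HasBlocks (F F₁ : Finset (Fin n × Fin n)) (b r : Fin n) (p : Fin n → Fin n)
    (ord : Fin n → ℕ) (lab : Fin n → Fin n) (σ : State) : Prop where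
  has_tree : HasTree b r p ord lab σ
  tree : IsTree F b r p ord
  ord_le : ∀ y, y ≠ b → ord y ≤ n
  complete : LabelsComplete F₁ b p ord lab
  sound : LabelsSound F b r p lab

theorem HasBlocks.frame {c : Cmd} (h : HasBlocks F F₁ b r p ord lab σ) (hf : Cmd.Frame c σ τ)
    (hc : (c.writes 0 || c.writes 2 || c.writes 3 || c.writes 4 || c.stores 5 || c.stores 6 ||
      c.stores 8) = false) : HasBlocks F F₁ b r p ord lab τ :=
  { h with has_tree := h.has_tree.frame hf hc }

theorem HasBlocks.mono {F' : Finset (Fin n × Fin n)} (h : HasBlocks F F₁ b r p ord lab σ)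
    (hF : F ⊆ F') : HasBlocks F' F₁ b r p ord lab σ :=
  { h with tree := h.tree.mono hF, sound := h.sound.mono hF }

/-- Used both for the edges of the current graph and for an edge that the algorithm adds. In either
case merging labels is enough and the tree is kept. -/
theorem HasBlocks.relabel (h : HasBlocks F F₁ b r p ord lab σ) {l : List (Fin n)}
    (hc : Climb p ord u w l) (hm : Marks lab l σ) (hu : u ≠ b) (hw : w ≠ b) (huw : (u, w) ∈ F) :
    ∃ lab', HasBlocks F (insert (u, w) F₁) b r p ord lab' (relabel.eval σ) := by
  obtain ⟨lab', ht, c, h1, h2, h3⟩ := relabel_spec h.has_tree hm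
  refine ⟨lab', ht, h.tree, h.ord_le, fun x y hxy hx hy => ?_,
    h.sound.relabel h.tree hc hu hw huw h1 h2 h3⟩
  rcases Finset.mem_insert.1 hxy with e | hxy
  · cases e
    exact ⟨l, hc, mono_relabel_self h1⟩
  · obtain ⟨l', hl', hm'⟩ := h.complete x y hxy hx hy
    exact ⟨l', hl', hm'.relabel h1 h2⟩

end Walk

/-! ### Blocks of the current graph -/

/-- Load the edge with the number in variable `9` into the variables `10` and `11`. -/
def loadEdge : Cmd := .assign 10 (.get 0 (.var 9)) ;; .assign 11 (.get 1 (.var 9))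

/-- Execute `p` if the edge in the variables `10` and `11` avoids the vertex in variable `4`. -/
def ifAvoids (p : Cmd) : Cmd :=
  .ite (.op .eq (.var 10) (.var 4)) .skip (.ite (.op .eq (.var 11) (.var 4)) .skip p)

def initLabels : Cmd := .loop 7 0 (.store 8 (.var 7) (.var 7))

/-- The truth value of the comparison serves as the root: it is `1` if vertex `0` is avoided and `0`
otherwise. -/
def setTree : Cmd := .assign 3 (.op .eq (.var 4) (.lit 0)) ;; search 2 ;; initLabels

def mergeStep : Cmd := .ite edgeEntry (loadEdge ;; ifAvoids (walk ;; relabel)) .skip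

/-- Compute a labelled spanning tree of the graph without the vertex in variable `4`. -/
def blocks : Cmd := setTree ;; .loop 9 1 mergeStep

section Blocks

variable {n : ℕ} {L : List (Fin n × Fin n)} {F F₁ : Finset (Fin n × Fin n)} {b r u w : Fin n}
  {p : Fin n → Fin n} {ord : Fin n → ℕ} {lab : Fin n → Fin n} {σ τ : State}

theorem loadEdge_eval (hin : HasInput L σ) {i : ℕ} (hi : i < L.length) (h9 : σ.var 9 = i) :
    loadEdge.eval σ = (σ.setVar 10 L[i].1).setVar 11 L[i].2 := by
  simp [loadEdge, Cmd.eval_seq, Cmd.eval_assign, Expr.eval, h9, hin.tail i hi, hin.head i hi]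

theorem ifAvoids_eval {q : Cmd} (h4 : σ.var 4 = b) (h10 : σ.var 10 = u) (h11 : σ.var 11 = w) :
    (ifAvoids q).eval σ = if u ≠ b ∧ w ≠ b then q.eval σ else σ := by
  rw [ifAvoids, Cmd.eval_ite, Cmd.eval_ite, Cmd.eval_skip]
  by_cases h1 : u = b <;> by_cases h2 : w = b <;>
    simp [Expr.eval, Op.eval, h4, h10, h11, h1, h2, Fin.val_inj]

theorem setTree_spec (h0 : σ.var 0 = n) (h2 : σ.var 2 = n + n) (h4 : σ.var 4 = b)
    (hF : IsMatrix 2 F σ) (hn : 2 ≤ n)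
    (hr : ∀ u w, u ≠ b → w ≠ b → ReachIn (fun x y => (x, y) ∈ F) {b}ᶜ u w) :
    ∃ r p ord lab, HasBlocks F ∅ b r p ord lab (setTree.eval σ) := by
  obtain ⟨r, hr3, hrb⟩ : ∃ r : Fin n, (if (b : ℕ) = 0 then 1 else 0) = (r : ℕ) ∧ r ≠ b := by
    by_cases e : (b : ℕ) = 0
    · exact ⟨⟨1, hn⟩, by simp [e], fun h => by rw [← h] at e; simp at e⟩
    · exact ⟨⟨0, by omega⟩, by simp [e], fun h => by rw [← h] at e; simp at e⟩
  set σ₁ := σ.setVar 3 r with hσ₁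
  have e₁ : setTree.eval σ = initLabels.eval ((search 2).eval σ₁) := by
    rw [setTree, Cmd.eval_seq, Cmd.eval_seq, Cmd.eval_assign]
    simp only [Expr.eval, Op.eval, h4, hr3, hσ₁]
  have hset : {x : Fin n | (x : ℕ) ≠ b} = {b}ᶜ := by
    ext x
    simp [Fin.val_inj]
  have s := search_spec (a := 2) (b := b) (by simp) (A := fun x y => (x, y) ∈ F) (r := r)
    (σ := σ₁) (by simp [hσ₁, h0]) (by simp [hσ₁]) (by simp [hσ₁, h4])
    (fun e => hrb (Fin.ext e)) hF
  rw [hset] at s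
  have f₁ := Cmd.frame (search 2) σ₁
  set σ₂ := (search 2).eval σ₁ with hσ₂
  have f₂ := Cmd.frame initLabels σ₂
  obtain ⟨p, hp, hroot, hs⟩ := s
  have v0 : σ₂.var 0 = n := (f₁.var 0 rfl).trans (by simp [hσ₁, h0])
  have l8 : ∀ j, (initLabels.eval σ₂).arr 8 j = if j < n then j else σ₂.arr 8 j := by
    rw [← v0]
    refine Cmd.loop_store (fun j => j) fun k hk υ hx _ _ j => ?_
    simp [Cmd.eval_store, Expr.eval, State.setArr_arr, hx]
  have key : ∀ y : Fin n, y ≠ b → _ := fun y hy => (hs y fun e => hy (Fin.ext e)).2 (hr r y hrb hy)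
  have tree : IsTree F b r p (fun y => σ₂.arr 6 y) :=
    ⟨hrb, hroot, fun y hy hyr e => ((key y hy).2 hyr).1 (by rw [e]),
      fun y hy hyr => ((key y hy).2 hyr).2.2.1, fun y hy hyr => ((key y hy).2 hyr).2.2.2⟩
  refine ⟨r, p, fun y => σ₂.arr 6 y, id, ?_, tree, fun y hy => (key y hy).1, ?_, ?_⟩
  · rw [e₁]
    refine ⟨(f₂.var 0 rfl).trans v0, (f₂.var 2 rfl).trans ((f₁.var 2 rfl).trans
      (by simp [hσ₁, h2])), (f₂.var 3 rfl).trans ((f₁.var 3 rfl).trans (by simp [hσ₁])),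
      (f₂.var 4 rfl).trans ((f₁.var 4 rfl).trans (by simp [hσ₁, h4])), ?_, ?_, fun y => ?_⟩
    · rw [f₂.arr 5 rfl]
      exact hp
    · rw [f₂.arr 6 rfl]
      exact fun _ => rfl
    · rw [l8, if_pos y.2, id]
  · intro u w huw
    simp at huw
  · exact LabelsSound.of_injective tree Function.injective_id

theorem mergeStep_spec {i : ℕ} (hin : HasInput L σ) (hF : IsMatrix 2 F σ) (hi : i < L.length)
    (h9 : σ.var 9 = i) (h : HasBlocks F (F.filter (· ∈ L.take i)) b r p ord lab σ) :
    ∃ lab', HasBlocks F (F.filter (· ∈ L.take (i + 1))) b r p ord lab' (mergeStep.eval σ) := by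
  have he := edgeEntry_eval hin hF hi h9
  have cases : ∀ x y, (x, y) ∈ F.filter (· ∈ L.take (i + 1)) →
      (x, y) ∈ F.filter (· ∈ L.take i) ∨ (x, y) = L[i] ∧ L[i] ∈ F := by
    intro x y hxy
    rw [Finset.mem_filter, List.take_succ_eq_append_getElem hi, List.mem_append,
      List.mem_singleton] at hxy
    rcases hxy with ⟨h1, h2 | h2⟩
    · exact Or.inl (Finset.mem_filter.2 ⟨h1, h2⟩)
    · exact Or.inr ⟨h2, h2 ▸ h1⟩
  rw [mergeStep, Cmd.eval_ite]
  by_cases hiF : L[i] ∈ F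
  · rw [if_pos (he.2 hiF), Cmd.eval_seq, loadEdge_eval hin hi h9]
    set υ := (σ.setVar 10 L[i].1).setVar 11 L[i].2 with hυ
    have hυb : HasBlocks F (F.filter (· ∈ L.take i)) b r p ord lab υ := by
      have := h.frame (Cmd.frame loadEdge σ) rfl
      rwa [loadEdge_eval hin hi h9] at this
    have u10 : υ.var 10 = L[i].1 := by simp [hυ]
    have u11 : υ.var 11 = L[i].2 := by simp [hυ]
    rw [ifAvoids_eval hυb.has_tree.avoid u10 u11]
    by_cases hav : L[i].1 ≠ b ∧ L[i].2 ≠ b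
    · rw [if_pos hav, Cmd.eval_seq]
      obtain ⟨l, hl, hm⟩ := walk_spec hυb.tree hυb.ord_le hυb.has_tree u10 u11 hav.1 hav.2
      obtain ⟨lab', h'⟩ := (hυb.frame (Cmd.frame walk υ) rfl).relabel hl hm hav.1 hav.2 hiF
      refine ⟨lab', { h' with complete := fun x y hxy hx hy => h'.complete x y ?_ hx hy }⟩
      rcases cases x y hxy with h1 | ⟨h1, -⟩
      · exact Finset.mem_insert_of_mem h1
      · rw [h1]
        exact Finset.mem_insert_self _ _
    · rw [if_neg hav]
      refine ⟨lab, { hυb with complete := fun x y hxy hx hy => ?_ }⟩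
      rcases cases x y hxy with h1 | ⟨h1, -⟩
      · exact hυb.complete x y h1 hx hy
      · rw [← h1] at hav
        exact absurd ⟨hx, hy⟩ hav
  · rw [if_neg fun h => hiF (he.1 h), Cmd.eval_skip]
    refine ⟨lab, { h with complete := fun x y hxy hx hy => ?_ }⟩
    rcases cases x y hxy with h1 | ⟨-, h1⟩
    · exact h.complete x y h1 hx hy
    · exact absurd h1 hiF

theorem blocks_spec (hin : HasInput L σ) (hF : IsMatrix 2 F σ) (hFL : F ⊆ L.toFinset)
    (h4 : σ.var 4 = b) (hn : 2 ≤ n)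
    (hr : ∀ u w, u ≠ b → w ≠ b → ReachIn (fun x y => (x, y) ∈ F) {b}ᶜ u w) :
    ∃ r p ord lab, HasBlocks F F b r p ord lab (blocks.eval σ) := by
  obtain ⟨r, p, ord, lab, h⟩ := setTree_spec hin.var_zero hin.var_two h4 hF hn hr
  have hf := Cmd.frame setTree σ
  have hin₁ := hin.frame hf rfl
  have key := Cmd.loop_induct (x := 9) (N := 1) (σ := setTree.eval σ) (p := mergeStep)
    (I := fun i τ => ∃ lab, HasBlocks F (F.filter (· ∈ L.take i)) b r p ord lab τ) ?_ ?_
  · obtain ⟨lab', h'⟩ := key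
    rw [hin₁.var_one, List.take_length, Finset.filter_true_of_mem
      fun e he => List.mem_toFinset.1 (hFL he)] at h'
    refine ⟨r, p, ord, lab', ?_⟩
    rw [blocks, Cmd.eval_seq]
    exact h'
  · refine ⟨lab, ?_⟩
    have h' := h.frame (Cmd.frame (.assign 9 (.lit 0)) (setTree.eval σ)) rfl
    rw [Cmd.eval_assign] at h'
    simpa [Expr.eval] using h'
  · rintro i hi τ hx hf' ⟨lab', h'⟩
    obtain ⟨lab'', h''⟩ := mergeStep_spec (hin₁.frame hf' rfl)
      ((hF.congr (hf.arr 2 rfl)).congr (hf'.arr 2 rfl)) (by rwa [hin₁.var_one] at hi) hx h'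
    refine ⟨lab'', { h'' with has_tree := ?_ }⟩
    have := h''.has_tree
    exact ⟨by simpa using this.var_zero, by simpa using this.var_two, by simpa using this.root,
      by simpa using this.avoid, this.par, this.ord, this.lab⟩

/-- Testing whether two vertices share a component thus costs one walk, in time linear in `n`. -/
theorem HasBlocks.sep_iff (h : HasBlocks F F b r p ord lab σ) {l : List (Fin n)}
    (hc : Climb p ord u w l) (hu : u ≠ b) (hw : w ≠ b) (hm : Marks lab l τ) :
    τ.var 15 = 0 ↔ Same F b u w :=
  hm.sep.trans ⟨h.sound.same h.tree hc hu hw, h.complete.mono_of_same h.tree hc hu hw⟩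

end Blocks

/-! ### The list of the strongly biconnected components -/

def clearFlags : Cmd := .loop 7 0 (.store 11 (.var 7) (.lit 0))

/-- Tree edges are named by their lower ends, so the root and the avoided vertex name none and are
skipped. -/
def setFlags : Cmd :=
  .loop 7 0 (.ite (.op .eq (.var 7) (.var 3)) .skip (.ite (.op .eq (.var 7) (.var 4)) .skip
    (.store 11 (.get 8 (.var 7)) (.lit 1))))

def clearMembers : Cmd := .loop 7 0 (.store 12 (.var 7) (.lit 0))

def setMembers : Cmd :=
  .loop 7 0 (.ite (.op .eq (.var 7) (.var 3)) .skip (.ite (.op .eq (.var 7) (.var 4)) .skip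
    (.ite (.op .eq (.get 8 (.var 7)) (.var 20))
      (.store 12 (.var 7) (.lit 1) ;; .store 12 (.get 5 (.var 7)) (.lit 1)) .skip)))

/-- Output the component with the label in variable `20`. -/
def emitComponent : Cmd := clearMembers ;; setMembers ;; emitSet 12

/-- Output the list of the strongly biconnected components. -/
def emitComponents : Cmd :=
  clearFlags ;; setFlags ;; emitCount 11 ;;
  .loop 20 0 (.ite (.get 11 (.var 20)) emitComponent .skip)

section Components

variable {n : ℕ} {F : Finset (Fin n × Fin n)} {b r : Fin n} {p : Fin n → Fin n}
  {ord : Fin n → ℕ} {lab : Fin n → Fin n} {σ τ : State}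

open Classical in
/-- The labels of the tree edges. -/
noncomputable def labels (b r : Fin n) (lab : Fin n → Fin n) : List (Fin n) :=
  (List.finRange n).filter fun c => ∃ y, y ≠ b ∧ y ≠ r ∧ lab y = c

open Classical in
noncomputable def component (b r : Fin n) (p lab : Fin n → Fin n) (c : Fin n) : List (Fin n) :=
  (List.finRange n).filter (· ∈ labelSet b r p lab c)

theorem listsSBComponents (h : HasBlocks F F b r p ord lab σ) (hV : ∃ x, x ≠ b ∧ x ≠ r)
    (hF : ∀ u w, u ≠ b → w ≠ b → ReachIn (fun x y => (x, y) ∈ F) {b}ᶜ u w) :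
    ListsSBComponents (graph F) b ((labels b r lab).map (component b r p lab)) := by
  have coe : ∀ c, ((component b r p lab c).toFinset : Set (Fin n)) = labelSet b r p lab c := by
    intro c
    ext x
    simp [component]
  have mem : ∀ c, c ∈ labels b r lab ↔ ∃ y, y ≠ b ∧ y ≠ r ∧ lab y = c := by
    intro c
    simp [labels]
  refine ⟨?_, ?_, fun S => ?_⟩
  · intro c hc
    obtain ⟨c, -, rfl⟩ := List.mem_map.1 hc
    exact (List.nodup_finRange n).filter _
  · rw [List.map_map]
    refine List.Nodup.map_on ?_ ((List.nodup_finRange n).filter _)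
    intro c hc c' hc' e
    obtain ⟨y, hyb, hyr, rfl⟩ := (mem c).1 hc
    obtain ⟨y', hyb', hyr', rfl⟩ := (mem c').1 hc'
    refine label_eq_of_labelSet_eq h.tree h.complete h.sound hyb hyr hyb' hyr' ?_
    rw [← coe, ← coe]
    exact congrArg _ e
  · rw [isSBComponent_iff h.tree h.complete h.sound hV hF, List.map_map, List.mem_map]
    constructor
    · rintro ⟨c, hc, rfl⟩
      obtain ⟨y, hyb, hyr, rfl⟩ := (mem c).1 hc
      exact ⟨y, hyb, hyr, coe _⟩
    · rintro ⟨y, hyb, hyr, hS⟩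
      refine ⟨lab y, (mem _).2 ⟨y, hyb, hyr, rfl⟩, ?_⟩
      rw [← Finset.coe_inj, hS]
      exact coe _

theorem flags_spec (ht : HasTree b r p ord lab σ) (c : Fin n) :
    (setFlags.eval (clearFlags.eval σ)).arr 11 c ≠ 0 ↔ ∃ y, y ≠ b ∧ y ≠ r ∧ lab y = c := by
  have l11 : ∀ j, (clearFlags.eval σ).arr 11 j = if j < n then 0 else σ.arr 11 j := by
    rw [← ht.var_zero]
    refine Cmd.loop_store (fun _ => 0) fun k hk υ hx _ _ j => ?_
    simp [Cmd.eval_store, Expr.eval, State.setArr_arr, hx]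
  have ht₁ := ht.frame (Cmd.frame clearFlags σ) rfl
  have key := Cmd.loop_induct (x := 7) (N := 0) (σ := clearFlags.eval σ)
    (p := .ite (.op .eq (.var 7) (.var 3)) .skip (.ite (.op .eq (.var 7) (.var 4)) .skip
      (.store 11 (.get 8 (.var 7)) (.lit 1))))
    (I := fun k τ => ∀ c : Fin n, τ.arr 11 c ≠ 0 ↔
      ∃ y : Fin n, (y : ℕ) < k ∧ y ≠ b ∧ y ≠ r ∧ lab y = c) ?_ ?_
  · rw [ht₁.var_zero] at key
    simpa [setFlags] using key c
  · intro c
    simp [l11]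
  · intro k hk τ hx hf hI c
    rw [ht₁.var_zero] at hk
    obtain ⟨y₀, rfl⟩ : ∃ y₀ : Fin n, k = y₀ := ⟨⟨k, hk⟩, rfl⟩
    have ht' : τ.arr 8 = (clearFlags.eval σ).arr 8 ∧ τ.var 3 = r ∧ τ.var 4 = b :=
      ⟨hf.arr 8 rfl, (hf.var 3 rfl).trans ht₁.root, (hf.var 4 rfl).trans ht₁.avoid⟩
    have split : (∃ y : Fin n, (y : ℕ) < y₀ + 1 ∧ y ≠ b ∧ y ≠ r ∧ lab y = c) ↔
        (∃ y : Fin n, (y : ℕ) < y₀ ∧ y ≠ b ∧ y ≠ r ∧ lab y = c) ∨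
          (y₀ ≠ b ∧ y₀ ≠ r ∧ lab y₀ = c) := by
      simp only [Nat.lt_succ_iff_lt_or_eq, or_and_right, exists_or, Fin.val_inj, exists_eq_left]
    rw [split, ← hI c]
    by_cases e1 : y₀ = r
    · simp [Cmd.eval_ite, Cmd.eval_skip, Expr.eval, Op.eval, hx, ht', e1]
    · by_cases e2 : y₀ = b
      · simp [Cmd.eval_ite, Cmd.eval_skip, Expr.eval, Op.eval, hx, ht', e2]
      · have e1' : ¬ (y₀ : ℕ) = r := fun e => e1 (Fin.ext e)
        have e2' : ¬ (y₀ : ℕ) = b := fun e => e2 (Fin.ext e)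
        by_cases e3 : lab y₀ = c
        · simp [Cmd.eval_ite, Cmd.eval_store, Expr.eval, Op.eval, hx, ht', e1', e2',
            ht₁.lab, State.setArr_arr, e1, e2, e3]
        · have e3' : ¬ (c : ℕ) = lab y₀ := fun e => e3 (Fin.ext e.symm)
          simp [Cmd.eval_ite, Cmd.eval_store, Expr.eval, Op.eval, hx, ht', e1', e2',
            ht₁.lab, State.setArr_arr, e3, e3']

theorem members_spec (ht : HasTree b r p ord lab σ) {c₀ : Fin n} (h20 : σ.var 20 = c₀)
    (x : Fin n) :
    (setMembers.eval (clearMembers.eval σ)).arr 12 x ≠ 0 ↔ x ∈ labelSet b r p lab c₀ := by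
  have l12 : ∀ j, (clearMembers.eval σ).arr 12 j = if j < n then 0 else σ.arr 12 j := by
    rw [← ht.var_zero]
    refine Cmd.loop_store (fun _ => 0) fun k hk υ hx _ _ j => ?_
    simp [Cmd.eval_store, Expr.eval, State.setArr_arr, hx]
  have ht₁ := ht.frame (Cmd.frame clearMembers σ) rfl
  have v20 : (clearMembers.eval σ).var 20 = c₀ := ((Cmd.frame _ σ).var 20 rfl).trans h20
  have key := Cmd.loop_induct (x := 7) (N := 0) (σ := clearMembers.eval σ)
    (p := .ite (.op .eq (.var 7) (.var 3)) .skip (.ite (.op .eq (.var 7) (.var 4)) .skip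
      (.ite (.op .eq (.get 8 (.var 7)) (.var 20))
        (.store 12 (.var 7) (.lit 1) ;; .store 12 (.get 5 (.var 7)) (.lit 1)) .skip)))
    (I := fun k τ => ∀ x : Fin n, τ.arr 12 x ≠ 0 ↔
      ∃ y : Fin n, (y : ℕ) < k ∧ y ≠ b ∧ y ≠ r ∧ lab y = c₀ ∧ (x = y ∨ x = p y)) ?_ ?_
  · rw [ht₁.var_zero] at key
    simpa [setMembers, labelSet] using key x
  · intro c
    simp [l12]
  · intro k hk τ hx hf hI x
    rw [ht₁.var_zero] at hk
    obtain ⟨y₀, rfl⟩ : ∃ y₀ : Fin n, k = y₀ := ⟨⟨k, hk⟩, rfl⟩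
    have ht' : τ.arr 8 = (clearMembers.eval σ).arr 8 ∧ τ.arr 5 = (clearMembers.eval σ).arr 5 ∧
        τ.var 3 = r ∧ τ.var 4 = b ∧ τ.var 20 = c₀ :=
      ⟨hf.arr 8 rfl, hf.arr 5 rfl, (hf.var 3 rfl).trans ht₁.root,
        (hf.var 4 rfl).trans ht₁.avoid, (hf.var 20 rfl).trans v20⟩
    have split : (∃ y : Fin n, (y : ℕ) < y₀ + 1 ∧ y ≠ b ∧ y ≠ r ∧ lab y = c₀ ∧
          (x = y ∨ x = p y)) ↔
        (∃ y : Fin n, (y : ℕ) < y₀ ∧ y ≠ b ∧ y ≠ r ∧ lab y = c₀ ∧ (x = y ∨ x = p y)) ∨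
          (y₀ ≠ b ∧ y₀ ≠ r ∧ lab y₀ = c₀ ∧ (x = y₀ ∨ x = p y₀)) := by
      simp only [Nat.lt_succ_iff_lt_or_eq, or_and_right, exists_or, Fin.val_inj, exists_eq_left]
    rw [split, ← hI x]
    by_cases e1 : y₀ = r
    · simp [Cmd.eval_ite, Cmd.eval_skip, Expr.eval, Op.eval, hx, ht', e1]
    · by_cases e2 : y₀ = b
      · simp [Cmd.eval_ite, Cmd.eval_skip, Expr.eval, Op.eval, hx, ht', e2]
      · have e1' : ¬ (y₀ : ℕ) = r := fun e => e1 (Fin.ext e)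
        have e2' : ¬ (y₀ : ℕ) = b := fun e => e2 (Fin.ext e)
        by_cases e3 : lab y₀ = c₀
        · simp only [Cmd.eval_ite, Cmd.eval_store, Cmd.eval_seq, Expr.eval, Op.eval, hx, ht', e1',
            e2', ht₁.lab, e3, if_true, if_false, ne_eq, not_true, one_ne_zero, not_false_iff,
            State.setArr_var, ht₁.par, State.setVar_arr, State.setArr_arr, true_and, e1, e2,
            Fin.val_inj]
          by_cases e4 : x = p y₀
          · simp [e4]
          · by_cases e5 : x = y₀
            · simp [e5]
            · simp [e4, e5, Fin.val_inj]
        · have e3' : ¬ (lab y₀ : ℕ) = c₀ := fun e => e3 (Fin.ext e)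
          simp [Cmd.eval_ite, Cmd.eval_skip, Expr.eval, Op.eval, hx, ht', e1', e2',
            ht₁.lab, e3, e3']

theorem emitComponent_out (ht : HasTree b r p ord lab σ) {c : Fin n} (h20 : σ.var 20 = c) :
    (emitComponent.eval σ).out = σ.out ++ encodeVertices (component b r p lab c) := by
  have f₁ := Cmd.frame clearMembers σ
  have f₂ := Cmd.frame setMembers (clearMembers.eval σ)
  have ht₂ := (ht.frame f₁ rfl).frame f₂ rfl
  rw [emitComponent, Cmd.eval_seq, Cmd.eval_seq, emitSet_out ht₂.var_zero, f₂.out rfl, f₁.out rfl]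
  have : members n 12 (setMembers.eval (clearMembers.eval σ)) = component b r p lab c := by
    refine List.filter_congr fun x _ => ?_
    exact decide_eq_decide.2 (members_spec ht h20 x)
  rw [this]

theorem emitComponents_out (ht : HasTree b r p ord lab σ) :
    (emitComponents.eval σ).out =
      σ.out ++ SB.encodeComponents ((labels b r lab).map (component b r p lab)) := by
  have f₁ := Cmd.frame clearFlags σ
  have f₂ := Cmd.frame setFlags (clearFlags.eval σ)
  have fl := flags_spec ht
  have ht₂ := (ht.frame f₁ rfl).frame f₂ rfl
  have o₂ : (setFlags.eval (clearFlags.eval σ)).out = σ.out := (f₂.out rfl).trans (f₁.out rfl)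
  set σ₂ := setFlags.eval (clearFlags.eval σ) with hσ₂
  have f₃ := Cmd.frame (emitCount 11) σ₂
  have ht₃ := ht₂.frame f₃ rfl
  have hm : members n 11 σ₂ = labels b r lab := by
    refine List.filter_congr fun x _ => ?_
    exact decide_eq_decide.2 (fl x)
  have o₃ : ((emitCount 11).eval σ₂).out = σ.out ++ [(labels b r lab).length] := by
    rw [emitCount_out ht₂.var_zero, hm, o₂]
  set σ₃ := (emitCount 11).eval σ₂ with hσ₃
  have key := Cmd.loop_induct (x := 20) (N := 0) (σ := σ₃)
    (p := .ite (.get 11 (.var 20)) emitComponent .skip)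
    (I := fun k τ => τ.out = σ₃.out ++ (((List.finRange n).take k).filter
      fun z : Fin n => σ₂.arr 11 z ≠ 0).flatMap fun c => encodeVertices (component b r p lab c))
    (by simp) ?_
  · rw [ht₃.var_zero, take_finRange_self] at key
    rw [emitComponents, Cmd.eval_seq, Cmd.eval_seq, Cmd.eval_seq, ← hσ₂, ← hσ₃, key, o₃]
    change _ ++ List.flatMap _ (members n 11 σ₂) = _
    rw [hm]
    simp [SB.encodeComponents, List.flatMap_map]
  · intro k hk τ hx hf hI
    have hk' : k < n := by rwa [ht₃.var_zero] at hk
    have ha : τ.arr 11 = σ₂.arr 11 := (hf.arr 11 rfl).trans (f₃.arr 11 rfl)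
    rw [take_finRange_succ hk', List.filter_append, List.flatMap_append, ← List.append_assoc,
      ← hI, Cmd.eval_ite, Cmd.eval_skip, Expr.eval, Expr.eval, hx, ha, State.setVar_out]
    by_cases e : σ₂.arr 11 k = 0
    · simp [e]
    · rw [if_pos e, emitComponent_out (ht₃.frame hf rfl) (c := ⟨k, hk'⟩) hx]
      simp [e]

end Components

/-! ### The b-articulation points -/

/-- Execute `q` if the ends of the edge with the number in variable `9` avoid the vertex in
variable `4` and are in no common component. -/
def scanStep (q : Cmd) : Cmd := loadEdge ;; ifAvoids (walk ;; .ite (.var 15) q .skip)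

def markPoint : Cmd := .store 10 (.var 4) (.lit 1)

def clearPoint : Cmd := .store 10 (.var 4) (.lit 0)

def testPoint : Cmd := .assign 4 (.var 21) ;; blocks ;; clearPoint ;; .loop 9 1 (scanStep markPoint)

/-- Mark the b-articulation points in array `10`. -/
def findPoints : Cmd := .loop 21 0 testPoint

section Points

variable {n : ℕ} {L : List (Fin n × Fin n)} {F F₁ : Finset (Fin n × Fin n)} {b r : Fin n}
  {p : Fin n → Fin n} {ord : Fin n → ℕ} {lab : Fin n → Fin n} {σ : State}

theorem HasBlocks.setVar (h : HasBlocks F F₁ b r p ord lab σ) {x : ℕ} (v : ℕ) (h0 : x ≠ 0)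
    (h2 : x ≠ 2) (h3 : x ≠ 3) (h4 : x ≠ 4) : HasBlocks F F₁ b r p ord lab (σ.setVar x v) := by
  refine h.frame (c := .assign x (.lit v)) (Cmd.frame (.assign x (.lit v)) σ) ?_
  simp [Cmd.writes, Cmd.stores, h0, h2, h3, h4]

/-- Either the ends of the edge are avoided or in a common component, or `q` is executed. -/
theorem scanStep_cases (hin : HasInput L σ) (h : HasBlocks F F b r p ord lab σ) {i : ℕ}
    (hi : i < L.length) (h9 : σ.var 9 = i) (q : Cmd) :
    ((L[i].1 ≠ b → L[i].2 ≠ b → Same F b L[i].1 L[i].2) ∧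
      (scanStep q).eval σ = (scanStep .skip).eval σ ∧
      (scanStep q).time σ ≤ (scanStep .skip).time σ) ∨
    (L[i].1 ≠ b ∧ L[i].2 ≠ b ∧ ¬ Same F b L[i].1 L[i].2 ∧
      ∃ l, Climb p ord L[i].1 L[i].2 l ∧ Marks lab l (walk.eval (loadEdge.eval σ)) ∧
        (scanStep q).eval σ = q.eval (walk.eval (loadEdge.eval σ)) ∧
        (scanStep q).time σ ≤
          (scanStep .skip).time σ + q.time (walk.eval (loadEdge.eval σ))) := by
  have e := loadEdge_eval hin hi h9
  have hb := h.frame (Cmd.frame loadEdge σ) rfl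
  have h4 := hb.has_tree.avoid
  have h10 : (loadEdge.eval σ).var 10 = L[i].1 := by simp [e]
  have h11 : (loadEdge.eval σ).var 11 = L[i].2 := by simp [e]
  have ev : ∀ q, (scanStep q).eval σ = if L[i].1 ≠ b ∧ L[i].2 ≠ b then
      (if (walk.eval (loadEdge.eval σ)).var 15 ≠ 0 then q.eval (walk.eval (loadEdge.eval σ))
        else walk.eval (loadEdge.eval σ)) else loadEdge.eval σ := fun q => by
    rw [scanStep, Cmd.eval_seq, ifAvoids_eval h4 h10 h11, Cmd.eval_seq, Cmd.eval_ite,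
      Cmd.eval_skip, Expr.eval]
  -- The time of `q` is not charged when `q` is not executed; this is what allows the additions to
  -- be counted over the whole run.
  have skip : ∀ q, (¬ (L[i].1 ≠ b ∧ L[i].2 ≠ b) ∨ (walk.eval (loadEdge.eval σ)).var 15 = 0) →
      (scanStep q).time σ ≤ (scanStep .skip).time σ := by
    intro q hq
    simp only [scanStep, ifAvoids, Cmd.time, Expr.eval, Op.eval, h4, h10, h11, Fin.val_inj]
    by_cases e1 : L[i].1 = b
    · simp [e1]
    · by_cases e2 : L[i].2 = b
      · simp [e2]
      · simp [hq.resolve_left (not_not.2 ⟨e1, e2⟩)]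
  by_cases hav : L[i].1 ≠ b ∧ L[i].2 ≠ b
  · obtain ⟨l, hl, hm⟩ := walk_spec hb.tree hb.ord_le hb.has_tree h10 h11 hav.1 hav.2
    have hs := hb.sep_iff hl hav.1 hav.2 hm
    by_cases h15 : (walk.eval (loadEdge.eval σ)).var 15 = 0
    · refine Or.inl ⟨fun _ _ => hs.1 h15, ?_, skip q (Or.inr h15)⟩
      rw [ev, ev, if_pos hav, if_pos hav, if_neg (not_not.2 h15), if_neg (not_not.2 h15)]
    · refine Or.inr ⟨hav.1, hav.2, fun hcon => h15 (hs.2 hcon), l, hl, hm, ?_, ?_⟩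
      · rw [ev, if_pos hav, if_pos h15]
      · simp only [scanStep, ifAvoids, Cmd.time]
        split_ifs <;> omega
  · refine Or.inl ⟨fun hu hw => absurd ⟨hu, hw⟩ hav, ?_, skip q (Or.inl hav)⟩
    rw [ev, ev, if_neg hav, if_neg hav]

/-- Strong connectivity without `b` is automatic, and it suffices to test the ends of the edges of
the input graph. This costs `m` walks per vertex instead of one for each pair of vertices. -/
theorem stronglyBiconnected_iff_same (hT : TwoVertexConnected (graph F))
    (hE : StronglyBiconnected (deleteVertex (graph L.toFinset) b)) :
    StronglyBiconnected (deleteVertex (graph F) b) ↔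
      ∀ e ∈ L, e.1 ≠ b → e.2 ≠ b → Same F b e.1 e.2 := by
  constructor
  · exact fun h e _ hu hw => ((stronglyBiconnected_deleteVertex b).1 h).2.2 e.1 e.2 hu hw
  · exact fun h => stronglyBiconnected_of_same hE (fun u w hu hw =>
      (twoVertexConnected_graph.1 hT).2.2 b u w hu hw)
      fun u w he hu hw => h (u, w) (List.mem_toFinset.1 he) hu hw

theorem testPoint_spec (hin : HasInput L σ) (hF : IsMatrix 2 F σ) (hFL : F ⊆ L.toFinset)
    (hT : TwoVertexConnected (graph F))
    (hE : StronglyBiconnected (deleteVertex (graph L.toFinset) b)) (h21 : σ.var 21 = b) (j : ℕ) :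
    (j = b → ((testPoint.eval σ).arr 10 j ≠ 0 ↔
      ¬ StronglyBiconnected (deleteVertex (graph F) b))) ∧
    (j ≠ b → (testPoint.eval σ).arr 10 j = σ.arr 10 j) := by
  have hT' := twoVertexConnected_graph.1 hT
  have hn : 2 ≤ n := by
    have := hT'.1
    rw [Nat.card_fin] at this
    omega
  have f₁ := Cmd.frame (.assign 4 (.var 21)) σ
  have e₁ : (Cmd.assign 4 (.var 21)).eval σ = σ.setVar 4 b := by
    rw [Cmd.eval_assign, Expr.eval, h21]
  rw [e₁] at f₁
  obtain ⟨r, p, ord, lab, hb⟩ := blocks_spec (hin.frame f₁ rfl) (hF.congr (f₁.arr 2 rfl)) hFL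
    (b := b) (by simp) hn fun u w hu hw => hT'.2.2 b u w hu hw
  have f₂ := Cmd.frame blocks (σ.setVar 4 b)
  have hin₂ := (hin.frame f₁ rfl).frame f₂ rfl
  have a₂ : (blocks.eval (σ.setVar 4 b)).arr 10 = σ.arr 10 := f₂.arr 10 rfl
  set σ₂ := blocks.eval (σ.setVar 4 b) with hσ₂
  have f₃ := Cmd.frame clearPoint σ₂
  have e₃ : clearPoint.eval σ₂ = σ₂.setArr 10 b 0 := by
    rw [clearPoint, Cmd.eval_store, Expr.eval, Expr.eval, hb.has_tree.avoid]
  rw [e₃] at f₃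
  have hin₃ := hin₂.frame f₃ rfl
  have hb₃ := hb.frame f₃ rfl
  have ev : testPoint.eval σ = (Cmd.loop 9 1 (scanStep markPoint)).eval (σ₂.setArr 10 b 0) := by
    rw [testPoint, Cmd.eval_seq, Cmd.eval_seq, Cmd.eval_seq, e₁, ← hσ₂, e₃]
  have key := Cmd.loop_induct (x := 9) (N := 1) (σ := σ₂.setArr 10 b 0)
    (p := scanStep markPoint)
    (I := fun k τ => HasBlocks F F b r p ord lab τ ∧
      (τ.arr 10 b ≠ 0 ↔ ¬ ∀ e ∈ L.take k, e.1 ≠ b → e.2 ≠ b → Same F b e.1 e.2) ∧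
      ∀ j : ℕ, j ≠ b → τ.arr 10 j = σ.arr 10 j) ?_ ?_
  · rw [hin₃.var_one, List.take_length, ← stronglyBiconnected_iff_same hT hE, ← ev] at key
    exact ⟨fun e => e ▸ key.2.1, key.2.2 j⟩
  · refine ⟨hb₃.setVar 0 (by simp) (by simp) (by simp) (by simp), ?_, fun j hj => ?_⟩
    · simp [State.setArr_arr]
    · simp [State.setArr_arr, hj, a₂]
  · rintro k hk τ hx hf ⟨hbτ, h1, h2⟩
    have hk' : k < L.length := by rwa [hin₃.var_one] at hk
    have hinτ := hin₃.frame hf rfl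
    have split : (∀ e ∈ L.take (k + 1), e.1 ≠ b → e.2 ≠ b → Same F b e.1 e.2) ↔
        (∀ e ∈ L.take k, e.1 ≠ b → e.2 ≠ b → Same F b e.1 e.2) ∧
          (L[k].1 ≠ b → L[k].2 ≠ b → Same F b L[k].1 L[k].2) := by
      rw [List.take_succ_eq_append_getElem hk']
      simp only [List.mem_append, List.mem_singleton, or_imp, forall_and, forall_eq]
    refine ⟨(hbτ.frame (Cmd.frame (scanStep markPoint) τ) rfl).setVar _ (by simp) (by simp)
      (by simp) (by simp), ?_⟩
    rw [split, State.setVar_arr]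
    rcases scanStep_cases hinτ hbτ hk' hx markPoint with ⟨hs, he, -⟩ | ⟨hu, hw, hs, l, -, -, he, -⟩
    · rw [he, (Cmd.frame (scanStep .skip) τ).arr 10 rfl, and_iff_left hs]
      exact ⟨h1, h2⟩
    · have h4 : (walk.eval (loadEdge.eval τ)).var 4 = b :=
        ((hbτ.frame (Cmd.frame loadEdge τ) rfl).frame (Cmd.frame walk _) rfl).has_tree.avoid
      have a4 : (walk.eval (loadEdge.eval τ)).arr 10 = τ.arr 10 :=
        ((Cmd.frame walk _).arr 10 rfl).trans ((Cmd.frame loadEdge τ).arr 10 rfl)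
      rw [he, markPoint, Cmd.eval_store, Expr.eval, Expr.eval, h4]
      refine ⟨?_, fun j hj => ?_⟩
      · rw [State.setArr_arr]
        simp only [and_self, if_true, ne_eq, one_ne_zero, not_false_iff, true_iff]
        exact fun h => hs (h.2 hu hw)
      · rw [State.setArr_arr, if_neg fun h => hj h.2, a4, h2 j hj]

theorem findPoints_spec (hin : HasInput L σ) (hF : IsMatrix 2 F σ) (hFL : F ⊆ L.toFinset)
    (hT : TwoVertexConnected (graph F))
    (hE : ∀ b, StronglyBiconnected (deleteVertex (graph L.toFinset) b)) (b : Fin n) :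
    (findPoints.eval σ).arr 10 b ≠ 0 ↔ IsBArticulationPoint (graph F) b := by
  have key := Cmd.loop_induct (x := 21) (N := 0) (σ := σ) (p := testPoint)
    (I := fun k τ => ∀ b : Fin n, (b : ℕ) < k → (τ.arr 10 b ≠ 0 ↔
      ¬ StronglyBiconnected (deleteVertex (graph F) b))) (by simp) ?_
  · rw [hT.isBArticulationPoint_iff]
    exact key b (b.2.trans_eq hin.var_zero.symm)
  · intro k hk τ hx hf hI b hb
    rw [hin.var_zero] at hk
    have h := testPoint_spec (b := ⟨k, hk⟩) (hin.frame hf rfl) (hF.congr (hf.arr 2 rfl)) hFL hT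
      (hE _) hx b
    rw [State.setVar_arr]
    rcases Nat.lt_succ_iff_lt_or_eq.1 hb with hlt | heq
    · rw [h.2 hlt.ne]
      exact hI b hlt
    · obtain rfl : b = ⟨k, hk⟩ := Fin.ext heq
      exact h.1 rfl

/-- Variable `22` tells whether array `10` contains a b-articulation point. -/
def testGraph : Cmd :=
  .assign 22 (.lit 0) ;; .loop 7 0 (.ite (.get 10 (.var 7)) (.assign 22 (.lit 1)) .skip)

theorem testGraph_spec (h0 : σ.var 0 = n) :
    (testGraph.eval σ).var 22 = 0 ↔ ∀ b : Fin n, σ.arr 10 b = 0 := by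
  have key := Cmd.loop_induct (x := 7) (N := 0) (σ := σ.setVar 22 0)
    (p := .ite (.get 10 (.var 7)) (.assign 22 (.lit 1)) .skip)
    (I := fun k τ => τ.var 22 = 0 ↔ ∀ b : Fin n, (b : ℕ) < k → σ.arr 10 b = 0) (by simp) ?_
  · rw [testGraph, Cmd.eval_seq, Cmd.eval_assign, Expr.eval, key]
    simp [h0]
  · intro k hk τ hx hf hI
    have hk' : k < n := by simpa [h0] using hk
    have ha : τ.arr 10 = σ.arr 10 := hf.arr 10 rfl
    have split : (∀ b : Fin n, (b : ℕ) < k + 1 → σ.arr 10 b = 0) ↔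
        (∀ b : Fin n, (b : ℕ) < k → σ.arr 10 b = 0) ∧ σ.arr 10 k = 0 := by
      constructor
      · exact fun h => ⟨fun b hb => h b (by omega), h ⟨k, hk'⟩ (by simp)⟩
      · rintro ⟨h, h'⟩ b hb
        rcases Nat.lt_succ_iff_lt_or_eq.1 hb with hlt | heq
        · exact h b hlt
        · rwa [heq]
    rw [split, ← hI]
    by_cases e : σ.arr 10 k = 0 <;>
      simp [Cmd.eval_ite, Cmd.eval_assign, Cmd.eval_skip, Expr.eval, hx, ha, e]

end Points

/-! ### The loops of the algorithm -/

/-- Output the components and the edge in the variables `10` and `11`, and add this edge. -/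
def addEdge : Cmd :=
  .emit (.lit 1) ;; emitComponents ;; .emit (.var 10) ;; .emit (.var 11) ;; restoreEdge ;; relabel

/-- Execute `q` for the edges whose ends avoid the vertex in variable `4` and are in no common
component. -/
def scan (q : Cmd) : Cmd :=
  .emit (.var 4) ;; blocks ;; .loop 9 1 (scanStep q) ;; .emit (.lit 0)

def treatPoint (q : Cmd) : Cmd :=
  .ite (.get 10 (.var 21)) (.assign 4 (.var 21) ;; scan q) .skip

def treatPoints : Cmd := .loop 21 0 (treatPoint addEdge)

/-- The values of the variables that bound the loops. -/
def sizes (n m : ℕ) : ℕ → ℕ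
  | 0 => n
  | 1 => m
  | _ => n + n

section Loops

variable {n : ℕ} {L : List (Fin n × Fin n)} {F F₁ : Finset (Fin n × Fin n)} {b r : Fin n}
  {p : Fin n → Fin n} {ord : Fin n → ℕ} {lab : Fin n → Fin n} {σ : State}

theorem HasInput.time_le (hin : HasInput L σ) {c : Cmd} (hc : c.static = true) :
    c.time σ ≤ c.cost (sizes n L.length) := by
  refine Cmd.time_le_cost hc σ fun y hy => ?_
  interval_cases y
  exacts [hin.var_zero, hin.var_one, hin.var_two]

theorem addEdge_spec (hF : IsMatrix 2 F σ) (h : HasBlocks F F b r p ord lab σ)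
    {u w : Fin n} (h10 : σ.var 10 = u) (h11 : σ.var 11 = w) (hu : u ≠ b) (hw : w ≠ b)
    {l : List (Fin n)} (hc : Climb p ord u w l) (hm : Marks lab l σ) :
    (addEdge.eval σ).out = σ.out ++ ([1] ++
      encodeComponents ((labels b r lab).map (component b r p lab)) ++ encodeEdge (u, w)) ∧
    IsMatrix 2 (insert (u, w) F) (addEdge.eval σ) ∧
    ∃ lab', HasBlocks (insert (u, w) F) (insert (u, w) F) b r p ord lab' (addEdge.eval σ) := by
  have f₁ := Cmd.frame (.emit (.lit 1)) σ
  have e₁ : (Cmd.emit (.lit 1)).eval σ = σ.write 1 := by rw [Cmd.eval_emit, Expr.eval]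
  rw [e₁] at f₁
  have o₂ := emitComponents_out (h.frame f₁ rfl).has_tree
  have f₂ := Cmd.frame emitComponents (σ.write 1)
  set σ₂ := emitComponents.eval (σ.write 1) with hσ₂
  set σ₃ := (σ₂.write u).write w with hσ₃
  have v0 : σ₃.var 0 = n := (f₂.var 0 rfl).trans h.has_tree.var_zero
  have v10 : σ₃.var 10 = u := (f₂.var 10 rfl).trans h10
  have v11 : σ₃.var 11 = w := (f₂.var 11 rfl).trans h11
  have e₄ : restoreEdge.eval σ₃ = σ₃.setArr 2 (u * n + w) 1 := by
    simp [restoreEdge, Cmd.storeMat, Cmd.eval_store, Expr.eval, Op.eval, v0, v10, v11]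
  have f₄ := Cmd.frame restoreEdge σ₃
  have ev : addEdge.eval σ = relabel.eval (restoreEdge.eval σ₃) := by
    have w10 : σ₂.var 10 = u := v10
    have w11 : (σ₂.write u).var 11 = w := v11
    have e10 : (Cmd.emit (.var 10)).eval σ₂ = σ₂.write u := by rw [Cmd.eval_emit, Expr.eval, w10]
    have e11 : (Cmd.emit (.var 11)).eval (σ₂.write u) = σ₃ := by
      rw [Cmd.eval_emit, Expr.eval, w11]
    rw [addEdge, Cmd.eval_seq, Cmd.eval_seq, Cmd.eval_seq, Cmd.eval_seq, Cmd.eval_seq, e₁, ← hσ₂,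
      e10, e11]
  have hb₂ := (h.frame f₁ rfl).frame f₂ rfl
  have hb₃ : HasBlocks F F b r p ord lab σ₃ :=
    (hb₂.frame (c := .emit (.lit u)) (Cmd.frame (.emit (.lit u)) σ₂) rfl).frame
      (c := .emit (.lit w)) (Cmd.frame (.emit (.lit w)) (σ₂.write u)) rfl
  have hb₄ := hb₃.frame f₄ rfl
  have m₃ : IsMatrix 2 F σ₃ := hF.congr (f₂.arr 2 rfl)
  have m₄ : IsMatrix 2 (insert (u, w) F) (restoreEdge.eval σ₃) := by
    rw [e₄]
    exact m₃.insert u w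
  -- The output of the components leaves the marks of the preceding walk intact, so the merging can
  -- follow the output.
  have hm₄ : Marks lab l (restoreEdge.eval σ₃) := hm.congr
    ((f₄.arr 9 rfl).trans (f₂.arr 9 rfl)) ((f₄.var 15 rfl).trans (f₂.var 15 rfl))
    ((f₄.var 14 rfl).trans (f₂.var 14 rfl))
  have f₅ := Cmd.frame relabel (restoreEdge.eval σ₃)
  rw [ev]
  refine ⟨?_, m₄.congr (f₅.arr 2 rfl),
    (hb₄.mono (Finset.subset_insert _ _)).relabel hc hm₄ hu hw (Finset.mem_insert_self _ _)⟩
  rw [f₅.out rfl, f₄.out rfl, hσ₃, State.write_out, State.write_out, o₂, State.write_out]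
  simp [encodeEdge]

/-- A single pass realises the while loop, because an edge whose ends are inseparable remains so
when edges are added. The number of edges, weighted with the cost of an addition, is a potential:
`scan .skip` accounts for the pass itself and the growth of `F` for the additions. -/
theorem scan_spec (hin : HasInput L σ) (hF : IsMatrix 2 F σ) (hFL : F ⊆ L.toFinset)
    (hT : TwoVertexConnected (graph F))
    (hE : StronglyBiconnected (deleteVertex (graph L.toFinset) b)) (h4 : σ.var 4 = b) :
    ∃ F' τ, F ⊆ F' ∧ F' ⊆ L.toFinset ∧ IsMatrix 2 F' ((scan addEdge).eval σ) ∧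
      WhileLoop L.toFinset b F τ F' ∧
      ((scan addEdge).eval σ).out = σ.out ++ ([(b : ℕ)] ++ τ) ∧
      (scan addEdge).time σ + F.card * addEdge.cost (sizes n L.length) ≤
        (scan .skip).cost (sizes n L.length) + F'.card * addEdge.cost (sizes n L.length) := by
  have hT' := twoVertexConnected_graph.1 hT
  have hn : 2 ≤ n := by
    have := hT'.1
    rw [Nat.card_fin] at this
    omega
  set A := addEdge.cost (sizes n L.length) with hA
  have f₁ := Cmd.frame (.emit (.var 4)) σ
  have e₁ : (Cmd.emit (.var 4)).eval σ = σ.write b := by rw [Cmd.eval_emit, Expr.eval, h4]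
  rw [e₁] at f₁
  have hin₁ := hin.frame f₁ rfl
  obtain ⟨r, p, ord, lab, hb⟩ := blocks_spec hin₁ (hF.congr (f₁.arr 2 rfl)) hFL (b := b)
    ((f₁.var 4 rfl).trans h4) hn fun u w hu hw => hT'.2.2 b u w hu hw
  have f₂ := Cmd.frame blocks (σ.write b)
  have hin₂ := hin₁.frame f₂ rfl
  have t₂ := hin₁.time_le (c := blocks) rfl
  have m₂ : IsMatrix 2 F (blocks.eval (σ.write b)) := hF.congr (f₂.arr 2 rfl)
  have o₂ : (blocks.eval (σ.write b)).out = σ.out ++ [(b : ℕ)] := f₂.out rfl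
  have hV : ∃ x, x ≠ b ∧ x ≠ r := exists_ne_of_three_le_card hT'.1 b r
  set σ₂ := blocks.eval (σ.write b) with hσ₂
  have key := Cmd.loop_induct_time (x := 9) (N := 1) (σ := σ₂) (p := scanStep addEdge)
    (I := fun k υ t => ∃ Fk τ lab, F ⊆ Fk ∧ Fk ⊆ L.toFinset ∧ IsMatrix 2 Fk υ ∧
      HasBlocks Fk Fk b r p ord lab υ ∧
      (∀ e ∈ L.take k, e.1 ≠ b → e.2 ≠ b → Same Fk b e.1 e.2) ∧
      -- A derivation of `WhileLoop` starts from its last round, so the rounds done so far are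
      -- described by what they put in front of any continuation.
      (∀ τ' F', WhileLoop L.toFinset b Fk τ' F' → WhileLoop L.toFinset b F (τ ++ τ') F') ∧
      υ.out = σ₂.out ++ τ ∧
      t + F.card * A ≤ k * (scanStep .skip).cost (sizes n L.length) + Fk.card * A) ?_ ?_
  · obtain ⟨t, ⟨Fk, τ, lab', h1, h2, h3, h5, h6, h7, h8, h9⟩, ht⟩ := key
    rw [hin₂.var_one] at h6 h9 ht
    rw [List.take_length] at h6
    have ev : (scan addEdge).eval σ =
        ((Cmd.loop 9 1 (scanStep addEdge)).eval σ₂).write 0 := by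
      rw [scan, Cmd.eval_seq, Cmd.eval_seq, Cmd.eval_seq, e₁, ← hσ₂, Cmd.eval_emit, Expr.eval]
    refine ⟨Fk, τ ++ [0], h1, h2, ?_, h7 _ _ (WhileLoop.done
      ((stronglyBiconnected_iff_same (hT.mono h1) hE).2 h6)), ?_, ?_⟩
    · rw [ev]
      exact h3
    · rw [ev, State.write_out, h8, o₂]
      simp
    · have e : (scan addEdge).time σ = 2 + (blocks.time (σ.write b) +
          ((Cmd.loop 9 1 (scanStep addEdge)).time σ₂ + 2)) := by
        simp only [scan, Cmd.time, Expr.cost, e₁, ← hσ₂]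
      rw [e, ht]
      simp only [scan, Cmd.cost, Expr.cost, sizes, Nat.mul_add] at *
      omega
  · exact ⟨F, [], lab, le_rfl, hFL, m₂, hb.setVar 0 (by simp) (by simp) (by simp) (by simp),
      by simp, fun τ' F' h => h, by simp, by simp⟩
  · rintro k hk υ t hx hf ⟨Fk, τ, lab, h1, h2, h3, h5, h6, h7, h8, h9⟩
    have hk' : k < L.length := by rwa [hin₂.var_one] at hk
    have hinυ := hin₂.frame hf rfl
    have split : ∀ Fk : Finset (Fin n × Fin n),
        (∀ e ∈ L.take (k + 1), e.1 ≠ b → e.2 ≠ b → Same Fk b e.1 e.2) ↔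
        (∀ e ∈ L.take k, e.1 ≠ b → e.2 ≠ b → Same Fk b e.1 e.2) ∧
          (L[k].1 ≠ b → L[k].2 ≠ b → Same Fk b L[k].1 L[k].2) := fun Fk => by
      rw [List.take_succ_eq_append_getElem hk']
      simp only [List.mem_append, List.mem_singleton, or_imp, forall_and, forall_eq]
    rcases scanStep_cases hinυ h5 hk' hx addEdge with
      ⟨hs, he, ht⟩ | ⟨hu, hw, hs, l, hl, hm, he, ht⟩
    · have f := Cmd.frame (scanStep .skip) υ
      rw [he]
      refine ⟨Fk, τ, lab, h1, h2, h3.congr (f.arr 2 rfl), (h5.frame f rfl).setVar _ (by simp)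
        (by simp) (by simp) (by simp), (split Fk).2 ⟨h6, hs⟩, h7, ?_, ?_⟩
      · rw [State.setVar_out, f.out rfl, h8]
      · have ts := hinυ.time_le (c := scanStep .skip) rfl
        rw [Nat.succ_mul]
        omega
    · have fl := Cmd.frame loadEdge υ
      have fw := Cmd.frame walk (loadEdge.eval υ)
      have el := loadEdge_eval hinυ hk' hx
      obtain ⟨ho, hM, lab', hb'⟩ := addEdge_spec (h3.congr ((fw.arr 2 rfl).trans (fl.arr 2 rfl)))
        ((h5.frame fl rfl).frame fw rfl) ((fw.var 10 rfl).trans (by simp [el]))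
        ((fw.var 11 rfl).trans (by simp [el])) hu hw hl hm
      -- Adjacent vertices are never separated, so an edge with separated ends is new.
      have hnot : L[k] ∉ Fk := fun hmem => hs (Same.of_sym (Or.inl hmem) hu hw)
      have hmem : L[k] ∈ L.toFinset := List.mem_toFinset.2 (List.getElem_mem hk')
      have hlists := listsSBComponents h5 hV fun u w hu hw =>
        (twoVertexConnected_graph.1 (hT.mono h1)).2.2 b u w hu hw
      rw [he]
      refine ⟨insert L[k] Fk, τ ++ ([1] ++ encodeComponents
        ((labels b r lab).map (component b r p lab)) ++ encodeEdge (L[k].1, L[k].2)), lab',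
        h1.trans (Finset.subset_insert _ _), Finset.insert_subset hmem h2, hM,
        hb'.setVar _ (by simp) (by simp) (by simp) (by simp), (split _).2 ⟨fun e he hu hw =>
          (h6 e he hu hw).mono (Finset.subset_insert _ _), fun hu hw =>
          Same.of_sym (Or.inl (Finset.mem_insert_self _ _)) hu hw⟩, fun τ' F' hW => ?_, ?_, ?_⟩
      · rw [List.append_assoc]
        refine h7 _ _ (WhileLoop.step (fun hcon => hs ?_) _ hlists L[k].1 L[k].2
          (Finset.mem_sdiff.2 ⟨hmem, hnot⟩) hu hw ?_ hW)
        · exact ((stronglyBiconnected_deleteVertex b).1 hcon).2.2 _ _ hu hw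
        · intro c hc hcon
          obtain ⟨c', hc', rfl⟩ := List.mem_map.1 hc
          simp only [labels, List.mem_filter, List.mem_finRange, true_and,
            decide_eq_true_eq] at hc'
          obtain ⟨y, hyb, hyr, rfl⟩ := hc'
          have hB := isBlock_labelSet h5.tree h5.complete h5.sound hyb hyr
          simp only [component, List.mem_filter, List.mem_finRange, true_and,
            decide_eq_true_eq] at hcon
          exact hs (hB.2.1 _ hcon.1 _ hcon.2)
      · rw [State.setVar_out, ho, fw.out rfl, fl.out rfl, h8]
        simp
      · have ta := ((hinυ.frame fl rfl).frame fw rfl).time_le (c := addEdge) rfl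
        have ts := hinυ.time_le (c := scanStep .skip) rfl
        rw [Finset.card_insert_of_notMem hnot, Nat.succ_mul, Nat.succ_mul]
        omega

/-- The potentials of the successive passes telescope. Since the final edge set has at most `m`
edges, all additions for all points together cost at most `m` times one addition. -/
theorem treatPoints_spec (hin : HasInput L σ) (hF : IsMatrix 2 F σ) (hFL : F ⊆ L.toFinset)
    (hT : TwoVertexConnected (graph F))
    (hE : ∀ b, StronglyBiconnected (deleteVertex (graph L.toFinset) b)) :
    ∃ F' τ, F' ⊆ L.toFinset ∧ IsMatrix 2 F' (treatPoints.eval σ) ∧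
      ForLoop L.toFinset (members n 10 σ) F τ F' ∧ (treatPoints.eval σ).out = σ.out ++ τ ∧
      treatPoints.time σ ≤ (Cmd.loop 21 0 (treatPoint .skip)).cost (sizes n L.length) +
        L.length * addEdge.cost (sizes n L.length) := by
  set A := addEdge.cost (sizes n L.length) with hA
  have key := Cmd.loop_induct_time (x := 21) (N := 0) (σ := σ) (p := treatPoint addEdge)
    (I := fun k υ t => ∃ Fk τ, F ⊆ Fk ∧ Fk ⊆ L.toFinset ∧ IsMatrix 2 Fk υ ∧
      (∀ bs τ' F', ForLoop L.toFinset bs Fk τ' F' → ForLoop L.toFinset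
        ((((List.finRange n).take k).filter fun z : Fin n => σ.arr 10 z ≠ 0) ++ bs) F
        (τ ++ τ') F') ∧
      υ.out = σ.out ++ τ ∧
      t + F.card * A ≤ k * (treatPoint .skip).cost (sizes n L.length) + Fk.card * A) ?_ ?_
  · obtain ⟨t, ⟨Fk, τ, h1, h2, h3, h5, h6, h7⟩, ht⟩ := key
    rw [hin.var_zero] at h5 h7 ht
    rw [take_finRange_self] at h5
    refine ⟨Fk, τ, h2, h3, ?_, h6, ?_⟩
    · have := h5 [] [] Fk ForLoop.nil
      rwa [List.append_nil, List.append_nil] at this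
    · have hc : Fk.card ≤ L.length := (Finset.card_le_card h2).trans (List.toFinset_card_le L)
      have := Nat.mul_le_mul_right A hc
      rw [treatPoints, ht]
      simp only [Cmd.cost, sizes, Nat.mul_add] at *
      omega
  · exact ⟨F, [], le_rfl, hFL, hF, fun bs τ' F' h => by simpa using h, by simp, by simp⟩
  · rintro k hk υ t hx hf ⟨Fk, τ, h1, h2, h3, h5, h6, h7⟩
    have hk' : k < n := by rwa [hin.var_zero] at hk
    have ha : υ.arr 10 = σ.arr 10 := hf.arr 10 rfl
    have hinυ := hin.frame hf rfl
    have e : (treatPoint addEdge).eval υ =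
        if σ.arr 10 k ≠ 0 then (scan addEdge).eval (υ.setVar 4 k) else υ := by
      rw [treatPoint, Cmd.eval_ite, Cmd.eval_seq, Cmd.eval_assign, Cmd.eval_skip, Expr.eval,
        Expr.eval, Expr.eval, hx, ha]
    have et : (treatPoint addEdge).time υ =
        3 + if σ.arr 10 k ≠ 0 then 2 + (scan addEdge).time (υ.setVar 4 k) else 1 := by
      simp only [treatPoint, Cmd.time, Cmd.eval_assign, Expr.eval, Expr.cost, hx, ha]
    have ec : (treatPoint .skip).cost (sizes n L.length) =
        3 + (2 + (scan .skip).cost (sizes n L.length) + 1) := rfl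
    rw [ec] at h7 ⊢
    rw [take_finRange_succ hk', List.filter_append, e, et, Nat.succ_mul]
    by_cases h10 : σ.arr 10 k = 0
    · rw [if_neg (not_not.2 h10), if_neg (not_not.2 h10)]
      refine ⟨Fk, τ, h1, h2, h3, fun bs τ' F' h => ?_, h6, by omega⟩
      simpa [h10] using h5 bs τ' F' h
    · rw [if_pos h10, if_pos h10]
      have f := Cmd.frame (.assign 4 (.lit k)) υ
      rw [Cmd.eval_assign, Expr.eval] at f
      obtain ⟨F', τ', s1, s2, s3, s4, s5, s6⟩ := scan_spec (b := ⟨k, hk'⟩) (hinυ.frame f rfl)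
        (h3.congr (f.arr 2 rfl)) h2 (hT.mono h1) (hE _) (by simp)
      rw [← hA] at s6
      refine ⟨F', τ ++ ([k] ++ τ'), h1.trans s1, s2, s3, fun bs τ'' F'' h => ?_, ?_, by omega⟩
      · have := h5 _ _ _ (ForLoop.cons s4 h)
        simpa [h10] using this
      · rw [State.setVar_out, s5, State.setVar_out, h6, List.append_assoc]

end Loops

/-! ### The whole algorithm -/

def prelude : Cmd := minimize ;; emitEdges ;; findPoints ;; testGraph

def reportPoints : Cmd := .emit (.lit 0) ;; emitSet 10

def lateStop : Cmd := reportPoints ;; treatPoints ;; emitEdges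

def earlyStop : Cmd := .emit (.lit 1) ;; emitEdges

def algorithm : Cmd := prelude ;; .ite (.var 22) lateStop earlyStop

/-! ### The cost polynomials -/

section Costs

variable {n m : ℕ}

/-- These are the monomials that occur in the cost polynomials. The constants in the bounds below
therefore only have to exceed the sums of the coefficients. -/
theorem monomials_le (hn : 1 ≤ n) (hnm : n ≤ m) :
    1 ≤ n ^ 2 * m ∧ n ≤ n ^ 2 * m ∧ m ≤ n ^ 2 * m ∧ n ^ 2 ≤ n ^ 2 * m ∧ n * m ≤ n ^ 2 * m ∧
      n ^ 3 ≤ n ^ 2 * m := by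
  have hm : 1 ≤ m := hn.trans hnm
  have h2 : n ≤ n ^ 2 := Nat.le_self_pow two_ne_zero n
  have h3 : n ^ 2 ≤ n ^ 2 * m := Nat.le_mul_of_pos_right _ hm
  exact ⟨(hn.trans h2).trans h3, h2.trans h3, Nat.le_mul_of_pos_left _ (hn.trans h2), h3,
    Nat.mul_le_mul_right m h2, (pow_succ n 2).trans_le (Nat.mul_le_mul_left _ hnm)⟩

theorem cost_prelude (hn : 1 ≤ n) (hnm : n ≤ m) :
    prelude.cost (sizes n m) ≤ 1005 * (n ^ 2 * m) := by
  have := monomials_le hn hnm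
  simp only [prelude, minimize, removeStep, testResidual, deleteEdge, residual, nextInit, pathNext,
    shiftMatrix, pathBack, restoreEdge, Cmd.storeMat, emitEdges, countEdges, listEdges, findPoints,
    testPoint, clearPoint, scanStep, markPoint, testGraph, blocks, setTree, initLabels, mergeStep,
    edgeEntry, relabel, loadEdge, ifAvoids, walk, walkInit, climbStep, climbMove, climbMark, search,
    searchRound, searchInit, Expr.mat, Cmd.cost, Expr.cost, findReached, scanRow, sizes]
  ring_nf at *
  linarith

theorem cost_treatPoint (hn : 1 ≤ n) (hnm : n ≤ m) :
    (Cmd.loop 21 0 (treatPoint .skip)).cost (sizes n m) ≤ 507 * (n ^ 2 * m) := by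
  have := monomials_le hn hnm
  simp only [treatPoint, scan, scanStep, blocks, setTree, initLabels, mergeStep,
    edgeEntry, relabel, loadEdge, ifAvoids, walk, walkInit, climbStep, climbMove, climbMark, search,
    searchRound, searchInit, Expr.mat, Cmd.cost, Expr.cost, findReached, scanRow, sizes]
  ring_nf at *
  linarith

theorem cost_addEdge (hn : 1 ≤ n) (hnm : n ≤ m) :
    m * addEdge.cost (sizes n m) ≤ 224 * (n ^ 2 * m) := by
  have := monomials_le hn hnm
  simp only [addEdge, emitComponents, relabel, restoreEdge, Cmd.storeMat, clearFlags, setFlags,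
    clearMembers, setMembers, emitComponent, emitSet, emitCount, emitMembers, Cmd.cost, Expr.cost,
    sizes]
  ring_nf at *
  linarith

theorem cost_reportPoints (hn : 1 ≤ n) (hnm : n ≤ m) :
    reportPoints.cost (sizes n m) ≤ 100 * (n ^ 2 * m) := by
  have := monomials_le hn hnm
  simp only [reportPoints, emitSet, emitCount, emitMembers, Cmd.cost, Expr.cost, sizes]
  ring_nf at *
  linarith

theorem cost_earlyStop (hn : 1 ≤ n) (hnm : n ≤ m) :
    earlyStop.cost (sizes n m) ≤ 150 * (n ^ 2 * m) := by
  have := monomials_le hn hnm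
  simp only [earlyStop, emitEdges, countEdges, listEdges, edgeEntry, Expr.mat, Cmd.cost, Expr.cost,
    sizes]
  ring_nf at *
  linarith

end Costs

/-! ### Correctness, running time and word size of the whole program -/

section Algorithm

variable {n : ℕ} {L : List (Fin n × Fin n)} {σ : State}

/-- A graph without strong articulation points has at least as many edges as vertices. -/
theorem TwoVertexConnected.card_le {V : Type*} [Fintype V] {F : Finset (V × V)}
    (h : TwoVertexConnected (graph F)) : Fintype.card V ≤ F.card := by
  classical
  have h' := twoVertexConnected_graph.1 h
  have : (Finset.univ : Finset V) ⊆ F.image Prod.fst := by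
    intro u _
    obtain ⟨w, hw, -⟩ := exists_ne_of_three_le_card h'.1 u u
    rcases Relation.ReflTransGen.cases_head (h'.2.1 u w) with e | ⟨x, hx, -⟩
    · exact absurd e.symm hw
    · exact Finset.mem_image.2 ⟨(u, x), hx.2.2, rfl⟩
  exact (Finset.card_le_card this).trans Finset.card_image_le

theorem toFinset_filter_mem {F : Finset (Fin n × Fin n)} (h : F ⊆ L.toFinset) :
    (L.filter (· ∈ F)).toFinset = F := by
  ext e
  simp only [List.mem_toFinset, List.mem_filter, decide_eq_true_eq, and_iff_right_iff_imp]
  exact fun he => List.mem_toFinset.1 (h he)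

theorem algorithm_spec (hin : HasInput L σ) (h2 : ∀ i, σ.arr 2 i = 0) (ho : σ.out = [])
    (hL : L.Nodup) (hG : TwoVertexStronglyBiconnected (graph L.toFinset)) :
    Execution L.toFinset (algorithm.eval σ).out ∧
      algorithm.time σ ≤ 2000 * (n ^ 2 * L.length) := by
  have hn : 1 ≤ n := by
    have := hG.1
    rw [Nat.card_fin] at this
    omega
  have hnm : n ≤ L.length := by
    have := hG.twoVertexConnected.card_le
    rwa [Fintype.card_fin, List.toFinset_card_of_nodup hL] at this
  have hpos := (monomials_le hn hnm).1
  obtain ⟨F, hmin, m₁⟩ := minimize_spec hin h2 hG.twoVertexConnected hL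
  have hFL : F ⊆ L.toFinset := hmin.prop.1
  have hT : TwoVertexConnected (graph F) := hmin.prop.2
  have f₁ := Cmd.frame minimize σ
  have hin₁ := hin.frame f₁ rfl
  have o₁ : (minimize.eval σ).out = [] := (f₁.out rfl).trans ho
  set σ₁ := minimize.eval σ with hσ₁
  have o₂ := emitEdges_out hin₁ m₁
  have f₂ := Cmd.frame emitEdges σ₁
  have hin₂ := hin₁.frame f₂ rfl
  have m₂ : IsMatrix 2 F (emitEdges.eval σ₁) := m₁.congr (f₂.arr 2 rfl)
  set σ₂ := emitEdges.eval σ₁ with hσ₂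
  have p₃ := findPoints_spec hin₂ m₂ hFL hT hG.2.2
  have f₃ := Cmd.frame findPoints σ₂
  have hin₃ := hin₂.frame f₃ rfl
  set σ₃ := findPoints.eval σ₂ with hσ₃
  have t₄ := testGraph_spec (n := n) hin₃.var_zero
  have f₄ := Cmd.frame testGraph σ₃
  have hin₄ := hin₃.frame f₄ rfl
  have e₄ : prelude.eval σ = testGraph.eval σ₃ := by
    rw [prelude, Cmd.eval_seq, Cmd.eval_seq, Cmd.eval_seq]
  have a₄ : (testGraph.eval σ₃).arr 10 = σ₃.arr 10 := f₄.arr 10 rfl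
  have m₄ : IsMatrix 2 F (testGraph.eval σ₃) := m₂.congr ((f₄.arr 2 rfl).trans (f₃.arr 2 rfl))
  have o₄ : (testGraph.eval σ₃).out = encodeEdges (L.filter (· ∈ F)) := by
    rw [f₄.out rfl, f₃.out rfl, o₂, o₁, List.nil_append]
  set σ₄ := testGraph.eval σ₃ with hσ₄
  have test : TwoVertexStronglyBiconnected (graph F) ↔ σ₄.var 22 = 0 := by
    rw [hT.twoVertexStronglyBiconnected_iff, t₄]
    exact forall_congr' fun b => by rw [← p₃ b, not_not]
  have eF := toFinset_filter_mem hFL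
  have time : algorithm.time σ = prelude.time σ +
      (2 + if σ₄.var 22 ≠ 0 then lateStop.time σ₄ else earlyStop.time σ₄) := by
    simp only [algorithm, Cmd.time, e₄, Expr.cost, Expr.eval]
  have ev : algorithm.eval σ = if σ₄.var 22 ≠ 0 then lateStop.eval σ₄ else earlyStop.eval σ₄ := by
    rw [algorithm, Cmd.eval_seq, Cmd.eval_ite, e₄, Expr.eval]
  have tp := (hin.time_le (c := prelude) rfl).trans (cost_prelude hn hnm)
  rw [ev, time]
  by_cases h22 : σ₄.var 22 = 0
  · rw [if_neg (not_not.2 h22), if_neg (not_not.2 h22)]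
    have te := (hin₄.time_le (c := earlyStop) rfl).trans (cost_earlyStop hn hnm)
    refine ⟨?_, by omega⟩
    have e₅ : (Cmd.emit (.lit 1)).eval σ₄ = σ₄.write 1 := by rw [Cmd.eval_emit, Expr.eval]
    have f₅ := Cmd.frame (.emit (.lit 1)) σ₄
    rw [e₅] at f₅
    rw [earlyStop, Cmd.eval_seq, e₅, emitEdges_out (hin₄.frame f₅ rfl) (m₄.congr rfl),
      State.write_out, o₄]
    exact Execution.early _ (hL.filter _) (by rwa [eF]) (by rw [eF]; exact test.2 h22) _
      (hL.filter _) rfl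
  · rw [if_pos h22, if_pos h22]
    have e₅ : reportPoints.eval σ₄ = (emitSet 10).eval (σ₄.write 0) := by
      rw [reportPoints, Cmd.eval_seq, Cmd.eval_emit, Expr.eval]
    have f₅ := Cmd.frame reportPoints σ₄
    have hin₅ := hin₄.frame f₅ rfl
    have m₅ : IsMatrix 2 F (reportPoints.eval σ₄) := m₄.congr (f₅.arr 2 rfl)
    have a₅ : (reportPoints.eval σ₄).arr 10 = σ₃.arr 10 := (f₅.arr 10 rfl).trans a₄
    have o₅ : (reportPoints.eval σ₄).out =
        encodeEdges (L.filter (· ∈ F)) ++ [0] ++ encodeVertices (members n 10 σ₃) := by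
      rw [e₅, emitSet_out (n := n) (σ := σ₄.write 0) hin₄.var_zero, State.write_out, o₄]
      simp only [members, State.write_arr, a₄]
    have tr := (hin₄.time_le (c := reportPoints) rfl).trans (cost_reportPoints hn hnm)
    have tlate : lateStop.time σ₄ = reportPoints.time σ₄ + (treatPoints.time (reportPoints.eval σ₄)
        + emitEdges.time (treatPoints.eval (reportPoints.eval σ₄))) := by
      simp only [lateStop, Cmd.time]
    have elate : lateStop.eval σ₄ = emitEdges.eval (treatPoints.eval (reportPoints.eval σ₄)) := by
      rw [lateStop, Cmd.eval_seq, Cmd.eval_seq]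
    set σ₅ := reportPoints.eval σ₄ with hσ₅
    obtain ⟨F', τ, s1, s2, s3, s4, s5⟩ := treatPoints_spec hin₅ m₅ hFL hT hG.2.2
    have f₆ := Cmd.frame treatPoints σ₅
    have hin₆ := hin₅.frame f₆ rfl
    have hmem : members n 10 σ₅ = members n 10 σ₃ := by rw [members, a₅, members]
    rw [hmem] at s3
    have te : emitEdges.time (treatPoints.eval σ₅) ≤ 150 * (n ^ 2 * L.length) := by
      refine (hin₆.time_le (c := emitEdges) rfl).trans (le_trans ?_ (cost_earlyStop hn hnm))
      rw [earlyStop, Cmd.cost]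
      exact Nat.le_add_left _ _
    have ta := cost_addEdge hn hnm
    have tt := cost_treatPoint hn hnm
    -- The sum is `1005 + 2 + 100 + 507 + 224 + 150 ≤ 2000`; the `2` is the test of variable `22`.
    refine ⟨?_, by omega⟩
    rw [elate, emitEdges_out hin₆ s2, s4, o₅]
    refine Execution.main _ (hL.filter _) (by rwa [eF]) (by rw [eF]; exact fun h => h22 (test.1 h))
      _ ((List.nodup_finRange n).filter _) (fun b => ?_) _ F' (by rwa [eF]) _ (hL.filter _)
      (toFinset_filter_mem s1)
    rw [eF, ← p₃ b]
    simp

theorem hasInput_input : HasInput L ((input n L).setVar 2 (n + n)) := by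
  refine ⟨rfl, rfl, by simp, fun i hi => ?_, fun i hi => ?_⟩ <;> simp [input, hi]

theorem bounded_input : ((input n L).setVar 2 (n + n)).Bounded (n + n + L.length) := by
  have key : ∀ (f : Fin n × Fin n → Fin n) (i : ℕ),
      (L.map fun e => (f e : ℕ)).getD i 0 ≤ n + n + L.length := by
    intro f i
    by_cases hi : i < L.length
    · have := (f L[i]).2
      simp [hi]
      omega
    · simp [hi]
  refine State.Bounded.setVar ⟨fun x => ?_, fun a i => ?_⟩ (by omega)
  · simp only [input]
    split_ifs <;> omega
  · simp only [input]
    split_ifs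
    exacts [key Prod.fst i, key Prod.snd i, Nat.zero_le _]

-- The base is at most `2001 * (n + 2) ^ 4`, and `2001 ≤ 2 ^ 11 ≤ (n + 2) ^ 11` raises the exponent
-- to `15`. The power `20` from the cost of expressions gives `300`, and one more makes the
-- inequality strict.
set_option exponentiation.threshold 400 in
theorem word_size_bound {n m t : ℕ} (hm : m ≤ n * n) (ht : t ≤ 2000 * (n ^ 2 * m)) :
    (n + n + m + t + 2) ^ 20 < (n + 2) ^ 301 := by
  have h1 : n ^ 2 * m ≤ (n + 2) ^ 4 := by
    calc n ^ 2 * m ≤ n ^ 2 * (n * n) := Nat.mul_le_mul_left _ hm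
      _ = n ^ 4 := by ring
      _ ≤ _ := Nat.pow_le_pow_left (by omega) 4
  have h2 : (n + 2) ^ 2 ≤ (n + 2) ^ 4 := Nat.pow_le_pow_right (by omega) (by omega)
  have h3 : n + n + m + 2 ≤ (n + 2) ^ 2 := by nlinarith
  have h4 : 2 ^ 11 ≤ (n + 2) ^ 11 := Nat.pow_le_pow_left (by omega) 11
  have h5 : n + n + m + t + 2 ≤ (n + 2) ^ 15 := by
    calc n + n + m + t + 2 ≤ 2 ^ 11 * (n + 2) ^ 4 := by omega
      _ ≤ (n + 2) ^ 11 * (n + 2) ^ 4 := Nat.mul_le_mul_right _ h4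
      _ = (n + 2) ^ 15 := by rw [← pow_add]
  calc (n + n + m + t + 2) ^ 20 ≤ ((n + 2) ^ 15) ^ 20 := Nat.pow_le_pow_left h5 20
    _ = (n + 2) ^ (15 * 20) := (pow_mul _ _ _).symm
    _ < (n + 2) ^ 301 := Nat.pow_lt_pow_right (by omega) (by omega)

end Algorithm

end SB

theorem mainTheorem3 :
    ∃ (P : SB.Program) (c C : ℕ),
      ∀ (n : ℕ) (L : List (Fin n × Fin n)), L.Nodup →
        SB.TwoVertexStronglyBiconnected (SB.graph L.toFinset) →
        ∃ (t : ℕ) (σ : SB.State),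
          SB.Exec ((n + 2) ^ c) P (SB.input n L) t σ ∧
          SB.Execution L.toFinset σ.out ∧
          t ≤ C * (n ^ 2 * L.length) := by
  -- The initial assignment provides the loop bound `n + n` for walks in the tree. It takes 4 steps,
  -- which explains `2004`.
  refine ⟨.seq (.assign 2 (.op .add (.var 0) (.var 0))) SB.algorithm.compile, 301, 2004,
    fun n L hL hG => ?_⟩
  obtain ⟨hx, ht⟩ := SB.algorithm_spec (σ := (SB.input n L).setVar 2 (n + n)) SB.hasInput_input
    (fun i => by simp [SB.input]) rfl hL hG
  have hm : L.length ≤ n * n := by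
    rw [← List.toFinset_card_of_nodup hL]
    simpa using L.toFinset.card_le_univ
  have hW := SB.word_size_bound hm ht
  obtain ⟨he, -⟩ := SB.algorithm.exec rfl _ _ SB.bounded_input hW
  have hfit : n + n < (n + 2) ^ 301 := by
    refine lt_of_le_of_lt ?_ ((Nat.le_self_pow (n := 20) (by omega) _).trans_lt hW)
    omega
  refine ⟨_, _, SB.Exec.seq (SB.Exec.assign ?_) he, hx, ?_⟩
  · refine ⟨?_, ?_, hfit⟩ <;> exact lt_of_le_of_lt (Nat.le_add_right n n) hfit
  · have h3 := hG.1
    rw [Nat.card_fin] at h3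
    have hnm := hG.twoVertexConnected.card_le
    rw [Fintype.card_fin, List.toFinset_card_of_nodup hL] at hnm
    have := (SB.monomials_le (by omega) hnm).1
    simp only [SB.Expr.cost]
    omega
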